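/- **Model.** An abstract object is $\mathcal O=(Q,q_0,O,R,\Delta)$ with $\Delta:Q\times O\to Q\times R$ deterministic. An operation $o$ is *state-changing* if $\Delta(q,o)$ has state component $\ne q$ for some $q\in Q$, and *read-only* otherwise. Processes $p_1,\dots,p_n$ communicate through atomic CAS base objects (with primitives Read, Write, and $\mathrm{CAS}(X,old,new)$); each step of a process is one primitive on one base object plus local computation, and may return a response. Each process has at most one pending operation. The *memory representation* of a finite execution is the vector of states of all base objects in its last configuration; local variables are not part of it. **R-LLSC objects from CAS.** A releasable LL/SC object with values in $V$ is stored in one CAS object $X$ with state $(v,c)\in V\times\{0,1\}^n$ (value and context), initially $(v_0,0)$. Code for $p_i$: * $\mathrm{LL}$: repeat $cur\gets\mathrm{Read}(X)$ until $\mathrm{CAS}(X,cur,cur\text{ with }c_i:=1)$ succeeds; return $cur.v$. * $\mathrm{SC}(v)$: repeat: $cur\gets\mathrm{Read}(X)$; if $cur.c_i=0$ return false; if $\mathrm{CAS}(X,cur,(v,0))$ succeeds return true. * $\mathrm{RL}$: repeat: $cur\gets\mathrm{Read}(X)$; if $cur.c_i=0$ return true; if $\mathrm{CAS}(X,cur,cur\text{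 with }c_i:=0)$ succeeds return true. * $\mathrm{VL}$: read $X$, return whether $c_i=1$. $\mathrm{Load}$: read $X$, return $v$. $\mathrm{Store}(v)$: $\mathrm{Write}(X,(v,0))$. **Universal implementation** of $\mathcal O$. Shared R-LLSC variables, each implemented as above: $head$, with values in $Q\times(\{\bot\}\cup R\times\{1,\dots,n\})$, initially $\langle q_0,\bot\rangle$; and $announce[1..n]$, with values in the disjoint union $\{\bot\}\sqcup O\sqcup R$, initially $\bot$. Each $p_i$ has a local variable $priority_i$, initially $i$, which it keeps between operations. In "$A \parallel B$" the process interleaves the steps of $A$ and $B$, taking an unspecified but finite number of steps on one side before switching; the block ends when $A$ finishes or when $B$ executes its goto. A read-only $op$ by $p_i$: $\langle q,\_\rangle\gets\mathrm{Load}(head)$; return the response in $\Delta(q,op)$. A state-changing $op$ by $p_i$: 1. $\mathrm{Store}(announce[i],op)$. 2. While $\mathrm{Load}(announce[i])\notin R$: * (a) $\langle q,r\rangle\gets\mathrm{LL}(head)\ \parallel\ $ wait until $\mathrm{Load}(announce[i])\in R$; goto 3. * (b) If $r=\bot$: $help\gets\mathrm{Load}(announce[priority_i])$. If $help\in O$,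 let $(o,j)=(help,priority_i)$. Otherwise, if $\mathrm{Load}(announce[i])\notin O$, restart the loop; else let $(o,j)=(op,i)$. Let $(q',rsp)=\Delta(q,o)$. If $\mathrm{SC}(head,\langle q',\langle rsp,j\rangle\rangle)$ succeeds, advance $priority_i$ by one, cyclically in $\{1,\dots,n\}$. * (c) If $r=\langle rsp,j\rangle$: $a\gets\mathrm{LL}(announce[j])\ \parallel\ $ wait until $\mathrm{Load}(announce[i])\in R$; $\mathrm{RL}(announce[j])$; goto 3. Then, if $\mathrm{VL}(head)$ is true: if $a\in O$ do $\mathrm{SC}(announce[j],rsp)$; then (in either case) $\mathrm{SC}(head,\langle q,\bot\rangle)$. Finally, whatever $\mathrm{VL}$ returned, if $a=\bot$ do $\mathrm{RL}(announce[j])$. 3. $response\gets\mathrm{Load}(announce[i])$. 4. $\langle q,r\rangle\gets\mathrm{LL}(head)\ \parallel\ $ wait until $\mathrm{Load}(head)$ is not of the form $\langle\_,\langle\_,i\rangle\rangle$; goto the $\mathrm{RL}(head)$ in 5. 5. If $r=\langle\_,i\rangle$ do $\mathrm{SC}(head,\langle q,\bot\rangle)$, else $\mathrm{RL}(head)$.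 6. $\mathrm{Store}(announce[i],\bot)$; return $response$. **Theorem.** For every abstract object $\mathcal O$ and every $n$, this implementation of $\mathcal O$ for $n$ processes from atomic CAS objects is * *linearizable*: every execution has a linearization; * *wait-free*: every pending operation returns after finitely many steps of the process that invoked it; * *state-quiescent history independent*: there is a function $h$ that maps every finite execution $\alpha$ to a linearization $h(\alpha)$ of it such that, whenever $\alpha,\alpha'$ are finite executions after which no state-changing operation is pending, and $h(\alpha)$ and $h(\alpha')$ lead $\mathcal O$ from $q_0$ to the same state, the memory representations after $\alpha$ and $\alpha'$ are equal. If $Q$, $O$ and $R$ are finite, the CAS object that stores $head$ has $|Q|\,(n|R|+1)\,2^n$ possible states and the one that stores $announce[j]$ has $(|O|+|R|+1)\,2^n$. -/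

import Mathlib

universe u v w

/-! ## Abstract objects -/

/-- A deterministic abstract object `(Q, q₀, O, R, Δ)`. -/
structure AbstractObject : Type (u + 1) where
  State : Type u
  init : State
  Op : Type u
  Resp : Type u
  Δ : State → Op → State × Resp

namespace AbstractObject

/-- An operation is state-changing if it moves the object from some state to a different one. -/
def StateChanging (𝒪 : AbstractObject.{u}) (o : 𝒪.Op) : Prop :=
  ∃ q : 𝒪.State, (𝒪.Δ q o).1 ≠ q

/-- An operation is read-only if it is not state-changing. -/
def ReadOnly (𝒪 : AbstractObject.{u}) (o : 𝒪.Op) : Prop :=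
  ¬ 𝒪.StateChanging o

end AbstractObject

/-! ## The asynchronous shared-memory model with atomic CAS base objects -/

/-- One atomic primitive on one CAS base object (`read`, `write` or `cas`), followed by a local
computation that turns the response of the primitive into a result of type `β`.
`Val b` is the state space of the base object `b`. -/
inductive Access (Base : Type v) (Val : Base → Type u) (β : Type w) where
  | read (b : Base) (k : Val b → β)
  | write (b : Base) (x : Val b) (k : β)
  | cas (b : Base) (old new : Val b) (k : Bool → β)

namespace Access

variable {Base : Type v} {Val : Base → Type u} {β : Type w}

/-- Post-compose the local computation of an access. -/
def map {γ : Type*} (f : β → γ) : Access Base Val β → Access Base Val γ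
  | read b k => read b fun x => f (k x)
  | write b x k => write b x (f k)
  | cas b old new k => cas b old new fun c => f (k c)

open Classical in
/-- The effect of an access on the shared memory, and its result. -/
noncomputable def exec : Access Base Val β → (∀ b, Val b) → (∀ b, Val b) × β
  | read b k, mem => (mem, k (mem b))
  | write b x k, mem => (Function.update mem b x, k)
  | cas b old new k, mem =>
      if mem b = old then (Function.update mem b new, k true) else (mem, k false)

end Access

/-- The two sides of an interleaved block `left ∥ right` of a program. -/
inductive Side where
  | left
  | right

/-- An implementation of an abstract object for `n` processes from CAS base objects.

A program may contain interleaved blocks `left ∥ right`: in such a block every step is taken on one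
of the two sides. Which side moves next is not determined by the program, so `step` gets the side as
an argument (outside such blocks it is ignored). `mustServe s l` says that a process in local state
`l` is in an interleaved block whose side `s` it may not neglect forever. -/
structure Implementation (𝒪 : AbstractObject.{u}) (n : ℕ) where
  /-- the base objects -/
  Base : Type
  /-- the state space of each base object -/
  Val : Base → Type u
  /-- the initial shared memory -/
  initMem : ∀ b, Val b
  /-- the local states of a process -/
  Local : Type u
  initLocal : Fin n → Local
  /-- the local state when an operation is invoked -/
  start : Fin n → 𝒪.Op → Local → Local
  /-- the next step: one primitive, then a new local state and possibly a response -/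
  step : Fin n → Side → Local → Access Base Val (Local × Option 𝒪.Resp)
  mustServe : Side → Local → Prop

/-- Invocations and responses of higher-level operations. -/
inductive Event (𝒪 : AbstractObject.{u}) (n : ℕ) where
  | inv (p : Fin n) (o : 𝒪.Op)
  | res (p : Fin n) (r : 𝒪.Resp)

/-- The process of an event. -/
def Event.proc {𝒪 : AbstractObject.{u}} {n : ℕ} : Event 𝒪 n → Fin n
  | inv p _ => p
  | res p _ => p

/-- The labels of an execution: an invocation of an operation, or a step of a process, taken on a
given side, that possibly returns a response. -/
inductive ExecAction (𝒪 : AbstractObject.{u}) (n : ℕ) where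
  | invoke (p : Fin n) (o : 𝒪.Op)
  | step (p : Fin n) (s : Side) (r : Option 𝒪.Resp)

/-- The event of the history, if any, at an action of an execution. -/
def ExecAction.event {𝒪 : AbstractObject.{u}} {n : ℕ} : ExecAction 𝒪 n → Option (Event 𝒪 n)
  | invoke p o => some (Event.inv p o)
  | step p _ r => r.map (Event.res p)

/-- A history. The index is the position in the execution; positions without an invocation or a
response hold `none`. -/
abbrev History (𝒪 : AbstractObject.{u}) (n : ℕ) := ℕ → Option (Event 𝒪 n)

/-- In `H`, the operation invoked at position `t` returns the response `r` at position `t'`. -/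
def Returns {𝒪 : AbstractObject.{u}} {n : ℕ} (H : History 𝒪 n) (t t' : ℕ) (r : 𝒪.Resp) : Prop :=
  ∃ p o, H t = some (Event.inv p o) ∧ t < t' ∧ H t' = some (Event.res p r) ∧
    ∀ x, t < x → x < t' → ∀ e, H x = some e → e.proc ≠ p

/-! ## Linearizability -/

/-- An operation of a sequential history: the invocation of `op` by `proc`, immediately followed by
the response `resp`. The position `time` of the invocation in the concurrent history identifies the
operation. -/
structure SeqOp (𝒪 : AbstractObject.{u}) (n : ℕ) where
  time : ℕ
  proc : Fin n
  op : 𝒪.Op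
  resp : 𝒪.Resp

/-- The state reached by a finite sequential history. -/
def seqState (𝒪 : AbstractObject.{u}) {n : ℕ} (L : List (SeqOp 𝒪 n)) : 𝒪.State :=
  L.foldl (fun q e => (𝒪.Δ q e.op).1) 𝒪.init

/-- The finite or infinite sequential history `L` (`L k` is its `k`-th operation, if there is one)
is a linearization of the history `H`. -/
structure IsLinearization (𝒪 : AbstractObject.{u}) {n : ℕ} (H : History 𝒪 n)
    (L : ℕ → Option (SeqOp 𝒪 n)) : Prop where
  /-- `L` is a finite or infinite sequence, without gaps -/
  no_gap : ∀ k, L k = none → L (k + 1) = none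
  /-- every operation of `L` is an operation of `H` -/
  mem_history : ∀ k e, L k = some e → H e.time = some (Event.inv e.proc e.op)
  /-- no operation of `H` occurs twice -/
  nodup : ∀ k k' e e', L k = some e → L k' = some e' → e.time = e'.time → k = k'
  /-- every completed operation of `H` occurs (pending ones may be completed or dropped) -/
  complete : ∀ t t' r, Returns H t t' r → ∃ k e, L k = some e ∧ e.time = t
  /-- completed operations have the response that they have in `H` -/
  same_resp : ∀ k e t' r, L k = some e → Returns H e.time t' r → e.resp = r
  /-- `L` matches the sequential specification -/
  spec : ∃ q : ℕ → 𝒪.State, q 0 = 𝒪.init ∧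
    ∀ k e, L k = some e → 𝒪.Δ (q k) e.op = (q (k + 1), e.resp)
  /-- `L` respects the real-time order of non-overlapping operations -/
  real_time : ∀ k k' e e' t' r, L k = some e → L k' = some e' →
    Returns H e.time t' r → t' < e'.time → k < k'

namespace Implementation

variable {𝒪 : AbstractObject.{u}} {n : ℕ}

/-! ## Configurations and executions -/

/-- A configuration: the shared memory (the memory representation), the local state of every process
and its pending operation, if any. -/
structure Config (I : Implementation 𝒪 n) where
  mem : ∀ b, I.Val b
  loc : Fin n → I.Local
  pending : Fin n → Option 𝒪.Op

/-- The unique initial configuration. -/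
def initConfig (I : Implementation 𝒪 n) : I.Config where
  mem := I.initMem
  loc := I.initLocal
  pending := fun _ => none

/-- The configuration after an invocation of `o` by `p`. -/
def afterInvoke (I : Implementation 𝒪 n) (C : I.Config) (p : Fin n) (o : 𝒪.Op) : I.Config where
  mem := C.mem
  loc := Function.update C.loc p (I.start p o (C.loc p))
  pending := Function.update C.pending p (some o)

/-- New memory, new local state and response of the next step of `p`, taken on side `s`. -/
noncomputable def outcome (I : Implementation 𝒪 n) (C : I.Config) (p : Fin n) (s : Side) :
    (∀ b, I.Val b) × (I.Local × Option 𝒪.Resp) :=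
  (I.step p s (C.loc p)).exec C.mem

/-- The configuration after a step of `p` on side `s`. -/
noncomputable def afterStep (I : Implementation 𝒪 n) (C : I.Config) (p : Fin n) (s : Side) :
    I.Config where
  mem := (I.outcome C p s).1
  loc := Function.update C.loc p (I.outcome C p s).2.1
  pending := match (I.outcome C p s).2.2 with
    | none => C.pending
    | some _ => Function.update C.pending p none

/-- The transition relation: an idle process may receive any invocation, a process with a pending
operation may take its next step. -/
inductive Step (I : Implementation 𝒪 n) : I.Config → ExecAction 𝒪 n → I.Config → Prop where
  | invoke (C : I.Config) (p : Fin n) (o : 𝒪.Op) (h : C.pending p = none) :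
      Step I C (ExecAction.invoke p o) (I.afterInvoke C p o)
  | step (C : I.Config) (p : Fin n) (s : Side) (h : C.pending p ≠ none) :
      Step I C (ExecAction.step p s (I.outcome C p s).2.2) (I.afterStep C p s)

/-- `I.Reach as C`: the actions `as`, performed from the initial configuration, lead to `C`. -/
inductive Reach (I : Implementation 𝒪 n) : List (ExecAction 𝒪 n) → I.Config → Prop where
  | nil : Reach I [] I.initConfig
  | snoc {as : List (ExecAction 𝒪 n)} {C C' : I.Config} {a : ExecAction 𝒪 n} :
      Reach I as C → I.Step C a C' → Reach I (as ++ [a]) C'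

/-- Finite executions. The intermediate configurations are determined by the actions. -/
structure FinExec (I : Implementation 𝒪 n) where
  acts : List (ExecAction 𝒪 n)
  last : I.Config
  reach : I.Reach acts last

/-- Infinite executions. -/
structure InfExec (I : Implementation 𝒪 n) where
  cfg : ℕ → I.Config
  act : ℕ → ExecAction 𝒪 n
  init : cfg 0 = I.initConfig
  step : ∀ t, I.Step (cfg t) (act t) (cfg (t + 1))

/-- The history of a finite execution. -/
def FinExec.history {I : Implementation 𝒪 n} (α : I.FinExec) : History 𝒪 n :=
  fun t => α.acts[t]?.bind ExecAction.event

/-- The history of an infinite execution. -/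
def InfExec.history {I : Implementation 𝒪 n} (ρ : I.InfExec) : History 𝒪 n :=
  fun t => (ρ.act t).event

/-! ## Correctness, progress and history independence -/

/-- Every execution, finite or infinite, has a linearization. -/
def Linearizable (I : Implementation 𝒪 n) : Prop :=
  (∀ α : I.FinExec, ∃ L : List (SeqOp 𝒪 n), IsLinearization 𝒪 α.history fun k => L[k]?) ∧
  (∀ ρ : I.InfExec, ∃ L : ℕ → Option (SeqOp 𝒪 n), IsLinearization 𝒪 ρ.history L)

/-- Process `p` takes infinitely many steps in `ρ`. -/
def InfExec.StepsInfinitely {I : Implementation 𝒪 n} (ρ : I.InfExec) (p : Fin n) : Prop :=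
  {t | ∃ s r, ρ.act t = ExecAction.step p s r}.Infinite

/-- The meaning of `left ∥ right`: a process takes an unspecified but finite number of steps on one
side before it switches to the other one. So a process that takes infinitely many steps and never
leaves an interleaved block keeps taking steps on each side that it must serve. -/
def InfExec.FairInterleaving {I : Implementation 𝒪 n} (ρ : I.InfExec) : Prop :=
  ∀ (p : Fin n) (s : Side) (T : ℕ), ρ.StepsInfinitely p →
    (∀ t, T ≤ t → I.mustServe s ((ρ.cfg t).loc p)) →
      ∃ t r, T ≤ t ∧ ρ.act t = ExecAction.step p s r

/-- Every operation returns after finitely many steps of the process that invoked it. -/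
def WaitFree (I : Implementation 𝒪 n) : Prop :=
  ∀ ρ : I.InfExec, ρ.FairInterleaving → ∀ (t : ℕ) (p : Fin n) (o : 𝒪.Op),
    ρ.history t = some (Event.inv p o) → ρ.StepsInfinitely p →
      ∃ t' r, Returns ρ.history t t' r

/-- History independence with respect to a set `E` of finite executions: for some linearization
function `h`, executions in `E` that end in the same state according to `h` end with the same
memory representation. -/
def HistoryIndependent (I : Implementation 𝒪 n) (E : Set I.FinExec) : Prop :=
  ∃ h : I.FinExec → List (SeqOp 𝒪 n),
    (∀ α, IsLinearization 𝒪 α.history fun k => (h α)[k]?) ∧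
    ∀ α ∈ E, ∀ β ∈ E, seqState 𝒪 (h α) = seqState 𝒪 (h β) → α.last.mem = β.last.mem

/-- A configuration is state-quiescent if no state-changing operation is pending. -/
def Config.StateQuiescent {I : Implementation 𝒪 n} (C : I.Config) : Prop :=
  ∀ p o, C.pending p = some o → ¬ 𝒪.StateChanging o

/-- History independence with respect to all finite executions that end in a state-quiescent
configuration. -/
def StateQuiescentHI (I : Implementation 𝒪 n) : Prop :=
  I.HistoryIndependent {α | α.last.StateQuiescent}

end Implementation

/-! ## Releasable LL/SC objects from CAS

The R-LLSC object `b` with values in `W b` is stored in one CAS base object, whose state is a value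
together with one bit per process for the context. -/

/-- The state of the CAS object that stores an R-LLSC object: a value and the context bits. -/
@[ext]
structure Cell (W : Type u) (n : ℕ) where
  val : W
  context : Fin n → Bool

/-- A cell with empty context. -/
def Cell.fresh {W : Type u} {n : ℕ} (x : W) : Cell W n := ⟨x, fun _ => false⟩

/-- Overwrite the context bit of process `i`. -/
def Cell.setBit {W : Type u} {n : ℕ} (c : Cell W n) (i : Fin n) (x : Bool) : Cell W n :=
  ⟨c.val, Function.update c.context i x⟩

/-- Program counter of the procedures LL, SC and RL: about to read the CAS object, or about to
perform a CAS with expected value `cur`. -/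
inductive Retry (W : Type u) (n : ℕ) : Type u where
  | read
  | cas (cur : Cell W n)

namespace RLLSC

variable {Base : Type v} {W : Base → Type u} {n : ℕ} {β : Type w}

/-- The next step of LL on `b` by process `i`. The result is a new program counter (`inl`) or the
returned value (`inr`). -/
def ll (b : Base) (i : Fin n) :
    Retry (W b) n → Access Base (fun b => Cell (W b) n) (Retry (W b) n ⊕ W b)
  | .read => .read b fun cur => .inl (.cas cur)
  | .cas cur => .cas b cur (cur.setBit i true) fun ok => if ok then .inr cur.val else .inl .read

/-- The next step of SC of `x` to `b` by process `i`. -/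
def sc (b : Base) (i : Fin n) (x : W b) :
    Retry (W b) n → Access Base (fun b => Cell (W b) n) (Retry (W b) n ⊕ Bool)
  | .read => .read b fun cur => if cur.context i then .inl (.cas cur) else .inr false
  | .cas cur => .cas b cur (Cell.fresh x) fun ok => if ok then .inr true else .inl .read

/-- The next step of RL on `b` by process `i`. -/
def rl (b : Base) (i : Fin n) :
    Retry (W b) n → Access Base (fun b => Cell (W b) n) (Retry (W b) n ⊕ Bool)
  | .read => .read b fun cur => if cur.context i then .inl (.cas cur) else .inr true
  | .cas cur => .cas b cur (cur.setBit i false) fun ok => if ok then .inr true else .inl .read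

/-- VL on `b` by process `i`: a single read. -/
def vl (b : Base) (i : Fin n) : Access Base (fun b => Cell (W b) n) Bool :=
  .read b fun cur => cur.context i

/-- Load of `b`: a single read. -/
def load (b : Base) : Access Base (fun b => Cell (W b) n) (W b) :=
  .read b fun cur => cur.val

/-- Store of `x` to `b`: a single write. -/
def store (b : Base) (x : W b) : Access Base (fun b => Cell (W b) n) Bool :=
  .write b (Cell.fresh x) true

end RLLSC

/-! ## The universal implementation -/

namespace Universal

/-- The R-LLSC variables: `head` and the array `announce`. -/
inductive Var (n : ℕ) : Type where
  | head
  | announce (j : Fin n)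

/-- Values of `head`: `⟨q, ⊥⟩` or `⟨q, ⟨r, j⟩⟩`. -/
abbrev HeadVal (𝒪 : AbstractObject.{u}) (n : ℕ) : Type u := 𝒪.State × Option (𝒪.Resp × Fin n)

/-- Values of a cell of `announce`: the disjoint union of `{⊥}`, the operations and the
responses. -/
inductive AnnVal (𝒪 : AbstractObject.{u}) : Type u where
  | bot
  | op (o : 𝒪.Op)
  | rsp (r : 𝒪.Resp)

/-- The value domain of each R-LLSC variable. -/
def Dom (𝒪 : AbstractObject.{u}) (n : ℕ) : Var n → Type u
  | .head => HeadVal 𝒪 n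
  | .announce _ => AnnVal 𝒪

/-- The state space of the CAS object behind each R-LLSC variable. -/
abbrev CellOf (𝒪 : AbstractObject.{u}) (n : ℕ) (b : Var n) : Type u := Cell (Dom 𝒪 n b) n

/-- Program counters; each one stands for the next R-LLSC operation, together with the local
variables that are still needed. `op` is the operation being executed. -/
inductive PC (𝒪 : AbstractObject.{u}) (n : ℕ) : Type u where
  /-- no operation is being executed -/
  | idle
  /-- read-only operations: `Load(head)` -/
  | readOnly (op : 𝒪.Op)
  /-- `Store(announce[i], op)` -/
  | announceOp (op : 𝒪.Op)
  /-- loop test: `Load(announce[i]) ∉ R` -/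
  | loopTest (op : 𝒪.Op)
  /-- `⟨q, r⟩ ← LL(head)  ∥  wait until Load(announce[i]) ∈ R; goto loadResponse` -/
  | llHead (op : 𝒪.Op) (c : Retry (HeadVal 𝒪 n) n)
  /-- `help ← Load(announce[priority])` -/
  | loadHelp (op : 𝒪.Op) (q : 𝒪.State)
  /-- `Load(announce[i]) ∉ O` -/
  | loadOwn (op : 𝒪.Op) (q : 𝒪.State)
  /-- `SC(head, ⟨state, ⟨rsp, j⟩⟩)` -/
  | scApply (op : 𝒪.Op) (state : 𝒪.State) (rsp : 𝒪.Resp) (j : Fin n)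
      (c : Retry (HeadVal 𝒪 n) n)
  /-- `a ← LL(announce[j])  ∥  wait until Load(announce[i]) ∈ R; RL(announce[j]);
  goto loadResponse`. The program counter of the right side is `none` while it waits and
  `some d` when it executes `RL(announce[j])`. -/
  | llAnnounce (op : 𝒪.Op) (q : 𝒪.State) (rsp : 𝒪.Resp) (j : Fin n)
      (c : Retry (AnnVal 𝒪) n) (right : Option (Retry (AnnVal 𝒪) n))
  /-- `VL(head)` -/
  | vlHead (op : 𝒪.Op) (q : 𝒪.State) (rsp : 𝒪.Resp) (j : Fin n) (a : AnnVal 𝒪)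
  /-- `SC(announce[j], rsp)` -/
  | scAnnounce (op : 𝒪.Op) (q : 𝒪.State) (rsp : 𝒪.Resp) (j : Fin n) (a : AnnVal 𝒪)
      (c : Retry (AnnVal 𝒪) n)
  /-- `SC(head, ⟨q, ⊥⟩)` inside the loop -/
  | scHeadBot (op : 𝒪.Op) (q : 𝒪.State) (j : Fin n) (a : AnnVal 𝒪)
      (c : Retry (HeadVal 𝒪 n) n)
  /-- `RL(announce[j])` -/
  | rlAnnounce (op : 𝒪.Op) (j : Fin n) (c : Retry (AnnVal 𝒪) n)
  /-- `response ← Load(announce[i])` -/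
  | loadResponse
  /-- `⟨q, r⟩ ← LL(head)  ∥  wait until Load(head) ≠ ⟨_, ⟨_, i⟩⟩; goto rlHead` -/
  | llHeadEnd (response : 𝒪.Resp) (c : Retry (HeadVal 𝒪 n) n)
  /-- `SC(head, ⟨q, ⊥⟩)` after the loop -/
  | scHeadEnd (response : 𝒪.Resp) (q : 𝒪.State) (c : Retry (HeadVal 𝒪 n) n)
  /-- `RL(head)` -/
  | rlHead (response : 𝒪.Resp) (c : Retry (HeadVal 𝒪 n) n)
  /-- `Store(announce[i], ⊥)`, then return -/
  | clearAnnounce (response : 𝒪.Resp)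

/-- The local state of a process: the variable `priority`, which survives between operations, and
the program counter. -/
structure LocalState (𝒪 : AbstractObject.{u}) (n : ℕ) : Type u where
  priority : Fin n
  pc : PC 𝒪 n

/-- Successor modulo `n`. -/
def succMod {n : ℕ} (p : Fin n) : Fin n :=
  ⟨(p.1 + 1) % n, Nat.mod_lt _ (Nat.lt_of_le_of_lt (Nat.zero_le _) p.2)⟩

variable {𝒪 : AbstractObject.{u}} {n : ℕ}

/-- The end of the branch in which `head` held a response:
`if a = ⊥ then RL(announce[j])`, then back to the loop test. -/
def afterHelp (op : 𝒪.Op) (j : Fin n) : AnnVal 𝒪 → PC 𝒪 n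
  | .bot => .rlAnnounce op j .read
  | .op _ => .loopTest op
  | .rsp _ => .loopTest op

open Classical in
/-- An invocation starts `ApplyReadOnly` or `Apply`, depending on the operation. -/
noncomputable def start (op : 𝒪.Op) (l : LocalState 𝒪 n) : LocalState 𝒪 n :=
  { l with pc := if 𝒪.ReadOnly op then .readOnly op else .announceOp op }

/-- Continue with program counter `pc`, without returning. -/
def goto (l : LocalState 𝒪 n) (pc : PC 𝒪 n) : LocalState 𝒪 n × Option 𝒪.Resp :=
  ({ l with pc := pc }, none)

/-- Return the response `r`. -/
def ret (l : LocalState 𝒪 n) (r : 𝒪.Resp) : LocalState 𝒪 n × Option 𝒪.Resp :=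
  ({ l with pc := .idle }, some r)

/-- The next step of process `i`: the next primitive of the R-LLSC operation being executed, and
all local computation up to the primitive after it. -/
def step (i : Fin n) (s : Side) (l : LocalState 𝒪 n) :
    Access (Var n) (CellOf 𝒪 n) (LocalState 𝒪 n × Option 𝒪.Resp) :=
  match l.pc with
  -- never executed: a process without pending operation takes no steps
  | .idle => (RLLSC.load (W := Dom 𝒪 n) .head).map fun _ => goto l .idle
  | .readOnly op => (RLLSC.load (W := Dom 𝒪 n) .head).map fun (v : HeadVal 𝒪 n) =>
      ret l (𝒪.Δ v.1 op).2
  | .announceOp op => (RLLSC.store (W := Dom 𝒪 n) (.announce i) (AnnVal.op op)).map fun _ =>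
      goto l (.loopTest op)
  | .loopTest op => (RLLSC.load (W := Dom 𝒪 n) (.announce i)).map fun (v : AnnVal 𝒪) =>
      match v with
      | .rsp _ => goto l .loadResponse
      | _ => goto l (.llHead op .read)
  | .llHead op c =>
      match s with
      | .left => (RLLSC.ll (W := Dom 𝒪 n) .head i c).map fun
          (x : Retry (HeadVal 𝒪 n) n ⊕ HeadVal 𝒪 n) =>
          match x with
          | .inl c' => goto l (.llHead op c')
          | .inr (q, none) => goto l (.loadHelp op q)
          | .inr (q, some (rsp, j)) => goto l (.llAnnounce op q rsp j .read none)
      | .right => (RLLSC.load (W := Dom 𝒪 n) (.announce i)).map fun (v : AnnVal 𝒪) =>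
          match v with
          | .rsp _ => goto l .loadResponse
          | _ => goto l (.llHead op c)
  | .loadHelp op q =>
      (RLLSC.load (W := Dom 𝒪 n) (.announce l.priority)).map fun (v : AnnVal 𝒪) =>
        match v with
        | .op help => goto l (.scApply op (𝒪.Δ q help).1 (𝒪.Δ q help).2 l.priority .read)
        | _ => goto l (.loadOwn op q)
  | .loadOwn op q => (RLLSC.load (W := Dom 𝒪 n) (.announce i)).map fun (v : AnnVal 𝒪) =>
      match v with
      | .op _ => goto l (.scApply op (𝒪.Δ q op).1 (𝒪.Δ q op).2 i .read)
      | _ => goto l (.loopTest op)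
  | .scApply op state rsp j c =>
      (RLLSC.sc (W := Dom 𝒪 n) .head i (state, some (rsp, j)) c).map fun
        (x : Retry (HeadVal 𝒪 n) n ⊕ Bool) =>
        match x with
        | .inl c' => goto l (.scApply op state rsp j c')
        | .inr true => goto { l with priority := succMod l.priority } (.loopTest op)
        | .inr false => goto l (.loopTest op)
  | .llAnnounce op q rsp j c right =>
      match s, right with
      | .left, _ => (RLLSC.ll (W := Dom 𝒪 n) (.announce j) i c).map fun
          (x : Retry (AnnVal 𝒪) n ⊕ AnnVal 𝒪) =>
          match x with
          | .inl c' => goto l (.llAnnounce op q rsp j c' right)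
          | .inr a => goto l (.vlHead op q rsp j a)
      | .right, none => (RLLSC.load (W := Dom 𝒪 n) (.announce i)).map fun (v : AnnVal 𝒪) =>
          match v with
          | .rsp _ => goto l (.llAnnounce op q rsp j c (some .read))
          | _ => goto l (.llAnnounce op q rsp j c none)
      | .right, some d => (RLLSC.rl (W := Dom 𝒪 n) (.announce j) i d).map fun
          (x : Retry (AnnVal 𝒪) n ⊕ Bool) =>
          match x with
          | .inl d' => goto l (.llAnnounce op q rsp j c (some d'))
          | .inr _ => goto l .loadResponse
  | .vlHead op q rsp j a => (RLLSC.vl (W := Dom 𝒪 n) .head i).map fun ok =>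
      match ok, a with
      | true, .op _ => goto l (.scAnnounce op q rsp j a .read)
      | true, _ => goto l (.scHeadBot op q j a .read)
      | false, _ => goto l (afterHelp op j a)
  | .scAnnounce op q rsp j a c =>
      (RLLSC.sc (W := Dom 𝒪 n) (.announce j) i (AnnVal.rsp rsp) c).map fun
        (x : Retry (AnnVal 𝒪) n ⊕ Bool) =>
        match x with
        | .inl c' => goto l (.scAnnounce op q rsp j a c')
        | .inr _ => goto l (.scHeadBot op q j a .read)
  | .scHeadBot op q j a c => (RLLSC.sc (W := Dom 𝒪 n) .head i (q, none) c).map fun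
      (x : Retry (HeadVal 𝒪 n) n ⊕ Bool) =>
      match x with
      | .inl c' => goto l (.scHeadBot op q j a c')
      | .inr _ => goto l (afterHelp op j a)
  | .rlAnnounce op j c => (RLLSC.rl (W := Dom 𝒪 n) (.announce j) i c).map fun
      (x : Retry (AnnVal 𝒪) n ⊕ Bool) =>
      match x with
      | .inl c' => goto l (.rlAnnounce op j c')
      | .inr _ => goto l (.loopTest op)
  | .loadResponse => (RLLSC.load (W := Dom 𝒪 n) (.announce i)).map fun (v : AnnVal 𝒪) =>
      match v with
      | .rsp r => goto l (.llHeadEnd r .read)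
      -- the value read here is always a response; the other cases only make the code total
      | _ => goto l .loadResponse
  | .llHeadEnd response c =>
      match s with
      | .left => (RLLSC.ll (W := Dom 𝒪 n) .head i c).map fun
          (x : Retry (HeadVal 𝒪 n) n ⊕ HeadVal 𝒪 n) =>
          match x with
          | .inl c' => goto l (.llHeadEnd response c')
          | .inr (_, none) => goto l (.rlHead response .read)
          | .inr (q, some (_, j)) =>
              if j = i then goto l (.scHeadEnd response q .read)
              else goto l (.rlHead response .read)
      | .right => (RLLSC.load (W := Dom 𝒪 n) .head).map fun (v : HeadVal 𝒪 n) =>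
          match v with
          | (_, none) => goto l (.rlHead response .read)
          | (_, some (_, j)) =>
              if j = i then goto l (.llHeadEnd response c) else goto l (.rlHead response .read)
  | .scHeadEnd response q c => (RLLSC.sc (W := Dom 𝒪 n) .head i (q, none) c).map fun
      (x : Retry (HeadVal 𝒪 n) n ⊕ Bool) =>
      match x with
      | .inl c' => goto l (.scHeadEnd response q c')
      | .inr _ => goto l (.clearAnnounce response)
  | .rlHead response c => (RLLSC.rl (W := Dom 𝒪 n) .head i c).map fun
      (x : Retry (HeadVal 𝒪 n) n ⊕ Bool) =>
      match x with
      | .inl c' => goto l (.rlHead response c')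
      | .inr _ => goto l (.clearAnnounce response)
  | .clearAnnounce response =>
      (RLLSC.store (W := Dom 𝒪 n) (.announce i) AnnVal.bot).map fun _ => ret l response

/-- In an interleaved block both sides have to be served as long as the right side is waiting; once
the wait is over, only the right side (left steps remain possible). -/
def mustServe (s : Side) (l : LocalState 𝒪 n) : Prop :=
  match l.pc with
  | .llHead _ _ => True
  | .llAnnounce _ _ _ _ _ none => True
  | .llAnnounce _ _ _ _ _ (some _) => s = .right
  | .llHeadEnd _ _ => True
  | _ => False

/-- The initial values of the R-LLSC variables: `⟨q₀, ⊥⟩` for `head`, `⊥` for `announce`. -/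
def initVal (𝒪 : AbstractObject.{u}) (n : ℕ) : ∀ b : Var n, Dom 𝒪 n b
  | .head => (𝒪.init, none)
  | .announce _ => AnnVal.bot

end Universal

/-- The universal implementation of `𝒪` for `n` processes from atomic CAS objects. -/
noncomputable def universalImplementation (𝒪 : AbstractObject.{u}) (n : ℕ) :
    Implementation 𝒪 n where
  Base := Universal.Var n
  Val := Universal.CellOf 𝒪 n
  initMem := fun b => Cell.fresh (Universal.initVal 𝒪 n b)
  Local := Universal.LocalState 𝒪 n
  initLocal := fun i => ⟨i, .idle⟩
  start := fun _ op l => Universal.start op l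
  step := Universal.step
  mustServe := Universal.mustServe

/-!
A state-changing operation takes effect at the successful `SC` that stores its result in `head`, a
read-only one at its `Load`. A context bit can only be set by its owner, and every write of a value
clears all of them; hence a linked process knows the value of the variable it is linked to, which
gives the invariant: a response held by `head` belongs to a pending operation, it is announced
before `head` is released, and the announcing process removes it only afterwards. At the end of an
operation its process has lost or released all its links, so with no state-changing operation
pending `head` holds just the state of the object, and everything else is `⊥` with empty context.

Wait-freedom: suppose that a process runs forever without returning. If the value of `head` changed
only finitely often, then so would the announced values, every process would go around its loop
finitely often, and the memory would freeze, so that every retry loop would succeed. If it changes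
infinitely often, then some process applies infinitely many operations; it advances its priority
each time, so it eventually helps the given process, whose response gets announced. From then on
that process only moves forward in its program. It does not wait forever on the left-hand side of a
`∥` block, as the condition on the right-hand side holds; and a retry loop that it executes while
linked either loses its link, after which it ends, or it keeps its link on a variable whose value is
constant, and such a variable is eventually no longer written.
-/

/-! ## Linearizations as limits of growing lists -/

section Linearizations

open Filter

variable {𝒪 : AbstractObject.{u}} {n : ℕ}

theorem seqState_concat (L : List (SeqOp 𝒪 n)) (e : SeqOp 𝒪 n) :
    seqState 𝒪 (L ++ [e]) = (𝒪.Δ (seqState 𝒪 L) e.op).1 := by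
  simp [seqState]

theorem Returns.congr {H H' : History 𝒪 n} {t t' : ℕ} {r : 𝒪.Resp} (h : Returns H t t' r)
    (hH : ∀ x ≤ t', H x = H' x) : Returns H' t t' r := by
  obtain ⟨p, o, hinv, hlt, hres, hbetween⟩ := h
  exact ⟨p, o, hH t hlt.le ▸ hinv, hlt, hH t' le_rfl ▸ hres,
    fun x hx hx' e he => hbetween x hx hx' e ((hH x hx'.le).trans he)⟩

theorem Returns.eventually {H : History 𝒪 n} {Hs : ℕ → History 𝒪 n} {t t' : ℕ} {r : 𝒪.Resp}
    (h : Returns H t t' r) (hH : ∀ x, ∀ᶠ s in atTop, Hs s x = H x) :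
    ∀ᶠ s in atTop, Returns (Hs s) t t' r := by
  have hall : ∀ᶠ s in atTop, ∀ x ∈ Set.Iic t', Hs s x = H x :=
    (eventually_all_finite (Set.finite_Iic t')).2 fun x _ => hH x
  filter_upwards [hall] with s hs
  exact h.congr fun x hx => (hs x hx).symm

/-- The finite sequential history `L` is a linearization of `H`. This is `IsLinearization` in terms
of lists, which makes it easy to append an operation. -/
structure ListLinearizes (H : History 𝒪 n) (L : List (SeqOp 𝒪 n)) : Prop where
  mem_history : ∀ e ∈ L, H e.time = some (Event.inv e.proc e.op)
  nodup : (L.map SeqOp.time).Nodup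
  complete : ∀ t t' r, Returns H t t' r → ∃ e ∈ L, e.time = t ∧ e.resp = r
  spec : ∀ k e, L[k]? = some e → (𝒪.Δ (seqState 𝒪 (L.take k)) e.op).2 = e.resp
  real_time : L.Pairwise fun e e' => ∀ t r, Returns H e'.time t r → e.time ≤ t

theorem ListLinearizes.same_resp {H : History 𝒪 n} {L : List (SeqOp 𝒪 n)}
    (h : ListLinearizes H L) {e : SeqOp 𝒪 n} (he : e ∈ L) {t : ℕ} {r : 𝒪.Resp}
    (hr : Returns H e.time t r) : e.resp = r := by
  obtain ⟨e', he', htime, rfl⟩ := h.complete _ _ _ hr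
  rw [List.inj_on_of_nodup_map h.nodup he' he htime]

theorem ListLinearizes.index_eq {H : History 𝒪 n} {L : List (SeqOp 𝒪 n)}
    (h : ListLinearizes H L) {k k' : ℕ} {e e' : SeqOp 𝒪 n} (he : L[k]? = some e)
    (he' : L[k']? = some e') (htime : e.time = e'.time) : k = k' := by
  obtain ⟨hk, rfl⟩ := List.getElem?_eq_some_iff.1 he
  obtain ⟨hk', rfl⟩ := List.getElem?_eq_some_iff.1 he'
  exact (h.nodup.getElem_inj_iff (hi := by simpa using hk) (hj := by simpa using hk')).1
    (by simpa using htime)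

theorem ListLinearizes.index_lt {H : History 𝒪 n} {L : List (SeqOp 𝒪 n)}
    (h : ListLinearizes H L) {k k' t : ℕ} {e e' : SeqOp 𝒪 n} {r : 𝒪.Resp}
    (he : L[k]? = some e) (he' : L[k']? = some e') (hr : Returns H e.time t r)
    (ht : t < e'.time) : k < k' := by
  obtain ⟨hk, rfl⟩ := List.getElem?_eq_some_iff.1 he
  obtain ⟨hk', rfl⟩ := List.getElem?_eq_some_iff.1 he'
  obtain ⟨-, -, -, hlt, -⟩ := id hr
  rcases lt_trichotomy k k' with hlt' | rfl | hgt
  · exact hlt'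
  · omega
  · exact absurd (List.pairwise_iff_getElem.1 h.real_time k' k hk' hk hgt t r hr) (by omega)

open Classical in
/-- The limit of a sequence of lists, each of which is a prefix of the next one. -/
noncomputable def listLimit {α : Type*} (L : ℕ → List α) (k : ℕ) : Option α :=
  if h : ∃ t, k < (L t).length then (L h.choose)[k]? else none

theorem listLimit_const {α : Type*} (L : List α) : listLimit (fun _ => L) = fun k => L[k]? := by
  ext1 k
  simp only [listLimit, exists_const, dite_eq_ite, ite_eq_left_iff, not_lt]
  exact fun hk => (List.getElem?_eq_none hk).symm

section ListLimit

variable {α : Type*} {L : ℕ → List α} (hL : ∀ s t, s ≤ t → L s <+: L t)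
include hL

theorem getElem?_eq_of_prefix_chain {s t k : ℕ} (hs : k < (L s).length) (ht : k < (L t).length) :
    (L s)[k]? = (L t)[k]? := by
  rcases le_total s t with hle | hle <;> obtain ⟨M, hM⟩ := hL _ _ hle <;> rw [← hM]
  · rw [List.getElem?_append_left hs]
  · rw [List.getElem?_append_left ht]

theorem listLimit_eq_of_lt {t k : ℕ} (ht : k < (L t).length) : listLimit L k = (L t)[k]? := by
  have hex : ∃ t, k < (L t).length := ⟨t, ht⟩
  rw [listLimit, dif_pos hex, getElem?_eq_of_prefix_chain hL hex.choose_spec ht]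

theorem eventually_getElem?_eq_some {k : ℕ} {a : α} (h : listLimit L k = some a) :
    ∀ᶠ t in atTop, (L t)[k]? = some a := by
  unfold listLimit at h
  split at h
  case isFalse => contradiction
  case isTrue hex =>
    filter_upwards [eventually_ge_atTop hex.choose] with t ht
    have hlt := hex.choose_spec.trans_le (hL _ _ ht).length_le
    rw [← h, getElem?_eq_of_prefix_chain hL hlt hex.choose_spec]

theorem listLimit_eq_some_of_mem {t : ℕ} {a : α} (ha : a ∈ L t) : ∃ k, listLimit L k = some a := by
  obtain ⟨k, hk⟩ := List.mem_iff_getElem?.1 ha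
  exact ⟨k, (listLimit_eq_of_lt hL (List.getElem?_eq_some_iff.1 hk).1).trans hk⟩

theorem listLimit_succ_eq_none {k : ℕ} (h : listLimit L k = none) : listLimit L (k + 1) = none := by
  by_contra hne
  obtain ⟨a, ha⟩ := Option.ne_none_iff_exists'.1 hne
  obtain ⟨t, ht⟩ := (eventually_getElem?_eq_some hL ha).exists
  have hk : k < (L t).length := k.lt_succ_self.trans (List.getElem?_eq_some_iff.1 ht).1
  rw [listLimit_eq_of_lt hL hk, List.getElem?_eq_some_iff.2 ⟨hk, rfl⟩] at h
  contradiction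

end ListLimit

/-- The state before the `k`-th operation of a possibly infinite sequential history. -/
def stateBefore (f : ℕ → Option (SeqOp 𝒪 n)) : ℕ → 𝒪.State
  | 0 => 𝒪.init
  | k + 1 => (f k).elim (stateBefore f k) fun e => (𝒪.Δ (stateBefore f k) e.op).1

theorem seqState_take {f : ℕ → Option (SeqOp 𝒪 n)} {L : List (SeqOp 𝒪 n)} {k : ℕ}
    (hk : k ≤ L.length) (hf : ∀ j < k, L[j]? = f j) :
    seqState 𝒪 (L.take k) = stateBefore f k := by
  induction k with
  | zero => rfl
  | succ k ih =>
    rw [List.take_succ_eq_append_getElem hk, seqState_concat,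
      ih (Nat.le_of_succ_le hk) fun j hj => hf j (hj.trans k.lt_succ_self), stateBefore,
      ← hf k k.lt_succ_self, List.getElem?_eq_getElem hk, Option.elim_some]

theorem isLinearization_listLimit {H : History 𝒪 n} {Hs : ℕ → History 𝒪 n}
    {L : ℕ → List (SeqOp 𝒪 n)} (hL : ∀ s t, s ≤ t → L s <+: L t)
    (hH : ∀ x, ∀ᶠ s in atTop, Hs s x = H x) (hlin : ∀ t, ListLinearizes (Hs t) (L t)) :
    IsLinearization 𝒪 H (listLimit L) where
  no_gap _ := listLimit_succ_eq_none hL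
  mem_history k e he := by
    obtain ⟨t, ht, heq⟩ := ((eventually_getElem?_eq_some hL he).and (hH e.time)).exists
    exact heq ▸ (hlin t).mem_history e (List.mem_of_getElem? ht)
  nodup k k' e e' he he' htime := by
    obtain ⟨t, ht, ht'⟩ := ((eventually_getElem?_eq_some hL he).and
      (eventually_getElem?_eq_some hL he')).exists
    exact (hlin t).index_eq ht ht' htime
  complete t t' r hr := by
    obtain ⟨s, hs⟩ := (hr.eventually hH).exists
    obtain ⟨e, he, htime, -⟩ := (hlin s).complete t t' r hs
    obtain ⟨k, hk⟩ := listLimit_eq_some_of_mem hL he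
    exact ⟨k, e, hk, htime⟩
  same_resp k e t' r he hr := by
    obtain ⟨s, hs, hrs⟩ := ((eventually_getElem?_eq_some hL he).and (hr.eventually hH)).exists
    exact (hlin s).same_resp (List.mem_of_getElem? hs) hrs
  spec := by
    refine ⟨stateBefore (listLimit L), rfl, fun k e he => ?_⟩
    obtain ⟨t, ht⟩ := (eventually_getElem?_eq_some hL he).exists
    have hk := (List.getElem?_eq_some_iff.1 ht).1
    have hstate := seqState_take hk.le fun j hj => (listLimit_eq_of_lt hL (hj.trans hk)).symm
    refine Prod.ext ?_ (hstate ▸ (hlin t).spec k e ht)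
    rw [stateBefore, he, Option.elim_some]
  real_time k k' e e' t' r he he' hr hlt := by
    obtain ⟨s, hs, hs', hrs⟩ := ((eventually_getElem?_eq_some hL he).and
      ((eventually_getElem?_eq_some hL he').and (hr.eventually hH))).exists
    exact (hlin s).index_lt hs hs' hrs hlt

theorem ListLinearizes.isLinearization {H : History 𝒪 n} {L : List (SeqOp 𝒪 n)}
    (h : ListLinearizes H L) : IsLinearization 𝒪 H fun k => L[k]? :=
  listLimit_const L ▸ isLinearization_listLimit (fun _ _ _ => List.prefix_rfl)
    (fun _ => .of_forall fun _ => rfl) fun _ => h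

end Linearizations

/-! ## Linearization points -/

section Atomic

variable {𝒪 : AbstractObject.{u}} {n : ℕ}

/-- The abstract object as an atomic concurrent object: its state and, for every process, the
response of the pending operation, once this operation has taken effect. -/
@[ext]
structure AtomicState (𝒪 : AbstractObject.{u}) (n : ℕ) where
  state : 𝒪.State
  result : Fin n → Option 𝒪.Resp

namespace AtomicState

/-- The operation `o` of process `j` takes effect. -/
def apply (A : AtomicState 𝒪 n) (j : Fin n) (o : 𝒪.Op) : AtomicState 𝒪 n where
  state := (𝒪.Δ A.state o).1
  result := Function.update A.result j (some (𝒪.Δ A.state o).2)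

/-- The operation of process `p` returns. -/
def finish (A : AtomicState 𝒪 n) (p : Fin n) : AtomicState 𝒪 n where
  state := A.state
  result := Function.update A.result p none

/-- At most one of the pending operations takes effect, and it had not done so before. -/
inductive Perform (pending : Fin n → Option 𝒪.Op) (A : AtomicState 𝒪 n) : AtomicState 𝒪 n → Prop
  | none : Perform pending A A
  | apply (j : Fin n) (o : 𝒪.Op) (hpending : pending j = some o) (hresult : A.result j = none) :
      Perform pending A (A.apply j o)

/-- A step of `p` with output `r`: the operation of `p` returns its result if there is an output. -/
def Output (A : AtomicState 𝒪 n) (p : Fin n) : Option 𝒪.Resp → AtomicState 𝒪 n → Prop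
  | none, B => B = A
  | some r, B => A.result p = some r ∧ B = A.finish p

theorem apply_result_of_ne (A : AtomicState 𝒪 n) {j p : Fin n} (h : p ≠ j) (o : 𝒪.Op) :
    (A.apply j o).result p = A.result p :=
  Function.update_of_ne h _ _

theorem finish_result_of_ne (A : AtomicState 𝒪 n) {j p : Fin n} (h : p ≠ j) :
    (A.finish j).result p = A.result p :=
  Function.update_of_ne h _ _

end AtomicState

/-- After the history `H`, an operation `o` of `p` that was invoked at position `t` is pending. -/
def OpenAt (H : History 𝒪 n) (p : Fin n) (o : 𝒪.Op) (t : ℕ) : Prop :=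
  H t = some (Event.inv p o) ∧ ∀ x, t < x → ∀ e, H x = some e → e.proc ≠ p

/-- The list `L` of operations that have taken effect explains how the atomic object arrived at `A`
in a history `H` of length `t`, after which the operations `pending` are pending. -/
structure Explains (H : History 𝒪 n) (t : ℕ) (pending : Fin n → Option 𝒪.Op)
    (A : AtomicState 𝒪 n) (L : List (SeqOp 𝒪 n)) : Prop where
  eq_none : ∀ x, t ≤ x → H x = none
  linearizes : ListLinearizes H L
  state_eq : seqState 𝒪 L = A.state
  of_pending : ∀ p o, pending p = some o → ∃ x, OpenAt H p o x ∧
    ∀ r, A.result p = some r ↔ ∃ e ∈ L, e.time = x ∧ e.resp = r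
  of_idle : ∀ p, pending p = none → A.result p = none

variable {H : History 𝒪 n} {t x y : ℕ} {p : Fin n} {o : 𝒪.Op} {r : 𝒪.Resp}
  {e : Option (Event 𝒪 n)} {pending : Fin n → Option 𝒪.Op} {A B : AtomicState 𝒪 n}
  {L : List (SeqOp 𝒪 n)}

theorem OpenAt.not_returns (h : OpenAt H p o x) : ¬ Returns H x y r := by
  rintro ⟨p', o', hinv, hlt, hres, -⟩
  obtain ⟨rfl, -⟩ : p = p' ∧ o = o' := by simpa [h.1] using hinv
  exact h.2 y hlt _ hres rfl

theorem OpenAt.lt (h : OpenAt H p o x) (hH : ∀ y, t ≤ y → H y = none) : x < t := by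
  by_contra! hx
  rw [OpenAt, hH x hx] at h
  exact absurd h.1 (by simp)

theorem OpenAt.update (h : OpenAt H p o x) (hx : x < t) (he : ∀ e', e = some e' → e'.proc ≠ p) :
    OpenAt (Function.update H t e) p o x := by
  refine ⟨by rw [Function.update_of_ne hx.ne, h.1], fun y hy e' he' => ?_⟩
  rcases eq_or_ne y t with rfl | hne
  · exact he e' (by simpa using he')
  · exact h.2 y hy e' (by rwa [Function.update_of_ne hne] at he')

/-- A return in an extended history is either an old one or the one at the new event. -/
theorem returns_of_update (h : Returns (Function.update H t e) x y r)
    (hH : ∀ z, t ≤ z → H z = none) : Returns H x y r ∨ y = t := by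
  rcases lt_trichotomy y t with hlt | heq | hgt
  · exact .inl (h.congr fun z hz => Function.update_of_ne (hz.trans_lt hlt).ne _ _)
  · exact .inr heq
  · obtain ⟨_, _, _, _, hres, _⟩ := h
    rw [Function.update_of_ne hgt.ne', hH y hgt.le] at hres
    contradiction

namespace ListLinearizes

/-- The new event `e` may only complete an operation that occurs in the linearization. -/
theorem update (h : ListLinearizes H L) (hH : ∀ x, t ≤ x → H x = none)
    (hnew : ∀ x r, Returns (Function.update H t e) x t r → ∃ e' ∈ L, e'.time = x ∧ e'.resp = r) :
    ListLinearizes (Function.update H t e) L := by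
  have hlt (e' : SeqOp 𝒪 n) (he' : e' ∈ L) : e'.time < t := by
    by_contra! hle
    simpa [hH _ hle] using h.mem_history e' he'
  refine ⟨fun e' he' => ?_, h.nodup, fun x y r hr => ?_, h.spec, ?_⟩
  · rw [Function.update_of_ne (hlt e' he').ne, h.mem_history e' he']
  · rcases returns_of_update hr hH with hr' | rfl
    · exact h.complete x y r hr'
    · exact hnew x r hr
  · refine h.real_time.imp_of_mem fun {e₁ e₂} he₁ _ hle y r hr => ?_
    rcases returns_of_update hr hH with hr' | rfl
    · exact hle y r hr'
    · exact (hlt e₁ he₁).le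

theorem append (h : ListLinearizes H L) (hopen : OpenAt H p o x) (hx : ∀ e ∈ L, e.time ≠ x)
    (hr : (𝒪.Δ (seqState 𝒪 L) o).2 = r) : ListLinearizes H (L ++ [⟨x, p, o, r⟩]) := by
  refine ⟨fun e he => ?_, ?_, fun y z r' hret => ?_, fun k e he => ?_, ?_⟩
  · rcases List.mem_append.1 he with he | he
    · exact h.mem_history e he
    · obtain rfl := List.mem_singleton.1 he
      exact hopen.1
  · simpa [List.nodup_append, h.nodup] using hx
  · obtain ⟨e, he, heq⟩ := h.complete y z r' hret
    exact ⟨e, List.mem_append_left _ he, heq⟩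
  · rcases lt_trichotomy k L.length with hk | rfl | hk
    · rw [List.getElem?_append_left hk] at he
      rw [List.take_append_of_le_length hk.le]
      exact h.spec k e he
    · rw [List.getElem?_concat_length, Option.some_inj] at he
      subst he
      rwa [List.take_left]
    · rw [List.getElem?_eq_none (by simpa using hk)] at he
      contradiction
  · refine List.pairwise_append.2 ⟨h.real_time, List.pairwise_singleton _ _, fun e _ e' he' => ?_⟩
    obtain rfl := List.mem_singleton.1 he'
    exact fun y r' hret => absurd hret hopen.not_returns

end ListLinearizes

namespace Explains

theorem nil : Explains (fun _ => none) 0 (fun _ => none)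
    (⟨𝒪.init, fun _ => none⟩ : AtomicState 𝒪 n) [] where
  eq_none _ _ := rfl
  linearizes := ⟨by simp, by simp, fun _ _ _ ⟨_, _, h, _⟩ => by simp at h, by simp, by simp⟩
  state_eq := rfl
  of_pending _ _ h := by simp at h
  of_idle _ _ := rfl

theorem silent (h : Explains H t pending A L) :
    Explains (Function.update H t none) (t + 1) pending A L := by
  have hH : Function.update H t none = H := Function.update_eq_self_iff.2 (h.eq_none t le_rfl).symm
  exact hH.symm ▸ { h with eq_none := fun x hx => h.eq_none x (Nat.le_of_succ_le hx) }

theorem update_eq_none (h : Explains H t pending A L) (x : ℕ) (hx : t + 1 ≤ x) :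
    Function.update H t e x = none := by
  rw [Function.update_of_ne (Nat.ne_of_gt hx), h.eq_none x (Nat.le_of_succ_le hx)]

theorem invoke (h : Explains H t pending A L) (hp : pending p = none) :
    Explains (Function.update H t (some (Event.inv p o))) (t + 1)
      (Function.update pending p (some o)) A L where
  eq_none := h.update_eq_none
  linearizes := h.linearizes.update h.eq_none fun x r ⟨_, _, _, _, hres, _⟩ => by simp at hres
  state_eq := h.state_eq
  of_pending q o' hq := by
    rcases eq_or_ne q p with rfl | hne
    · obtain rfl : o = o' := by simpa using hq
      refine ⟨t, ⟨by simp, fun x hx e he => ?_⟩, fun r => ?_⟩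
      · rw [h.update_eq_none x hx] at he
        contradiction
      · simp only [h.of_idle q hp, reduceCtorEq, false_iff, not_exists, not_and]
        intro e he htime
        simpa [htime, h.eq_none t le_rfl] using h.linearizes.mem_history e he
    · rw [Function.update_of_ne hne] at hq
      obtain ⟨x, hopen, hresult⟩ := h.of_pending q o' hq
      refine ⟨x, hopen.update (hopen.lt h.eq_none) fun e he => ?_, hresult⟩
      obtain rfl := Option.some_inj.1 he
      exact hne.symm
  of_idle q hq := by
    rcases eq_or_ne q p with rfl | hne
    · simp at hq
    · exact h.of_idle q (by rwa [Function.update_of_ne hne] at hq)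

theorem respond (h : Explains H t pending A L) (hp : pending p = some o)
    (hr : A.result p = some r) :
    Explains (Function.update H t (some (Event.res p r))) (t + 1)
      (Function.update pending p none) (A.finish p) L where
  eq_none := h.update_eq_none
  linearizes := by
    refine h.linearizes.update h.eq_none fun x r' ⟨p', o', hinv, hlt, hres, hbetween⟩ => ?_
    obtain ⟨rfl, rfl⟩ : p = p' ∧ r = r' := by simpa using hres
    obtain ⟨y, hopen, hresult⟩ := h.of_pending p o hp
    rw [Function.update_of_ne hlt.ne] at hinv
    obtain rfl : x = y := by
      rcases lt_trichotomy x y with hxy | heq | hyx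
      · refine absurd rfl (hbetween y hxy (hopen.lt h.eq_none) (Event.inv p o) ?_)
        rw [Function.update_of_ne (hopen.lt h.eq_none).ne, hopen.1]
      · exact heq
      · exact absurd rfl (hopen.2 x hyx _ hinv)
    exact (hresult r).1 hr
  state_eq := h.state_eq
  of_pending q o' hq := by
    rcases eq_or_ne q p with rfl | hne
    · simp at hq
    · rw [Function.update_of_ne hne] at hq
      obtain ⟨x, hopen, hresult⟩ := h.of_pending q o' hq
      refine ⟨x, hopen.update (hopen.lt h.eq_none) fun e he => ?_, fun r' => ?_⟩
      · obtain rfl := Option.some_inj.1 he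
        exact hne.symm
      · rw [A.finish_result_of_ne hne, hresult]
  of_idle q hq := by
    rcases eq_or_ne q p with rfl | hne
    · exact Function.update_self ..
    · rw [A.finish_result_of_ne hne]
      exact h.of_idle q (by rwa [Function.update_of_ne hne] at hq)

theorem perform (h : Explains H t pending A L) (hB : A.Perform pending B) :
    ∃ M, Explains H t pending B (L ++ M) := by
  rcases hB with _ | ⟨j, o, hj, hresult⟩
  · exact ⟨[], by rwa [List.append_nil]⟩
  obtain ⟨x, hopen, hx⟩ := h.of_pending j o hj
  have hfresh : ∀ e ∈ L, e.time ≠ x := fun e he htime => by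
    simpa [hresult] using (hx e.resp).2 ⟨e, he, htime, rfl⟩
  refine ⟨[⟨x, j, o, (𝒪.Δ A.state o).2⟩], h.eq_none,
    h.linearizes.append hopen hfresh (by rw [h.state_eq]), ?_, fun q o' hq => ?_, fun q hq => ?_⟩
  · rw [seqState_concat, h.state_eq, AtomicState.apply]
  · rcases eq_or_ne q j with rfl | hne
    · obtain rfl : o = o' := by simpa [hj] using hq
      refine ⟨x, hopen, fun r => ?_⟩
      simp only [AtomicState.apply, Function.update_self, Option.some_inj, List.mem_append,
        List.mem_singleton]
      constructor
      · rintro rfl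
        exact ⟨_, .inr rfl, rfl, rfl⟩
      · rintro ⟨e, he | rfl, htime, rfl⟩
        · exact absurd htime (hfresh e he)
        · rfl
    · obtain ⟨y, hopen', hy⟩ := h.of_pending q o' hq
      have hxy : x ≠ y := by
        rintro rfl
        obtain ⟨heq, -⟩ : q = j ∧ o' = o := by simpa using hopen'.1.symm.trans hopen.1
        exact hne heq
      refine ⟨y, hopen', fun r => ?_⟩
      simp [A.apply_result_of_ne hne, hy, hxy, or_and_right, exists_or]
  · rw [A.apply_result_of_ne (by rintro rfl; simp [hj] at hq)]
    exact h.of_idle q hq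

end Explains

end Atomic

namespace Implementation

variable {𝒪 : AbstractObject.{u}} {n : ℕ} {I : Implementation 𝒪 n}

/-- Some finite execution leads to the configuration `C`. -/
def Reachable (C : I.Config) : Prop :=
  ∃ as, I.Reach as C

/-- The actions of the first `t` steps of an infinite execution. -/
def InfExec.firstActs (ρ : I.InfExec) (t : ℕ) : List (ExecAction 𝒪 n) :=
  (List.range t).map ρ.act

theorem InfExec.firstActs_succ (ρ : I.InfExec) (t : ℕ) :
    ρ.firstActs (t + 1) = ρ.firstActs t ++ [ρ.act t] := by
  simp [firstActs, List.range_succ]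

theorem InfExec.reach (ρ : I.InfExec) (t : ℕ) : I.Reach (ρ.firstActs t) (ρ.cfg t) := by
  induction t with
  | zero => exact ρ.init ▸ Reach.nil
  | succ t ih => exact ρ.firstActs_succ t ▸ ih.snoc (ρ.step t)

/-- The history of a list of actions. -/
def actsHistory (as : List (ExecAction 𝒪 n)) : History 𝒪 n :=
  fun t => as[t]?.bind ExecAction.event

theorem actsHistory_concat (as : List (ExecAction 𝒪 n)) (a : ExecAction 𝒪 n) :
    actsHistory (as ++ [a]) = Function.update (actsHistory as) as.length a.event := by
  ext1 t
  rcases lt_trichotomy t as.length with ht | rfl | ht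
  · rw [Function.update_of_ne ht.ne, actsHistory, actsHistory, List.getElem?_append_left ht]
  · rw [Function.update_self, actsHistory, List.getElem?_concat_length, Option.bind_some]
  · rw [Function.update_of_ne ht.ne', actsHistory, actsHistory,
      List.getElem?_eq_none (by simpa using ht), List.getElem?_eq_none ht.le]

theorem InfExec.eventually_actsHistory (ρ : I.InfExec) (x : ℕ) :
    ∀ᶠ t in Filter.atTop, actsHistory (ρ.firstActs t) x = ρ.history x := by
  filter_upwards [Filter.eventually_gt_atTop x] with t ht
  simp [actsHistory, firstActs, InfExec.history, ht]

/-- A choice of linearization points: the configuration determines the state of an atomic object,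
such that each step amounts to at most one operation taking effect, followed by the return of an
operation that has taken effect, if the step returns. -/
structure LinearizationPoints (I : Implementation 𝒪 n) where
  atomic : I.Config → AtomicState 𝒪 n
  init : atomic I.initConfig = ⟨𝒪.init, fun _ => none⟩
  invoke : ∀ C p o, Reachable C → C.pending p = none → atomic (I.afterInvoke C p o) = atomic C
  step : ∀ C p s, Reachable C → C.pending p ≠ none → ∃ A, (atomic C).Perform C.pending A ∧
    A.Output p (I.outcome C p s).2.2 (atomic (I.afterStep C p s))

namespace LinearizationPoints

variable (P : LinearizationPoints I) {as : List (ExecAction 𝒪 n)} {C C' : I.Config}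
  {a : ExecAction 𝒪 n} {L : List (SeqOp 𝒪 n)}

/-- The operations `L` that have taken effect explain the configuration reached by `as`. -/
abbrev ExplainsConfig (as : List (ExecAction 𝒪 n)) (C : I.Config) (L : List (SeqOp 𝒪 n)) : Prop :=
  Explains (actsHistory as) as.length C.pending (P.atomic C) L

theorem exists_append (hC : I.Reach as C) (hstep : I.Step C a C') (h : P.ExplainsConfig as C L) :
    ∃ M, P.ExplainsConfig (as ++ [a]) C' (L ++ M) := by
  simp only [ExplainsConfig, actsHistory_concat, List.length_append, List.length_singleton]
  cases hstep with
  | invoke p o hp =>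
    refine ⟨[], ?_⟩
    rw [P.invoke C p o ⟨as, hC⟩ hp, List.append_nil]
    exact h.invoke hp
  | step p s hp =>
    obtain ⟨A, hA, hout⟩ := P.step C p s ⟨as, hC⟩ hp
    obtain ⟨M, hM⟩ := h.perform hA
    refine ⟨M, ?_⟩
    simp only [afterStep] at hout ⊢
    generalize (I.outcome C p s).2.2 = r at hout ⊢
    cases r with
    | none => exact hout ▸ hM.silent
    | some r =>
      obtain ⟨o, ho⟩ := Option.ne_none_iff_exists'.1 hp
      exact hout.2 ▸ hM.respond ho hout.1

theorem exists_explains (h : I.Reach as C) : ∃ L, P.ExplainsConfig as C L := by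
  induction h with
  | nil => exact ⟨[], by rw [ExplainsConfig, P.init]; exact Explains.nil⟩
  | snoc hC hstep ih =>
    obtain ⟨L, hL⟩ := ih
    obtain ⟨M, hM⟩ := P.exists_append hC hstep hL
    exact ⟨L ++ M, hM⟩

theorem exists_explains_infExec (ρ : I.InfExec) : ∃ L : ℕ → List (SeqOp 𝒪 n),
    (∀ s t, s ≤ t → L s <+: L t) ∧ ∀ t, P.ExplainsConfig (ρ.firstActs t) (ρ.cfg t) (L t) := by
  have hnext (t : ℕ) (L : {L // P.ExplainsConfig (ρ.firstActs t) (ρ.cfg t) L}) :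
      ∃ M, P.ExplainsConfig (ρ.firstActs (t + 1)) (ρ.cfg (t + 1)) (L.1 ++ M) :=
    ρ.firstActs_succ t ▸ P.exists_append (ρ.reach t) (ρ.step t) L.2
  choose M hM using hnext
  obtain ⟨L₀, hL₀⟩ := P.exists_explains (ρ.reach 0)
  let L : ∀ t, {L // P.ExplainsConfig (ρ.firstActs t) (ρ.cfg t) L} :=
    fun t => Nat.rec ⟨L₀, hL₀⟩ (fun t L => ⟨L.1 ++ M t L, hM t L⟩) t
  refine ⟨fun t => (L t).1, fun s t hst => ?_, fun t => (L t).2⟩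
  induction t, hst using Nat.le_induction with
  | base => exact List.prefix_rfl
  | succ t _ ih => exact ih.trans (List.prefix_append _ _)

theorem linearizable (P : LinearizationPoints I) : I.Linearizable := by
  refine ⟨fun α => ?_, fun ρ => ?_⟩
  · obtain ⟨L, hL⟩ := P.exists_explains α.reach
    exact ⟨L, hL.linearizes.isLinearization⟩
  · obtain ⟨L, hprefix, hL⟩ := P.exists_explains_infExec ρ
    exact ⟨listLimit L, isLinearization_listLimit hprefix ρ.eventually_actsHistory
      fun t => (hL t).linearizes⟩

theorem historyIndependent {E : Set I.FinExec}
    (hmem : ∀ α ∈ E, ∀ β ∈ E, (P.atomic α.last).state = (P.atomic β.last).state →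
      α.last.mem = β.last.mem) : I.HistoryIndependent E := by
  choose h hh using fun α : I.FinExec => P.exists_explains α.reach
  refine ⟨h, fun α => (hh α).linearizes.isLinearization, fun α hα β hβ heq => ?_⟩
  rw [(hh α).state_eq, (hh β).state_eq] at heq
  exact hmem α hα β hβ heq

end LinearizationPoints

end Implementation

/-! ## Steps of the R-LLSC procedures -/

namespace Access

variable {Base : Type v} {Val : Base → Type u} {β : Type w} {γ : Type*}

theorem exec_map (f : β → γ) (a : Access Base Val β) (mem : ∀ b, Val b) :
    (a.map f).exec mem = ((a.exec mem).1, f (a.exec mem).2) := by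
  cases a with
  | read => rfl
  | write => rfl
  | cas b old new k =>
    simp only [map, exec]
    split <;> rfl

end Access

namespace Cell

variable {W : Type u} {n : ℕ}

@[simp] theorem val_fresh (x : W) : (fresh x : Cell W n).val = x := rfl

@[simp] theorem context_fresh (x : W) (i : Fin n) : (fresh x : Cell W n).context i = false := rfl

@[simp] theorem val_setBit (c : Cell W n) (i : Fin n) (x : Bool) : (c.setBit i x).val = c.val := rfl

theorem context_setBit (c : Cell W n) (i j : Fin n) (x : Bool) :
    (c.setBit i x).context j = if j = i then x else c.context j :=
  Function.update_apply ..

theorem setBit_eq_self {c : Cell W n} {i : Fin n} {x : Bool} (h : c.context i = x) :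
    c.setBit i x = c := by
  subst h
  simp [setBit]

end Cell

namespace Retry

variable {W : Type u} {n : ℕ}

/-- One step of a retry loop on an object with contents `X` that does not leave the loop. -/
inductive Iterates (X : Cell W n) : Retry W n → Retry W n → Prop
  | read : Iterates X .read (.cas X)
  | fail {cur : Cell W n} (h : X ≠ cur) : Iterates X (.cas cur) .read

/-- The expected value of a pending CAS was read while process `i` was in the context. -/
def Linked (i : Fin n) (c : Retry W n) : Prop :=
  ∀ cur, c = .cas cur → cur.context i = true

@[simp] theorem linked_read (i : Fin n) : (read : Retry W n).Linked i := nofun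

@[simp] theorem linked_cas (i : Fin n) (cur : Cell W n) :
    (cas cur).Linked i ↔ cur.context i = true := by
  simp [Linked]

end Retry

namespace RLLSC

variable {W : Type u} {n : ℕ}

/-- A step of `LL` by process `i` on an object with contents `X`. -/
inductive LLStep (i : Fin n) (X : Cell W n) : Retry W n → Cell W n → Retry W n ⊕ W → Prop
  | retry {c c'} (h : Retry.Iterates X c c') : LLStep i X c X (.inl c')
  | success : LLStep i X (.cas X) (X.setBit i true) (.inr X.val)

/-- A step of `SC(x)` by process `i` on an object with contents `X`. -/
inductive SCStep (i : Fin n) (x : W) (X : Cell W n) :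
    Retry W n → Cell W n → Retry W n ⊕ Bool → Prop
  | retry {c c'} (h : Retry.Iterates X c c') (hc' : c'.Linked i) : SCStep i x X c X (.inl c')
  | unlinked (h : X.context i = false) : SCStep i x X .read X (.inr false)
  | success : SCStep i x X (.cas X) (Cell.fresh x) (.inr true)

/-- A step of `RL` by process `i` on an object with contents `X`. If `i` is not in the context, then
clearing its bit does nothing, so that both ways to finish have the same effect. -/
inductive RLStep (i : Fin n) (X : Cell W n) : Retry W n → Cell W n → Retry W n ⊕ Bool → Prop
  | retry {c c'} (h : Retry.Iterates X c c') (hc' : c'.Linked i) : RLStep i X c X (.inl c')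
  | done {c} : RLStep i X c (X.setBit i false) (.inr true)

section Exec

variable {Base : Type v} {W : Base → Type u} {n : ℕ}
  (mem : ∀ b, Cell (W b) n) (b : Base) (i : Fin n) (c : Retry (W b) n)

open Classical in
theorem exec_ll : ∃ X, ((ll b i c).exec mem).1 = Function.update mem b X ∧
    LLStep i (mem b) c X ((ll b i c).exec mem).2 := by
  rcases c with _ | cur
  · exact ⟨mem b, by simp [ll, Access.exec], .retry .read⟩
  · by_cases h : mem b = cur
    · subst h
      exact ⟨(mem b).setBit i true, by simp [ll, Access.exec],
        by simpa [ll, Access.exec] using .success⟩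
    · exact ⟨mem b, by simp [ll, Access.exec, h],
        by simpa [ll, Access.exec, h] using .retry (.fail h)⟩

open Classical in
theorem exec_sc (x : W b) : ∃ X, ((sc b i x c).exec mem).1 = Function.update mem b X ∧
    SCStep i x (mem b) c X ((sc b i x c).exec mem).2 := by
  rcases c with _ | cur
  · refine ⟨mem b, by simp [sc, Access.exec], ?_⟩
    cases h : (mem b).context i
    · simpa [sc, Access.exec, h] using .unlinked h
    · simpa [sc, Access.exec, h] using .retry .read (by simpa using h)
  · by_cases h : mem b = cur
    · subst h
      exact ⟨Cell.fresh x, by simp [sc, Access.exec], by simpa [sc, Access.exec] using .success⟩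
    · exact ⟨mem b, by simp [sc, Access.exec, h],
        by simpa [sc, Access.exec, h] using .retry (.fail h) (by simp)⟩

open Classical in
theorem exec_rl : ∃ X, ((rl b i c).exec mem).1 = Function.update mem b X ∧
    RLStep i (mem b) c X ((rl b i c).exec mem).2 := by
  rcases c with _ | cur
  · refine ⟨mem b, by simp [rl, Access.exec], ?_⟩
    cases h : (mem b).context i
    · nth_rw 2 [← Cell.setBit_eq_self h]
      simpa [rl, Access.exec, h] using .done
    · simpa [rl, Access.exec, h] using .retry .read (by simpa using h)
  · by_cases h : mem b = cur
    · subst h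
      exact ⟨(mem b).setBit i false, by simp [rl, Access.exec],
        by simpa [rl, Access.exec] using .done⟩
    · exact ⟨mem b, by simp [rl, Access.exec, h],
        by simpa [rl, Access.exec, h] using .retry (.fail h) (by simp)⟩

end Exec

end RLLSC

/-! ## Transitions of the universal implementation -/

namespace Universal

variable {𝒪 : AbstractObject.{u}} {n : ℕ}

/-- The shared memory, split into `head` and `announce`. -/
structure Shared (𝒪 : AbstractObject.{u}) (n : ℕ) where
  head : Cell (HeadVal 𝒪 n) n
  ann : Fin n → Cell (AnnVal 𝒪) n

namespace Shared

/-- The contents of the base objects. -/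
def ofMem (mem : ∀ b, CellOf 𝒪 n b) : Shared 𝒪 n where
  head := mem .head
  ann j := mem (.announce j)

/-- Overwrite `head`. -/
def setHead (M : Shared 𝒪 n) (X : Cell (HeadVal 𝒪 n) n) : Shared 𝒪 n := { M with head := X }

/-- Overwrite `announce[j]`. -/
def setAnn (M : Shared 𝒪 n) (j : Fin n) (X : Cell (AnnVal 𝒪) n) : Shared 𝒪 n :=
  { M with ann := Function.update M.ann j X }

variable (M : Shared 𝒪 n) (j : Fin n)

@[simp] theorem head_setHead (X) : (M.setHead X).head = X := rfl

@[simp] theorem ann_setHead (X) : (M.setHead X).ann = M.ann := rfl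

@[simp] theorem head_setAnn (X) : (M.setAnn j X).head = M.head := rfl

theorem ann_setAnn (X) (k : Fin n) : (M.setAnn j X).ann k = if k = j then X else M.ann k :=
  Function.update_apply ..

@[simp] theorem ann_setAnn_self (X) : (M.setAnn j X).ann j = X := Function.update_self ..

@[simp] theorem val_ann_setAnn_setBit (p k : Fin n) (x : Bool) :
    ((M.setAnn j ((M.ann j).setBit p x)).ann k).val = (M.ann k).val := by
  rw [ann_setAnn]
  split_ifs with h
  · rw [h, Cell.val_setBit]
  · rfl

theorem setAnn_ann : M.setAnn j (M.ann j) = M :=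
  congrArg (mk M.head) (Function.update_eq_self ..)

theorem ofMem_update_head {_ : DecidableEq (Var n)} (mem : ∀ b, CellOf 𝒪 n b)
    (X : CellOf 𝒪 n .head) : ofMem (Function.update mem .head X) = (ofMem mem).setHead X :=
  congrArg₂ mk (Function.update_self ..) (funext fun _ => Function.update_of_ne (by simp) ..)

theorem ofMem_update_announce {_ : DecidableEq (Var n)} (mem : ∀ b, CellOf 𝒪 n b)
    (X : CellOf 𝒪 n (.announce j)) :
    ofMem (Function.update mem (.announce j) X) = (ofMem mem).setAnn j X := by
  refine congrArg₂ mk (Function.update_of_ne (by simp) ..) (funext fun k => ?_)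
  rcases eq_or_ne k j with rfl | hne
  · exact (Function.update_self ..).trans (ann_setAnn_self (ofMem mem) k X).symm
  · exact (Function.update_of_ne (by simpa using hne) ..).trans
      ((ann_setAnn (ofMem mem) j X k).trans (if_neg hne)).symm

/-- `head` holds a response for process `j`. -/
def HeldFor (M : Shared 𝒪 n) (j : Fin n) : Prop :=
  ∃ q r, M.head.val = (q, some (r, j))

end Shared

/-- The announced value is a response. -/
def AnnVal.IsRsp (a : AnnVal 𝒪) : Prop :=
  ∃ r, a = .rsp r

/-- The steps of process `p` on side `s`, from memory `M` and local state `l` to memory `M'` and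
local state `l'` with output `r`: the program with all case distinctions spelled out. -/
inductive Transition (p : Fin n) : Side → Shared 𝒪 n → LocalState 𝒪 n →
    Shared 𝒪 n → LocalState 𝒪 n → Option 𝒪.Resp → Prop
  | readOnly {s M k op} :
      Transition p s M ⟨k, .readOnly op⟩ M ⟨k, .idle⟩ (some (𝒪.Δ M.head.val.1 op).2)
  | announceOp {s M k op} :
      Transition p s M ⟨k, .announceOp op⟩ (M.setAnn p (Cell.fresh (.op op))) ⟨k, .loopTest op⟩ none
  | loopTestExit {s M k op} (h : (M.ann p).val.IsRsp) :
      Transition p s M ⟨k, .loopTest op⟩ M ⟨k, .loadResponse⟩ none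
  | loopTestEnter {s M k op} (h : ¬ (M.ann p).val.IsRsp) :
      Transition p s M ⟨k, .loopTest op⟩ M ⟨k, .llHead op .read⟩ none
  | llHeadRetry {M k op c c'} (h : Retry.Iterates M.head c c') :
      Transition p .left M ⟨k, .llHead op c⟩ M ⟨k, .llHead op c'⟩ none
  | llHeadBot {M k op q} (h : M.head.val = (q, none)) :
      Transition p .left M ⟨k, .llHead op (.cas M.head)⟩ (M.setHead (M.head.setBit p true))
        ⟨k, .loadHelp op q⟩ none
  | llHeadHeld {M k op q rsp j} (h : M.head.val = (q, some (rsp, j))) :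
      Transition p .left M ⟨k, .llHead op (.cas M.head)⟩ (M.setHead (M.head.setBit p true))
        ⟨k, .llAnnounce op q rsp j .read none⟩ none
  | llHeadExit {M k op c} (h : (M.ann p).val.IsRsp) :
      Transition p .right M ⟨k, .llHead op c⟩ M ⟨k, .loadResponse⟩ none
  | llHeadWait {M k op c} (h : ¬ (M.ann p).val.IsRsp) :
      Transition p .right M ⟨k, .llHead op c⟩ M ⟨k, .llHead op c⟩ none
  | loadHelpOp {s M k op q o} (h : (M.ann k).val = .op o) :
      Transition p s M ⟨k, .loadHelp op q⟩ M
        ⟨k, .scApply op (𝒪.Δ q o).1 (𝒪.Δ q o).2 k .read⟩ none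
  | loadHelpNone {s M k op q} (h : ∀ o, (M.ann k).val ≠ .op o) :
      Transition p s M ⟨k, .loadHelp op q⟩ M ⟨k, .loadOwn op q⟩ none
  | loadOwnOp {s M k op q o} (h : (M.ann p).val = .op o) :
      Transition p s M ⟨k, .loadOwn op q⟩ M
        ⟨k, .scApply op (𝒪.Δ q op).1 (𝒪.Δ q op).2 p .read⟩ none
  | loadOwnNone {s M k op q} (h : ∀ o, (M.ann p).val ≠ .op o) :
      Transition p s M ⟨k, .loadOwn op q⟩ M ⟨k, .loopTest op⟩ none
  | scApplyRetry {s M k op st rsp j c c'} (h : Retry.Iterates M.head c c') (hc' : c'.Linked p) :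
      Transition p s M ⟨k, .scApply op st rsp j c⟩ M ⟨k, .scApply op st rsp j c'⟩ none
  | scApplyUnlinked {s M k op st rsp j} (h : M.head.context p = false) :
      Transition p s M ⟨k, .scApply op st rsp j .read⟩ M ⟨k, .loopTest op⟩ none
  | scApply {s M k op st rsp j} :
      Transition p s M ⟨k, .scApply op st rsp j (.cas M.head)⟩
        (M.setHead (Cell.fresh (st, some (rsp, j)))) ⟨succMod k, .loopTest op⟩ none
  | llAnnounceRetry {M k op q rsp j c c' d} (h : Retry.Iterates (M.ann j) c c') :
      Transition p .left M ⟨k, .llAnnounce op q rsp j c d⟩ M ⟨k, .llAnnounce op q rsp j c' d⟩ none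
  | llAnnounce {M k op q rsp j d} :
      Transition p .left M ⟨k, .llAnnounce op q rsp j (.cas (M.ann j)) d⟩
        (M.setAnn j ((M.ann j).setBit p true)) ⟨k, .vlHead op q rsp j (M.ann j).val⟩ none
  | llAnnounceExit {M k op q rsp j c} (h : (M.ann p).val.IsRsp) :
      Transition p .right M ⟨k, .llAnnounce op q rsp j c none⟩ M
        ⟨k, .llAnnounce op q rsp j c (some .read)⟩ none
  | llAnnounceWait {M k op q rsp j c} (h : ¬ (M.ann p).val.IsRsp) :
      Transition p .right M ⟨k, .llAnnounce op q rsp j c none⟩ M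
        ⟨k, .llAnnounce op q rsp j c none⟩ none
  | llAnnounceRlRetry {M k op q rsp j c d d'} (h : Retry.Iterates (M.ann j) d d')
      (hd' : d'.Linked p) :
      Transition p .right M ⟨k, .llAnnounce op q rsp j c (some d)⟩ M
        ⟨k, .llAnnounce op q rsp j c (some d')⟩ none
  | llAnnounceRl {M k op q rsp j c d} :
      Transition p .right M ⟨k, .llAnnounce op q rsp j c (some d)⟩
        (M.setAnn j ((M.ann j).setBit p false)) ⟨k, .loadResponse⟩ none
  | vlHeadOp {s M k op q rsp j o} (h : M.head.context p = true) :
      Transition p s M ⟨k, .vlHead op q rsp j (.op o)⟩ M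
        ⟨k, .scAnnounce op q rsp j (.op o) .read⟩ none
  | vlHeadNotOp {s M k op q rsp j a} (h : M.head.context p = true) (ha : ∀ o, a ≠ .op o) :
      Transition p s M ⟨k, .vlHead op q rsp j a⟩ M ⟨k, .scHeadBot op q j a .read⟩ none
  | vlHeadUnlinked {s M k op q rsp j a} (h : M.head.context p = false) :
      Transition p s M ⟨k, .vlHead op q rsp j a⟩ M ⟨k, afterHelp op j a⟩ none
  | scAnnounceRetry {s M k op q rsp j a c c'} (h : Retry.Iterates (M.ann j) c c')
      (hc' : c'.Linked p) :
      Transition p s M ⟨k, .scAnnounce op q rsp j a c⟩ M ⟨k, .scAnnounce op q rsp j a c'⟩ none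
  | scAnnounceUnlinked {s M k op q rsp j a} (h : (M.ann j).context p = false) :
      Transition p s M ⟨k, .scAnnounce op q rsp j a .read⟩ M ⟨k, .scHeadBot op q j a .read⟩ none
  | scAnnounce {s M k op q rsp j a} :
      Transition p s M ⟨k, .scAnnounce op q rsp j a (.cas (M.ann j))⟩
        (M.setAnn j (Cell.fresh (.rsp rsp))) ⟨k, .scHeadBot op q j a .read⟩ none
  | scHeadBotRetry {s M k op q j a c c'} (h : Retry.Iterates M.head c c') (hc' : c'.Linked p) :
      Transition p s M ⟨k, .scHeadBot op q j a c⟩ M ⟨k, .scHeadBot op q j a c'⟩ none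
  | scHeadBotUnlinked {s M k op q j a} (h : M.head.context p = false) :
      Transition p s M ⟨k, .scHeadBot op q j a .read⟩ M ⟨k, afterHelp op j a⟩ none
  | scHeadBot {s M k op q j a} :
      Transition p s M ⟨k, .scHeadBot op q j a (.cas M.head)⟩ (M.setHead (Cell.fresh (q, none)))
        ⟨k, afterHelp op j a⟩ none
  | rlAnnounceRetry {s M k op j c c'} (h : Retry.Iterates (M.ann j) c c') (hc' : c'.Linked p) :
      Transition p s M ⟨k, .rlAnnounce op j c⟩ M ⟨k, .rlAnnounce op j c'⟩ none
  | rlAnnounce {s M k op j c} :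
      Transition p s M ⟨k, .rlAnnounce op j c⟩ (M.setAnn j ((M.ann j).setBit p false))
        ⟨k, .loopTest op⟩ none
  | loadResponse {s M k r} (h : (M.ann p).val = .rsp r) :
      Transition p s M ⟨k, .loadResponse⟩ M ⟨k, .llHeadEnd r .read⟩ none
  | loadResponseStuck {s M k} (h : ¬ (M.ann p).val.IsRsp) :
      Transition p s M ⟨k, .loadResponse⟩ M ⟨k, .loadResponse⟩ none
  | llHeadEndRetry {M k r c c'} (h : Retry.Iterates M.head c c') :
      Transition p .left M ⟨k, .llHeadEnd r c⟩ M ⟨k, .llHeadEnd r c'⟩ none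
  | llHeadEndHeld {M k r q rsp} (h : M.head.val = (q, some (rsp, p))) :
      Transition p .left M ⟨k, .llHeadEnd r (.cas M.head)⟩ (M.setHead (M.head.setBit p true))
        ⟨k, .scHeadEnd r q .read⟩ none
  | llHeadEndNotHeld {M k r} (h : ¬ M.HeldFor p) :
      Transition p .left M ⟨k, .llHeadEnd r (.cas M.head)⟩ (M.setHead (M.head.setBit p true))
        ⟨k, .rlHead r .read⟩ none
  | llHeadEndWait {M k r c} (h : M.HeldFor p) :
      Transition p .right M ⟨k, .llHeadEnd r c⟩ M ⟨k, .llHeadEnd r c⟩ none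
  | llHeadEndExit {M k r c} (h : ¬ M.HeldFor p) :
      Transition p .right M ⟨k, .llHeadEnd r c⟩ M ⟨k, .rlHead r .read⟩ none
  | scHeadEndRetry {s M k r q c c'} (h : Retry.Iterates M.head c c') (hc' : c'.Linked p) :
      Transition p s M ⟨k, .scHeadEnd r q c⟩ M ⟨k, .scHeadEnd r q c'⟩ none
  | scHeadEndUnlinked {s M k r q} (h : M.head.context p = false) :
      Transition p s M ⟨k, .scHeadEnd r q .read⟩ M ⟨k, .clearAnnounce r⟩ none
  | scHeadEnd {s M k r q} :
      Transition p s M ⟨k, .scHeadEnd r q (.cas M.head)⟩ (M.setHead (Cell.fresh (q, none)))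
        ⟨k, .clearAnnounce r⟩ none
  | rlHeadRetry {s M k r c c'} (h : Retry.Iterates M.head c c') (hc' : c'.Linked p) :
      Transition p s M ⟨k, .rlHead r c⟩ M ⟨k, .rlHead r c'⟩ none
  | rlHead {s M k r c} :
      Transition p s M ⟨k, .rlHead r c⟩ (M.setHead (M.head.setBit p false))
        ⟨k, .clearAnnounce r⟩ none
  | clearAnnounce {s M k r} :
      Transition p s M ⟨k, .clearAnnounce r⟩ (M.setAnn p (Cell.fresh .bot)) ⟨k, .idle⟩ (some r)

section TransitionStep

variable (p : Fin n) (mem : ∀ b, CellOf 𝒪 n b)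

/-- The step `a` of process `p` in local state `l` performs a transition of the memory. -/
def Implements (s : Side) (l : LocalState 𝒪 n)
    (a : Access (Var n) (CellOf 𝒪 n) (LocalState 𝒪 n × Option 𝒪.Resp)) : Prop :=
  Transition p s (Shared.ofMem mem) l (Shared.ofMem (a.exec mem).1) (a.exec mem).2.1
    (a.exec mem).2.2

variable {p mem} {s : Side} {l : LocalState 𝒪 n}

theorem implements_map {β : Type*} (a : Access (Var n) (CellOf 𝒪 n) β)
    (f : β → LocalState 𝒪 n × Option 𝒪.Resp) {M : Shared 𝒪 n}
    (hM : Shared.ofMem (a.exec mem).1 = M)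
    (h : Transition p s (Shared.ofMem mem) l M (f (a.exec mem).2).1 (f (a.exec mem).2).2) :
    Implements p mem s l (a.map f) := by
  rw [Implements, Access.exec_map, hM]
  exact h

theorem implements_load_head {f : HeadVal 𝒪 n → LocalState 𝒪 n × Option 𝒪.Resp}
    (h : ∀ v, (Shared.ofMem mem).head.val = v →
      Transition p s (Shared.ofMem mem) l (Shared.ofMem mem) (f v).1 (f v).2) :
    Implements p mem s l ((RLLSC.load (W := Dom 𝒪 n) .head).map f) :=
  implements_map _ f rfl (h _ rfl)

theorem implements_load_announce {j : Fin n} {f : AnnVal 𝒪 → LocalState 𝒪 n × Option 𝒪.Resp}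
    (h : ∀ v, ((Shared.ofMem mem).ann j).val = v →
      Transition p s (Shared.ofMem mem) l (Shared.ofMem mem) (f v).1 (f v).2) :
    Implements p mem s l ((RLLSC.load (W := Dom 𝒪 n) (.announce j)).map f) :=
  implements_map _ f rfl (h _ rfl)

open Classical in
theorem implements_store_announce {j : Fin n} {x : AnnVal 𝒪}
    {f : Bool → LocalState 𝒪 n × Option 𝒪.Resp}
    (h : Transition p s (Shared.ofMem mem) l ((Shared.ofMem mem).setAnn j (Cell.fresh x))
      (f true).1 (f true).2) :
    Implements p mem s l ((RLLSC.store (W := Dom 𝒪 n) (.announce j) x).map f) :=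
  implements_map _ f (Shared.ofMem_update_announce j mem (Cell.fresh x)) h

theorem implements_vl_head {f : Bool → LocalState 𝒪 n × Option 𝒪.Resp}
    (h : ∀ b, (Shared.ofMem mem).head.context p = b →
      Transition p s (Shared.ofMem mem) l (Shared.ofMem mem) (f b).1 (f b).2) :
    Implements p mem s l ((RLLSC.vl (W := Dom 𝒪 n) .head p).map f) :=
  implements_map _ f rfl (h _ rfl)

theorem implements_ll_head {c : Retry (HeadVal 𝒪 n) n}
    {f : Retry (HeadVal 𝒪 n) n ⊕ HeadVal 𝒪 n → LocalState 𝒪 n × Option 𝒪.Resp}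
    (h : ∀ X out, RLLSC.LLStep p (Shared.ofMem mem).head c X out →
      Transition p s (Shared.ofMem mem) l ((Shared.ofMem mem).setHead X) (f out).1 (f out).2) :
    Implements p mem s l ((RLLSC.ll (W := Dom 𝒪 n) .head p c).map f) :=
  have ⟨X, hX, hstep⟩ := RLLSC.exec_ll (W := Dom 𝒪 n) mem .head p c
  implements_map _ f (hX ▸ Shared.ofMem_update_head mem X) (h X _ hstep)

theorem implements_ll_announce {j : Fin n} {c : Retry (AnnVal 𝒪) n}
    {f : Retry (AnnVal 𝒪) n ⊕ AnnVal 𝒪 → LocalState 𝒪 n × Option 𝒪.Resp}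
    (h : ∀ X out, RLLSC.LLStep p ((Shared.ofMem mem).ann j) c X out →
      Transition p s (Shared.ofMem mem) l ((Shared.ofMem mem).setAnn j X) (f out).1 (f out).2) :
    Implements p mem s l ((RLLSC.ll (W := Dom 𝒪 n) (.announce j) p c).map f) :=
  have ⟨X, hX, hstep⟩ := RLLSC.exec_ll (W := Dom 𝒪 n) mem (.announce j) p c
  implements_map _ f (hX ▸ Shared.ofMem_update_announce j mem X) (h X _ hstep)

theorem implements_sc_head {x : HeadVal 𝒪 n} {c : Retry (HeadVal 𝒪 n) n}
    {f : Retry (HeadVal 𝒪 n) n ⊕ Bool → LocalState 𝒪 n × Option 𝒪.Resp}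
    (h : ∀ X out, RLLSC.SCStep p x (Shared.ofMem mem).head c X out →
      Transition p s (Shared.ofMem mem) l ((Shared.ofMem mem).setHead X) (f out).1 (f out).2) :
    Implements p mem s l ((RLLSC.sc (W := Dom 𝒪 n) .head p x c).map f) :=
  have ⟨X, hX, hstep⟩ := RLLSC.exec_sc (W := Dom 𝒪 n) mem .head p c x
  implements_map _ f (hX ▸ Shared.ofMem_update_head mem X) (h X _ hstep)

theorem implements_sc_announce {j : Fin n} {x : AnnVal 𝒪} {c : Retry (AnnVal 𝒪) n}
    {f : Retry (AnnVal 𝒪) n ⊕ Bool → LocalState 𝒪 n × Option 𝒪.Resp}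
    (h : ∀ X out, RLLSC.SCStep p x ((Shared.ofMem mem).ann j) c X out →
      Transition p s (Shared.ofMem mem) l ((Shared.ofMem mem).setAnn j X) (f out).1 (f out).2) :
    Implements p mem s l ((RLLSC.sc (W := Dom 𝒪 n) (.announce j) p x c).map f) :=
  have ⟨X, hX, hstep⟩ := RLLSC.exec_sc (W := Dom 𝒪 n) mem (.announce j) p c x
  implements_map _ f (hX ▸ Shared.ofMem_update_announce j mem X) (h X _ hstep)

theorem implements_rl_head {c : Retry (HeadVal 𝒪 n) n}
    {f : Retry (HeadVal 𝒪 n) n ⊕ Bool → LocalState 𝒪 n × Option 𝒪.Resp}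
    (h : ∀ X out, RLLSC.RLStep p (Shared.ofMem mem).head c X out →
      Transition p s (Shared.ofMem mem) l ((Shared.ofMem mem).setHead X) (f out).1 (f out).2) :
    Implements p mem s l ((RLLSC.rl (W := Dom 𝒪 n) .head p c).map f) :=
  have ⟨X, hX, hstep⟩ := RLLSC.exec_rl (W := Dom 𝒪 n) mem .head p c
  implements_map _ f (hX ▸ Shared.ofMem_update_head mem X) (h X _ hstep)

theorem implements_rl_announce {j : Fin n} {c : Retry (AnnVal 𝒪) n}
    {f : Retry (AnnVal 𝒪) n ⊕ Bool → LocalState 𝒪 n × Option 𝒪.Resp}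
    (h : ∀ X out, RLLSC.RLStep p ((Shared.ofMem mem).ann j) c X out →
      Transition p s (Shared.ofMem mem) l ((Shared.ofMem mem).setAnn j X) (f out).1 (f out).2) :
    Implements p mem s l ((RLLSC.rl (W := Dom 𝒪 n) (.announce j) p c).map f) :=
  have ⟨X, hX, hstep⟩ := RLLSC.exec_rl (W := Dom 𝒪 n) mem (.announce j) p c
  implements_map _ f (hX ▸ Shared.ofMem_update_announce j mem X) (h X _ hstep)

variable {k : Fin n} {op : 𝒪.Op} {q st : 𝒪.State} {r rsp : 𝒪.Resp} {j : Fin n} {a : AnnVal 𝒪}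

theorem implements_step_readOnly :
    Implements p mem s ⟨k, .readOnly op⟩ (step p s ⟨k, .readOnly op⟩) := by
  rw [step]
  exact implements_load_head fun _ hv => hv ▸ .readOnly

theorem implements_step_announceOp :
    Implements p mem s ⟨k, .announceOp op⟩ (step p s ⟨k, .announceOp op⟩) := by
  rw [step]
  exact implements_store_announce .announceOp

theorem implements_step_loopTest :
    Implements p mem s ⟨k, .loopTest op⟩ (step p s ⟨k, .loopTest op⟩) := by
  rw [step]
  refine implements_load_announce fun v hv => ?_
  cases v with
  | rsp r => exact .loopTestExit ⟨r, hv⟩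
  | _ => exact .loopTestEnter (by simp [AnnVal.IsRsp, hv])

theorem implements_step_llHead {c : Retry (HeadVal 𝒪 n) n} :
    Implements p mem s ⟨k, .llHead op c⟩ (step p s ⟨k, .llHead op c⟩) := by
  cases s with
  | left =>
    rw [step]
    refine implements_ll_head fun X out h => ?_
    cases h with
    | retry h => exact .llHeadRetry h
    | success =>
      rcases hv : (Shared.ofMem mem).head.val with ⟨q, _ | ⟨r, j⟩⟩
      · exact .llHeadBot hv
      · exact .llHeadHeld hv
  | right =>
    rw [step]
    refine implements_load_announce fun v hv => ?_
    cases v with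
    | rsp r => exact .llHeadExit ⟨r, hv⟩
    | _ => exact .llHeadWait (by simp [AnnVal.IsRsp, hv])

theorem implements_step_loadHelp :
    Implements p mem s ⟨k, .loadHelp op q⟩ (step p s ⟨k, .loadHelp op q⟩) := by
  rw [step]
  refine implements_load_announce fun v hv => ?_
  cases v with
  | op o => exact .loadHelpOp hv
  | _ => exact .loadHelpNone (by simp [hv])

theorem implements_step_loadOwn :
    Implements p mem s ⟨k, .loadOwn op q⟩ (step p s ⟨k, .loadOwn op q⟩) := by
  rw [step]
  refine implements_load_announce fun v hv => ?_
  cases v with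
  | op o => exact .loadOwnOp hv
  | _ => exact .loadOwnNone (by simp [hv])

theorem implements_step_scApply {c : Retry (HeadVal 𝒪 n) n} :
    Implements p mem s ⟨k, .scApply op st rsp j c⟩ (step p s ⟨k, .scApply op st rsp j c⟩) := by
  rw [step]
  refine implements_sc_head fun X out h => ?_
  cases h with
  | retry h hc' => exact .scApplyRetry h hc'
  | unlinked h => exact .scApplyUnlinked h
  | success => exact .scApply

theorem implements_step_llAnnounce {c : Retry (AnnVal 𝒪) n} {d : Option (Retry (AnnVal 𝒪) n)} :
    Implements p mem s ⟨k, .llAnnounce op q rsp j c d⟩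
      (step p s ⟨k, .llAnnounce op q rsp j c d⟩) := by
  cases s with
  | left =>
    rw [step]
    refine implements_ll_announce fun X out h => ?_
    cases h with
    | retry h => rw [Shared.setAnn_ann]; exact .llAnnounceRetry h
    | success => exact .llAnnounce
  | right =>
    cases d with
    | none =>
      rw [step]
      refine implements_load_announce fun v hv => ?_
      cases v with
      | rsp r => exact .llAnnounceExit ⟨r, hv⟩
      | _ => exact .llAnnounceWait (by simp [AnnVal.IsRsp, hv])
    | some d =>
      rw [step]
      refine implements_rl_announce fun X out h => ?_
      cases h with
      | retry h hd' => rw [Shared.setAnn_ann]; exact .llAnnounceRlRetry h hd'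
      | done => exact .llAnnounceRl

theorem implements_step_vlHead :
    Implements p mem s ⟨k, .vlHead op q rsp j a⟩ (step p s ⟨k, .vlHead op q rsp j a⟩) := by
  rw [step]
  refine implements_vl_head fun b hb => ?_
  cases b
  · exact .vlHeadUnlinked hb
  · cases a with
    | op o => exact .vlHeadOp hb
    | _ => exact .vlHeadNotOp hb nofun

theorem implements_step_scAnnounce {c : Retry (AnnVal 𝒪) n} :
    Implements p mem s ⟨k, .scAnnounce op q rsp j a c⟩
      (step p s ⟨k, .scAnnounce op q rsp j a c⟩) := by
  rw [step]
  refine implements_sc_announce fun X out h => ?_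
  cases h with
  | retry h hc' => rw [Shared.setAnn_ann]; exact .scAnnounceRetry h hc'
  | unlinked h => rw [Shared.setAnn_ann]; exact .scAnnounceUnlinked h
  | success => exact .scAnnounce

theorem implements_step_scHeadBot {c : Retry (HeadVal 𝒪 n) n} :
    Implements p mem s ⟨k, .scHeadBot op q j a c⟩ (step p s ⟨k, .scHeadBot op q j a c⟩) := by
  rw [step]
  refine implements_sc_head fun X out h => ?_
  cases h with
  | retry h hc' => exact .scHeadBotRetry h hc'
  | unlinked h => exact .scHeadBotUnlinked h
  | success => exact .scHeadBot

theorem implements_step_rlAnnounce {c : Retry (AnnVal 𝒪) n} :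
    Implements p mem s ⟨k, .rlAnnounce op j c⟩ (step p s ⟨k, .rlAnnounce op j c⟩) := by
  rw [step]
  refine implements_rl_announce fun X out h => ?_
  cases h with
  | retry h hc' => rw [Shared.setAnn_ann]; exact .rlAnnounceRetry h hc'
  | done => exact .rlAnnounce

theorem implements_step_loadResponse :
    Implements p mem s ⟨k, .loadResponse⟩ (step p s ⟨k, .loadResponse⟩) := by
  rw [step]
  refine implements_load_announce fun v hv => ?_
  cases v with
  | rsp r => exact .loadResponse hv
  | _ => exact .loadResponseStuck (by simp [AnnVal.IsRsp, hv])

theorem implements_step_llHeadEnd {c : Retry (HeadVal 𝒪 n) n} :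
    Implements p mem s ⟨k, .llHeadEnd r c⟩ (step p s ⟨k, .llHeadEnd r c⟩) := by
  cases s with
  | left =>
    rw [step]
    refine implements_ll_head fun X out h => ?_
    cases h with
    | retry h => exact .llHeadEndRetry h
    | success =>
      rcases hv : (Shared.ofMem mem).head.val with ⟨q, _ | ⟨rsp, j⟩⟩
      · exact .llHeadEndNotHeld (by simp [Shared.HeldFor, hv])
      · rcases eq_or_ne j p with rfl | hj
        · simpa using .llHeadEndHeld hv
        · simpa [hj] using .llHeadEndNotHeld (by simp [Shared.HeldFor, hv, hj])
  | right =>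
    rw [step]
    refine implements_load_head fun v hv => ?_
    rcases v with ⟨q, _ | ⟨rsp, j⟩⟩
    · exact .llHeadEndExit (by simp [Shared.HeldFor, hv])
    · rcases eq_or_ne j p with rfl | hj
      · simpa using .llHeadEndWait ⟨q, rsp, hv⟩
      · simpa [hj] using .llHeadEndExit (by simp [Shared.HeldFor, hv, hj])

theorem implements_step_scHeadEnd {c : Retry (HeadVal 𝒪 n) n} :
    Implements p mem s ⟨k, .scHeadEnd r q c⟩ (step p s ⟨k, .scHeadEnd r q c⟩) := by
  rw [step]
  refine implements_sc_head fun X out h => ?_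
  cases h with
  | retry h hc' => exact .scHeadEndRetry h hc'
  | unlinked h => exact .scHeadEndUnlinked h
  | success => exact .scHeadEnd

theorem implements_step_rlHead {c : Retry (HeadVal 𝒪 n) n} :
    Implements p mem s ⟨k, .rlHead r c⟩ (step p s ⟨k, .rlHead r c⟩) := by
  rw [step]
  refine implements_rl_head fun X out h => ?_
  cases h with
  | retry h hc' => exact .rlHeadRetry h hc'
  | done => exact .rlHead

theorem implements_step_clearAnnounce :
    Implements p mem s ⟨k, .clearAnnounce r⟩ (step p s ⟨k, .clearAnnounce r⟩) := by
  rw [step]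
  exact implements_store_announce .clearAnnounce

theorem transition_of_step (hl : l.pc ≠ .idle) : Implements p mem s l (step p s l) := by
  obtain ⟨k, pc⟩ := l
  cases pc with
  | idle => exact absurd rfl hl
  | readOnly => exact implements_step_readOnly
  | announceOp => exact implements_step_announceOp
  | loopTest => exact implements_step_loopTest
  | llHead => exact implements_step_llHead
  | loadHelp => exact implements_step_loadHelp
  | loadOwn => exact implements_step_loadOwn
  | scApply => exact implements_step_scApply
  | llAnnounce => exact implements_step_llAnnounce
  | vlHead => exact implements_step_vlHead
  | scAnnounce => exact implements_step_scAnnounce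
  | scHeadBot => exact implements_step_scHeadBot
  | rlAnnounce => exact implements_step_rlAnnounce
  | loadResponse => exact implements_step_loadResponse
  | llHeadEnd => exact implements_step_llHeadEnd
  | scHeadEnd => exact implements_step_scHeadEnd
  | rlHead => exact implements_step_rlHead
  | clearAnnounce => exact implements_step_clearAnnounce

end TransitionStep

end Universal

/-! ## The invariant -/

namespace Universal

variable {𝒪 : AbstractObject.{u}} {n : ℕ}

section ProcInv

variable (M : Shared 𝒪 n) (p : Fin n) (pend : Option 𝒪.Op)

/-- Process `p` executes the state-changing operation `op` and has announced it; the announcement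
may have been replaced by the response. -/
def Looping (op : 𝒪.Op) : Prop :=
  pend = some op ∧ 𝒪.StateChanging op ∧ ((M.ann p).val = .op op ∨ (M.ann p).val.IsRsp)

/-- Process `p` executes a state-changing operation, whose response `r` has been announced. -/
def Finishing (r : 𝒪.Resp) : Prop :=
  (∃ op, pend = some op ∧ 𝒪.StateChanging op) ∧ (M.ann p).val = .rsp r

/-- The invariant of process `p` with pending operation `pend`, by program counter. -/
def ProcInv : PC 𝒪 n → Prop
  | .idle => pend = none ∧ (M.ann p).val = .bot ∧ M.head.context p = false
  | .readOnly op => pend = some op ∧ ¬ 𝒪.StateChanging op ∧ (M.ann p).val = .bot ∧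
      M.head.context p = false
  | .announceOp op => pend = some op ∧ 𝒪.StateChanging op ∧ (M.ann p).val = .bot ∧
      M.head.context p = false
  | .loopTest op => Looping M p pend op
  | .llHead op _ => Looping M p pend op
  | .loadHelp op q => Looping M p pend op ∧ (M.head.context p = true → M.head.val = (q, none))
  | .loadOwn op q => Looping M p pend op ∧ (M.head.context p = true → M.head.val = (q, none))
  | .scApply op st rsp j c => Looping M p pend op ∧ c.Linked p ∧
      (M.head.context p = true →
        ∃ q o, M.head.val = (q, none) ∧ (M.ann j).val = .op o ∧ 𝒪.Δ q o = (st, rsp))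
  | .llAnnounce op q rsp j _ right => Looping M p pend op ∧
      (M.head.context p = true → M.head.val = (q, some (rsp, j))) ∧
      (∀ d, right = some d → (M.ann p).val.IsRsp ∧ d.Linked p)
  | .vlHead op q rsp j a => Looping M p pend op ∧
      (M.head.context p = true → M.head.val = (q, some (rsp, j)) ∧ a ≠ .bot ∧
        ((M.ann j).context p = true ∨ (M.ann j).val.IsRsp) ∧ (a.IsRsp → (M.ann j).val.IsRsp)) ∧
      ((M.ann j).context p = true → (M.ann j).val = a)
  | .scAnnounce op q rsp j a c => Looping M p pend op ∧ c.Linked p ∧ (∃ o, a = .op o) ∧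
      (M.head.context p = true → M.head.val = (q, some (rsp, j)) ∧
        ((M.ann j).context p = true ∨ (M.ann j).val.IsRsp)) ∧
      ((M.ann j).context p = true →
        (∃ o, (M.ann j).val = .op o) ∧ ∃ q', M.head.val = (q', some (rsp, j)))
  | .scHeadBot op q j _ c => Looping M p pend op ∧ c.Linked p ∧
      (M.head.context p = true →
        (∃ rsp, M.head.val = (q, some (rsp, j))) ∧ (M.ann j).val.IsRsp)
  | .rlAnnounce op _ c => Looping M p pend op ∧ c.Linked p
  | .loadResponse => ∃ r, Finishing M p pend r
  | .llHeadEnd r _ => Finishing M p pend r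
  | .scHeadEnd r q c => Finishing M p pend r ∧ c.Linked p ∧
      (M.head.context p = true → ∃ rsp, M.head.val = (q, some (rsp, p))) ∧
      (M.head.context p = false → ¬ M.HeldFor p)
  | .rlHead r c => Finishing M p pend r ∧ c.Linked p ∧ ¬ M.HeldFor p
  | .clearAnnounce r => Finishing M p pend r ∧ ¬ M.HeldFor p ∧ M.head.context p = false

end ProcInv

/-- If `head` holds the response `r` for `j`, then `j` has announced an operation whose response,
if it is already there, is `r`. -/
def HeadInv (M : Shared 𝒪 n) : Prop :=
  ∀ q r j, M.head.val = (q, some (r, j)) →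
    (M.ann j).val ≠ .bot ∧ ∀ r', (M.ann j).val = .rsp r' → r' = r

/-- The program counters at which a process may be linked to an empty announcement of `j`. -/
def BotLink (j : Fin n) : PC 𝒪 n → Prop
  | .vlHead _ _ _ j' a => j' = j ∧ a = .bot
  | .scHeadBot _ _ j' a _ => j' = j ∧ a = .bot
  | .rlAnnounce _ j' _ => j' = j
  | _ => False

/-- The effects that the steps of process `p` have on the shared memory. -/
inductive MemStep (p : Fin n) (M : Shared 𝒪 n) : Shared 𝒪 n → Prop where
  | silent : MemStep p M M
  | headBit (x : Bool) : MemStep p M (M.setHead (M.head.setBit p x))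
  | apply {q o j st rsp} (hhead : M.head.val = (q, none)) (hann : (M.ann j).val = .op o)
      (hΔ : 𝒪.Δ q o = (st, rsp)) : MemStep p M (M.setHead (Cell.fresh (st, some (rsp, j))))
  | headBot {q rsp j} (hhead : M.head.val = (q, some (rsp, j))) (hann : (M.ann j).val.IsRsp) :
      MemStep p M (M.setHead (Cell.fresh (q, none)))
  | annBit (j : Fin n) (x : Bool) : MemStep p M (M.setAnn j ((M.ann j).setBit p x))
  | respond {q o j rsp} (hhead : M.head.val = (q, some (rsp, j))) (hann : (M.ann j).val = .op o) :
      MemStep p M (M.setAnn j (Cell.fresh (.rsp rsp)))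
  | announce {op} (hann : (M.ann p).val = .bot) :
      MemStep p M (M.setAnn p (Cell.fresh (.op op)))
  | clear (hhead : ¬ M.HeldFor p) (hann : (M.ann p).val.IsRsp) :
      MemStep p M (M.setAnn p (Cell.fresh .bot))

/-- What process `i` can rely on when another process changes the shared memory from `M` to
`M'`. -/
structure Rely (i : Fin n) (M M' : Shared 𝒪 n) : Prop where
  head_of_context : M'.head.context i = true → M.head.context i = true ∧ M'.head.val = M.head.val
  ann_of_context : ∀ j, (M'.ann j).context i = true →
    (M.ann j).context i = true ∧ (M'.ann j).val = (M.ann j).val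
  ann_self : (M'.ann i).val = (M.ann i).val ∨ (∃ o, (M.ann i).val = .op o) ∧ (M'.ann i).val.IsRsp
  ann_of_heldFor : ∀ j, M.HeldFor j →
    (M'.ann j).val.IsRsp ∨ (M'.ann j).context i = (M.ann j).context i ∧
      (M'.ann j).val = (M.ann j).val
  ann_of_op : ∀ j o, (M.ann j).val = .op o → M.HeldFor j ∨ (M'.ann j).val = .op o
  head_of_heldFor : ∀ j, M.HeldFor j → (M.ann j).val.IsRsp ∨ M'.head.val = M.head.val
  heldFor_self : (M.ann i).val.IsRsp → M'.HeldFor i →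
    M.HeldFor i ∧ M'.head.context i = M.head.context i

variable {p i : Fin n} {s : Side} {M M' : Shared 𝒪 n} {l l' : LocalState 𝒪 n}
  {r : Option 𝒪.Resp} {pend : Option 𝒪.Op} {pc : PC 𝒪 n}

theorem Transition.memStep (h : Transition p s M l M' l' r) (hp : ProcInv M p pend l.pc) :
    MemStep p M M' := by
  cases h with
  | announceOp => exact .announce hp.2.2.1
  | llHeadBot | llHeadHeld | llHeadEndHeld | llHeadEndNotHeld | rlHead => exact .headBit _
  | llAnnounce | llAnnounceRl | rlAnnounce => exact .annBit _ _
  | scApply =>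
    obtain ⟨q, o, hhead, hann, hΔ⟩ := hp.2.2 (hp.2.1 _ rfl)
    exact .apply hhead hann hΔ
  | scAnnounce =>
    obtain ⟨⟨o, hann⟩, q, hhead⟩ := hp.2.2.2.2 (hp.2.1 _ rfl)
    exact .respond hhead hann
  | scHeadBot =>
    obtain ⟨⟨r, hhead⟩, hann⟩ := hp.2.2 (hp.2.1 _ rfl)
    exact .headBot hhead hann
  | scHeadEnd =>
    obtain ⟨r, hhead⟩ := hp.2.2.1 (hp.2.1 _ rfl)
    exact .headBot hhead ⟨_, hp.1.2⟩
  | clearAnnounce => exact .clear hp.2.1 ⟨_, hp.1.2⟩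
  | _ => exact .silent

theorem MemStep.headInv (h : MemStep p M M') (hM : HeadInv M) : HeadInv M' := by
  cases h with
  | silent | headBit => exact hM
  | _ =>
    grind [HeadInv, Shared.HeldFor, Shared.head_setHead, Shared.ann_setHead, Shared.head_setAnn,
      Shared.ann_setAnn, Cell.val_fresh, Cell.val_setBit]

theorem MemStep.rely (h : MemStep p M M') (hM : HeadInv M) (hi : i ≠ p) : Rely i M M' := by
  cases h <;> constructor <;>
    grind [HeadInv, Shared.HeldFor, AnnVal.IsRsp, Shared.head_setHead, Shared.ann_setHead,
      Shared.head_setAnn, Shared.ann_setAnn, Cell.val_fresh, Cell.context_fresh, Cell.val_setBit,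
      Cell.context_setBit]

theorem Looping.of_rely {op : 𝒪.Op} (h : Looping M i pend op) (hrely : Rely i M M') :
    Looping M' i pend op := by
  grind [Looping, Rely]

theorem Finishing.of_rely {r : 𝒪.Resp} (h : Finishing M i pend r) (hrely : Rely i M M') :
    Finishing M' i pend r := by
  grind [Finishing, Rely]

theorem ProcInv.of_rely (h : ProcInv M i pend pc) (hrely : Rely i M M') : ProcInv M' i pend pc := by
  cases pc with
  | loadResponse => exact h.imp fun _ hr => hr.of_rely hrely
  | _ =>
    simp only [ProcInv] at h ⊢
    grind [Looping.of_rely, Finishing.of_rely, Rely, Shared.HeldFor, AnnVal.IsRsp, Finishing]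

end Universal

namespace Universal

variable {𝒪 : AbstractObject.{u}} {n : ℕ} {p : Fin n} {s : Side} {M M' : Shared 𝒪 n}
  {l l' : LocalState 𝒪 n} {r : Option 𝒪.Resp} {pend : Option 𝒪.Op} {op : 𝒪.Op} {j : Fin n}

theorem procInv_afterHelp (h : Looping M p pend op) (a : AnnVal 𝒪) :
    ProcInv M p pend (afterHelp op j a) := by
  cases a with
  | bot => exact ⟨h, by simp⟩
  | op | rsp => exact h

theorem botLink_afterHelp {j' : Fin n} {a : AnnVal 𝒪} (h : j' = j ∧ a = .bot) :
    BotLink j (afterHelp op j' a) := by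
  obtain ⟨rfl, rfl⟩ := h
  rfl

theorem Transition.procInv (h : Transition p s M l M' l' r) (hM : HeadInv M)
    (hp : ProcInv M p pend l.pc) : ProcInv M' p (if r = none then pend else none) l'.pc := by
  cases h with
  | vlHeadUnlinked | scHeadBotUnlinked => exact procInv_afterHelp hp.1 _
  | @scHeadBot _ _ _ _ q => exact procInv_afterHelp (M := M.setHead (Cell.fresh (q, none))) hp.1 _
  | loopTestExit h => exact h.imp fun r hr => ⟨⟨_, hp.1, hp.2.1⟩, hr⟩
  | llHeadExit h => exact h.imp fun r hr => ⟨⟨_, hp.1, hp.2.1⟩, hr⟩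
  | llAnnounceRl =>
    obtain ⟨r, hr⟩ := (hp.2.2 _ rfl).1
    exact ⟨r, ⟨_, hp.1.1, hp.1.2.1⟩, by rw [Shared.val_ann_setAnn_setBit, hr]⟩
  | @vlHeadNotOp _ _ _ _ _ _ _ a h ha =>
    obtain ⟨hhead, hbot, -, hrsp⟩ := hp.2.1 h
    rcases a with _ | o | r
    · exact absurd rfl hbot
    · exact absurd rfl (ha o)
    · exact ⟨hp.1, by simp, fun _ => ⟨⟨_, hhead⟩, hrsp ⟨r, rfl⟩⟩⟩
  | _ =>
    simp only [ProcInv, if_true] at hp ⊢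
    grind [HeadInv, Looping, Finishing, AnnVal.IsRsp, Shared.HeldFor, Retry.Linked,
      Shared.head_setHead, Shared.ann_setHead, Shared.head_setAnn, Shared.ann_setAnn,
      Cell.val_fresh, Cell.context_fresh, Cell.val_setBit, Cell.context_setBit]

theorem Transition.botLink (h : Transition p s M l M' l' r) (hp : ProcInv M p pend l.pc)
    (hbot : ∀ j, (M.ann j).val = .bot → (M.ann j).context p = true → BotLink j l.pc) :
    ∀ j, (M'.ann j).val = .bot → (M'.ann j).context p = true → BotLink j l'.pc := by
  cases h with
  | vlHeadUnlinked | scHeadBotUnlinked | scHeadBot =>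
    exact fun j hval hctx => botLink_afterHelp (hbot j hval hctx)
  | announceOp | llAnnounce | llAnnounceRl | vlHeadOp | scAnnounceUnlinked | scAnnounce
  | rlAnnounce | clearAnnounce =>
    simp only [ProcInv, BotLink, imp_false] at hp hbot ⊢
    grind [Shared.ann_setHead, Shared.ann_setAnn, Cell.val_fresh, Cell.context_fresh,
      Cell.val_setBit, Cell.context_setBit]
  | _ => exact hbot

/-- The base objects of a configuration. -/
def shared (C : (universalImplementation 𝒪 n).Config) : Shared 𝒪 n := Shared.ofMem C.mem

/-- The local state of a process in a configuration. -/
def localState (C : (universalImplementation 𝒪 n).Config) (p : Fin n) : LocalState 𝒪 n := C.loc p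

/-- The invariant of the universal implementation. -/
structure Inv (C : (universalImplementation 𝒪 n).Config) : Prop where
  proc : ∀ p, ProcInv (shared C) p (C.pending p) (localState C p).pc
  head : HeadInv (shared C)
  bot : ∀ j p, ((shared C).ann j).val = .bot → ((shared C).ann j).context p = true →
    BotLink j (localState C p).pc

/-- The steps from configuration `C` to `C'`, in terms of transitions of single processes. -/
inductive ConfigStep (C C' : (universalImplementation 𝒪 n).Config) : ExecAction 𝒪 n → Prop where
  | invoke (p : Fin n) (o : 𝒪.Op) (hpend : C.pending p = none) (hshared : shared C' = shared C)
      (hlocal : localState C' p = start o (localState C p))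
      (hother : ∀ i ≠ p, localState C' i = localState C i ∧ C'.pending i = C.pending i)
      (hpend' : C'.pending p = some o) : ConfigStep C C' (.invoke p o)
  | step (p : Fin n) (s : Side) (r : Option 𝒪.Resp) (hpend : C.pending p ≠ none)
      (htrans : Transition p s (shared C) (localState C p) (shared C') (localState C' p) r)
      (hother : ∀ i ≠ p, localState C' i = localState C i ∧ C'.pending i = C.pending i)
      (hpend' : C'.pending p = if r = none then C.pending p else none) :
      ConfigStep C C' (.step p s r)

variable {C C' : (universalImplementation 𝒪 n).Config} {a : ExecAction 𝒪 n}

theorem inv_initConfig : Inv (universalImplementation 𝒪 n).initConfig where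
  proc _ := ⟨rfl, rfl, rfl⟩
  head _ _ _ h := by cases h
  bot _ _ _ h := by cases h

theorem Inv.idle_iff (hC : Inv C) (p : Fin n) :
    (localState C p).pc = .idle ↔ C.pending p = none := by
  have hp := hC.proc p
  cases h : (localState C p).pc <;>
    simp only [h, ProcInv, Looping, Finishing, reduceCtorEq, false_iff, true_iff] at hp ⊢ <;>
    grind

theorem Inv.transition (hC : Inv C) (hp : C.pending p ≠ none) (s : Side) :
    Transition p s (shared C) (localState C p)
      (shared ((universalImplementation 𝒪 n).afterStep C p s))
      (localState ((universalImplementation 𝒪 n).afterStep C p s) p)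
      ((universalImplementation 𝒪 n).outcome C p s).2.2 := by
  have h : Implements p C.mem s (localState C p) (step p s (localState C p)) :=
    transition_of_step (mt (hC.idle_iff p).1 hp)
  have hloc : localState ((universalImplementation 𝒪 n).afterStep C p s) p =
      ((universalImplementation 𝒪 n).outcome C p s).2.1 := Function.update_self ..
  rw [hloc]
  exact h

theorem Inv.configStep (hC : Inv C) (h : (universalImplementation 𝒪 n).Step C a C') :
    ConfigStep C C' a := by
  cases h with
  | invoke p o hp =>
    exact .invoke p o hp rfl (Function.update_self ..)
      (fun i hi => ⟨Function.update_of_ne hi .., Function.update_of_ne hi ..⟩)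
      (Function.update_self ..)
  | step p s hp =>
    refine .step p s _ hp (hC.transition hp s) (fun i hi => ⟨Function.update_of_ne hi .., ?_⟩) ?_
    all_goals
      simp only [Implementation.afterStep]
      rcases ((universalImplementation 𝒪 n).outcome C p s).2.2 with _ | _
    · rfl
    · exact Function.update_of_ne hi ..
    · rfl
    · exact Function.update_self ..

theorem procInv_start {o : 𝒪.Op} (hp : ProcInv M p none .idle) :
    ProcInv M p (some o) (start o l).pc := by
  by_cases ho : 𝒪.StateChanging o <;> simpa [start, AbstractObject.ReadOnly, ho, ProcInv] using hp

theorem ConfigStep.inv_of_invoke {o : 𝒪.Op} (h : ConfigStep C C' (.invoke p o)) (hC : Inv C) :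
    Inv C' := by
  obtain ⟨_, _, hpend, hshared, hlocal, hother, hpend'⟩ := h
  have hidle : (localState C p).pc = .idle := (hC.idle_iff p).2 hpend
  refine ⟨fun i => ?_, by rw [hshared]; exact hC.head, fun j i hval hctx => ?_⟩
  · rcases eq_or_ne i p with rfl | hi
    · rw [hshared, hlocal, hpend']
      exact procInv_start (hpend ▸ hidle ▸ hC.proc i)
    · rw [hshared, (hother i hi).1, (hother i hi).2]
      exact hC.proc i
  · rw [hshared] at hval hctx
    have hbot := hC.bot j i hval hctx
    rcases eq_or_ne i p with rfl | hi
    · rw [hidle] at hbot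
      exact hbot.elim
    · rwa [(hother i hi).1]

theorem ConfigStep.inv_of_step (h : ConfigStep C C' (.step p s r)) (hC : Inv C) : Inv C' := by
  obtain ⟨⟩ | ⟨_, _, _, hpend, htrans, hother, hpend'⟩ := h
  have hmem := htrans.memStep (hC.proc p)
  refine ⟨fun i => ?_, hmem.headInv hC.head, fun j i hval hctx => ?_⟩
  · rcases eq_or_ne i p with rfl | hi
    · rw [hpend']
      exact htrans.procInv hC.head (hC.proc i)
    · rw [(hother i hi).1, (hother i hi).2]
      exact (hC.proc i).of_rely (hmem.rely hC.head hi)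
  · rcases eq_or_ne i p with rfl | hi
    · exact htrans.botLink (hC.proc i) (fun j => hC.bot j i) j hval hctx
    · obtain ⟨hctx', hval'⟩ := (hmem.rely hC.head hi).ann_of_context j hctx
      rw [(hother i hi).1]
      exact hC.bot j i (hval' ▸ hval) hctx'

theorem ConfigStep.inv (h : ConfigStep C C' a) (hC : Inv C) : Inv C' := by
  cases a with
  | invoke p o => exact h.inv_of_invoke hC
  | step p s r => exact h.inv_of_step hC

theorem inv_of_reachable (h : Implementation.Reachable C) : Inv C := by
  obtain ⟨as, h⟩ := h
  induction h with
  | nil => exact inv_initConfig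
  | snoc _ hstep ih => exact (ih.configStep hstep).inv ih

end Universal

/-! ## Linearizability and history independence -/

namespace Universal

variable {𝒪 : AbstractObject.{u}} {n : ℕ} {p j : Fin n} {s : Side} {M M' : Shared 𝒪 n}
  {l l' : LocalState 𝒪 n} {r : Option 𝒪.Resp} {rsp : 𝒪.Resp} {o : 𝒪.Op} {q : 𝒪.State}

/-- The response of the pending operation of `j`, if this operation has taken effect: it is held by
`head` until it is announced. -/
def applied (M : Shared 𝒪 n) (j : Fin n) : Option 𝒪.Resp :=
  match (M.ann j).val with
  | .bot => none
  | .rsp r => some r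
  | .op _ =>
    match M.head.val.2 with
    | none => none
    | some (r, j') => if j' = j then some r else none

/-- The atomic object that the shared memory represents. -/
def atomicState (M : Shared 𝒪 n) : AtomicState 𝒪 n where
  state := M.head.val.1
  result := applied M

theorem applied_of_bot (h : (M.ann j).val = .bot) : applied M j = none := by
  simp [applied, h]

theorem applied_of_rsp (h : (M.ann j).val = .rsp rsp) : applied M j = some rsp := by
  simp [applied, h]

theorem applied_of_op_of_head (h : (M.ann j).val = .op o)
    (hhead : M.head.val = (q, some (rsp, j))) : applied M j = some rsp := by
  simp [applied, h, hhead]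

theorem applied_of_op_of_not_heldFor (h : (M.ann j).val = .op o) (hhead : ¬ M.HeldFor j) :
    applied M j = none := by
  rcases hv : M.head.val with ⟨q, _ | ⟨r, j'⟩⟩
  · simp [applied, h, hv]
  · have hne : j' ≠ j := fun e => hhead ⟨q, r, by rw [hv, e]⟩
    simp [applied, h, hv, hne]

theorem applied_congr (hhead : M'.head.val = M.head.val) (hann : (M'.ann j).val = (M.ann j).val) :
    applied M' j = applied M j := by
  simp [applied, hhead, hann]

theorem atomicState_setHead_fresh (st : 𝒪.State) (hann : (M.ann j).val = .op o)
    (hhead : M.head.val = (q, none)) :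
    atomicState (M.setHead (Cell.fresh (st, some (rsp, j)))) =
      ⟨st, Function.update (applied M) j (some rsp)⟩ := by
  refine AtomicState.ext rfl (funext fun k => ?_)
  rcases eq_or_ne k j with rfl | hk
  · exact (applied_of_op_of_head (M := M.setHead (Cell.fresh (st, some (rsp, k)))) hann rfl).trans
      (Function.update_self k (some rsp) (applied M)).symm
  · refine Eq.trans ?_ (Function.update_of_ne hk (some rsp) (applied M)).symm
    simp [atomicState, applied, hhead, Cell.fresh, hk.symm]

theorem atomicState_setHead_none (hhead : M.head.val = (q, some (rsp, j)))
    (hann : (M.ann j).val.IsRsp) :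
    atomicState (M.setHead (Cell.fresh (q, none))) = atomicState M := by
  refine AtomicState.ext (congrArg Prod.fst hhead).symm (funext fun k => ?_)
  rcases eq_or_ne k j with rfl | hk
  · obtain ⟨r, hr⟩ := hann
    exact (applied_of_rsp (M := M.setHead (Cell.fresh (q, none))) hr).trans (applied_of_rsp hr).symm
  · simp [atomicState, applied, hhead, Cell.fresh, hk.symm]

theorem applied_setAnn_of_ne (X : Cell (AnnVal 𝒪) n) {k : Fin n} (hk : k ≠ j) :
    applied (M.setAnn j X) k = applied M k :=
  applied_congr rfl (by rw [Shared.ann_setAnn, if_neg hk])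

theorem atomicState_setAnn {X : Cell (AnnVal 𝒪) n} (h : applied (M.setAnn j X) j = applied M j) :
    atomicState (M.setAnn j X) = atomicState M := by
  refine AtomicState.ext rfl (funext fun k => ?_)
  rcases eq_or_ne k j with rfl | hk
  · exact h
  · exact applied_setAnn_of_ne X hk

theorem atomicState_clear :
    atomicState (M.setAnn p (Cell.fresh .bot)) = (atomicState M).finish p := by
  refine AtomicState.ext rfl (funext fun k => ?_)
  rcases eq_or_ne k p with rfl | hk
  · exact (applied_of_bot (by simp)).trans (Function.update_self k none (applied M)).symm
  · exact (applied_setAnn_of_ne _ hk).trans (Function.update_of_ne hk ..).symm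

theorem MemStep.perform {pending : Fin n → Option 𝒪.Op} (h : MemStep p M M') (hM : HeadInv M)
    (hpend : ∀ j o, (M.ann j).val = .op o → pending j = some o)
    (hp : (M'.ann p).val = .bot → (M.ann p).val = .bot) :
    (atomicState M).Perform pending (atomicState M') := by
  cases h with
  | silent | headBit => exact .none
  | @apply q o j st rsp hhead hann hΔ =>
    have hnone : applied M j = none :=
      applied_of_op_of_not_heldFor hann (by simp [Shared.HeldFor, hhead])
    have happly : atomicState (M.setHead (Cell.fresh (st, some (rsp, j)))) =
        (atomicState M).apply j o := by
      rw [atomicState_setHead_fresh st hann hhead]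
      simp [AtomicState.apply, atomicState, hhead, hΔ]
    exact happly ▸ .apply j o (hpend j o hann) hnone
  | headBot hhead hann => exact atomicState_setHead_none hhead hann ▸ .none
  | annBit j x =>
    exact atomicState_setAnn (applied_congr rfl (Shared.val_ann_setAnn_setBit ..)) ▸ .none
  | respond hhead hann =>
    refine atomicState_setAnn ?_ ▸ .none
    rw [applied_of_op_of_head hann hhead]
    exact applied_of_rsp (by simp)
  | @announce op hann =>
    refine atomicState_setAnn ?_ ▸ .none
    rw [applied_of_bot hann]
    refine applied_of_op_of_not_heldFor (o := op) (by simp) ?_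
    rintro ⟨q, r, hhead⟩
    exact (hM q r p hhead).1 hann
  | clear _ hann =>
    obtain ⟨r, hr⟩ := hann
    simp [hr] at hp

theorem Transition.perform {pending : Fin n → Option 𝒪.Op} (h : Transition p s M l M' l' r)
    (hM : HeadInv M) (hp : ProcInv M p (pending p) l.pc)
    (hpend : ∀ j o, (M.ann j).val = .op o → pending j = some o) :
    ∃ A, (atomicState M).Perform pending A ∧ A.Output p r (atomicState M') := by
  have hmem := h.memStep hp
  cases h with
  | @readOnly _ _ _ op =>
    have hstate : (𝒪.Δ M.head.val.1 op).1 = M.head.val.1 := by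
      by_contra hne
      exact hp.2.1 ⟨_, hne⟩
    have hnone : applied M p = none := applied_of_bot hp.2.2.1
    refine ⟨_, .apply p op hp.1 hnone, Function.update_self .., AtomicState.ext hstate.symm ?_⟩
    exact (Function.update_idem ..).trans (Function.update_eq_self_iff.2 hnone.symm) |>.symm
  | clearAnnounce => exact ⟨_, .none, applied_of_rsp hp.1.2, atomicState_clear⟩
  | _ =>
    refine ⟨_, hmem.perform hM hpend ?_, rfl⟩
    grind [Shared.ann_setHead, Shared.ann_setAnn, Cell.val_setBit, Cell.val_fresh]

theorem ProcInv.pending_of_op {pend : Option 𝒪.Op} {pc : PC 𝒪 n} (h : ProcInv M p pend pc)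
    (ho : (M.ann p).val = .op o) : pend = some o := by
  cases pc <;> simp only [ProcInv, Looping, Finishing, AnnVal.IsRsp, ho] at h <;> grind

/-- An operation takes effect when its response is written into `head`; a read-only operation takes
effect when it reads `head`. -/
noncomputable def linearizationPoints (𝒪 : AbstractObject.{u}) (n : ℕ) :
    Implementation.LinearizationPoints (universalImplementation 𝒪 n) where
  atomic C := atomicState (shared C)
  init := rfl
  invoke _ _ _ _ _ := rfl
  step C p s hC hp := by
    have hinv := inv_of_reachable hC
    exact (hinv.transition hp s).perform hinv.head (hinv.proc p)
      fun j _ ho => (hinv.proc j).pending_of_op ho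

variable {C C' : (universalImplementation 𝒪 n).Config}

theorem Inv.quiescent_proc (hC : Inv C) (hq : C.StateQuiescent) (p : Fin n) :
    ((shared C).ann p).val = .bot ∧ (shared C).head.context p = false ∧
      ∀ j, ¬ BotLink j (localState C p).pc := by
  have hp := hC.proc p
  have hqp := hq p
  cases h : (localState C p).pc <;> rw [h] at hp <;>
    simp only [ProcInv, Looping, Finishing, BotLink] at hp ⊢ <;> grind

theorem Inv.shared_of_stateQuiescent (hC : Inv C) (hq : C.StateQuiescent) :
    shared C = ⟨Cell.fresh ((shared C).head.val.1, none), fun _ => Cell.fresh .bot⟩ := by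
  have hproc := hC.quiescent_proc hq
  refine congrArg₂ Shared.mk (Cell.ext (Prod.ext rfl ?_) (funext fun p => (hproc p).2.1))
    (funext fun j => Cell.ext (hproc j).1 (funext fun p => ?_))
  · rcases h : (shared C).head.val with ⟨q, _ | ⟨r, j⟩⟩
    · exact congrArg Prod.snd h
    · exact absurd (hproc j).1 (hC.head q r j h).1
  · rw [Cell.context_fresh, ← Bool.not_eq_true]
    exact fun h => (hproc p).2.2 j (hC.bot j p (hproc j).1 h)

theorem mem_eq_of_shared_eq (h : shared C = shared C') : C.mem = C'.mem := by
  funext b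
  cases b with
  | head => exact congrArg Shared.head h
  | announce j => exact congrFun (congrArg Shared.ann h) j

theorem linearizable (𝒪 : AbstractObject.{u}) (n : ℕ) :
    (universalImplementation 𝒪 n).Linearizable :=
  (linearizationPoints 𝒪 n).linearizable

theorem stateQuiescentHI (𝒪 : AbstractObject.{u}) (n : ℕ) :
    (universalImplementation 𝒪 n).StateQuiescentHI := by
  refine (linearizationPoints 𝒪 n).historyIndependent fun α hα β hβ heq => mem_eq_of_shared_eq ?_
  have hstate : (shared α.last).head.val.1 = (shared β.last).head.val.1 := heq
  rw [(inv_of_reachable ⟨_, α.reach⟩).shared_of_stateQuiescent hα, hstate]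
  exact ((inv_of_reachable ⟨_, β.reach⟩).shared_of_stateQuiescent hβ).symm

end Universal

/-! ## Progress measures -/

namespace Universal

variable {𝒪 : AbstractObject.{u}} {n : ℕ}

/-- The program counter without the state of its retry loops. -/
def skeleton : PC 𝒪 n → PC 𝒪 n
  | .llHead op _ => .llHead op .read
  | .scApply op st rsp j _ => .scApply op st rsp j .read
  | .llAnnounce op q rsp j _ right => .llAnnounce op q rsp j .read (right.map fun _ => .read)
  | .scAnnounce op q rsp j a _ => .scAnnounce op q rsp j a .read
  | .scHeadBot op q j a _ => .scHeadBot op q j a .read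
  | .rlAnnounce op j _ => .rlAnnounce op j .read
  | .llHeadEnd r _ => .llHeadEnd r .read
  | .scHeadEnd r q _ => .scHeadEnd r q .read
  | .rlHead r _ => .rlHead r .read
  | pc => pc

/-- The position in the program of a process whose response has been announced: it only moves
forwards. -/
def position : PC 𝒪 n → ℕ
  | .idle | .readOnly _ | .announceOp _ => 0
  | .llHead _ _ => 1
  | .loadHelp _ _ => 2
  | .loadOwn _ _ => 3
  | .scApply _ _ _ _ _ => 4
  | .llAnnounce _ _ _ _ _ none => 2
  | .llAnnounce _ _ _ _ _ (some _) => 3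
  | .vlHead _ _ _ _ _ => 4
  | .scAnnounce _ _ _ _ _ _ => 5
  | .scHeadBot _ _ _ _ _ => 6
  | .rlAnnounce _ _ _ => 7
  | .loopTest _ => 8
  | .loadResponse => 9
  | .llHeadEnd _ _ => 10
  | .scHeadEnd _ _ _ => 11
  | .rlHead _ _ => 11
  | .clearAnnounce _ => 12

/-- The position in the program of a process whose operation has no response yet: while the values
of all variables are constant, it only moves forwards. The Boolean `x` is the context bit of the
process in `head`: only a process that has lost its link goes around the loop, and it does so at
most once, since `LL` sets the bit. -/
def openPosition (x : Bool) : PC 𝒪 n → ℕ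
  | .llHead _ _ => 9
  | .loadHelp _ _ => if x then 12 else 2
  | .loadOwn _ _ => if x then 13 else 3
  | .scApply _ _ _ _ _ => if x then 14 else 4
  | .llAnnounce _ _ _ _ _ _ => if x then 12 else 2
  | .vlHead _ _ _ _ _ => if x then 14 else 4
  | .scAnnounce _ _ _ _ _ _ => if x then 15 else 5
  | .scHeadBot _ _ _ _ _ => if x then 16 else 6
  | .rlAnnounce _ _ _ => 7
  | .loopTest _ => 8
  | _ => 0

/-- The position in the program of a process whose announced value is `v` and whose context bit in
`head` is `x`. -/
def rank (v : AnnVal 𝒪) (x : Bool) (pc : PC 𝒪 n) : ℕ :=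
  match v with
  | .bot => 0
  | .op _ => openPosition x pc
  | .rsp _ => position pc

theorem position_le (pc : PC 𝒪 n) : position pc ≤ 12 := by
  unfold position; split <;> omega

theorem rank_le (v : AnnVal 𝒪) (x : Bool) (pc : PC 𝒪 n) : rank v x pc ≤ 16 := by
  cases v with
  | bot => exact Nat.zero_le 16
  | op => simp only [rank]; unfold openPosition; split <;> first | omega | (split_ifs <;> omega)
  | rsp => exact (position_le pc).trans (by omega)

theorem position_skeleton (pc : PC 𝒪 n) : position (skeleton pc) = position pc := by
  cases pc with
  | llAnnounce op q rsp j c right => cases right <;> rfl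
  | _ => rfl

theorem rank_skeleton (v : AnnVal 𝒪) (x : Bool) (pc : PC 𝒪 n) :
    rank v x (skeleton pc) = rank v x pc := by
  cases v with
  | bot => rfl
  | op => cases pc <;> rfl
  | rsp => exact position_skeleton pc

theorem rank_congr (v : AnnVal 𝒪) (x : Bool) {pc pc' : PC 𝒪 n} (h : skeleton pc' = skeleton pc) :
    rank v x pc' = rank v x pc := by
  rw [← rank_skeleton, h, rank_skeleton]

theorem mustServe_congr {l l' : LocalState 𝒪 n} (h : skeleton l'.pc = skeleton l.pc) (s : Side) :
    mustServe s l' ↔ mustServe s l := by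
  have hskel : ∀ l : LocalState 𝒪 n,
      mustServe s { l with pc := skeleton l.pc } ↔ mustServe s l := by
    rintro ⟨k, pc⟩
    cases pc with
    | llAnnounce op q rsp j c right => cases right <;> exact Iff.rfl
    | _ => exact Iff.rfl
  rw [← hskel l', ← hskel l, h]
  rfl

theorem mustServe_right_of_left {l : LocalState 𝒪 n} (h : mustServe .left l) :
    mustServe .right l := by
  obtain ⟨k, pc⟩ := l
  cases pc with
  | llHead | llHeadEnd => trivial
  | llAnnounce op q rsp j c right =>
    cases right with
    | none => trivial
    | some d => cases h
  | _ => exact h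

/-- A step on side `s` executes the retry loop in which the process is stuck while the memory does
not change, rather than the other side of an interleaved block. -/
def Productive (s : Side) : PC 𝒪 n → Prop
  | .llHead _ _ => s = .left
  | .llAnnounce _ _ _ _ _ none => s = .left
  | .llAnnounce _ _ _ _ _ (some _) => s = .right
  | .llHeadEnd _ _ => s = .left
  | _ => True

theorem productive_congr {pc pc' : PC 𝒪 n} (h : skeleton pc' = skeleton pc) (s : Side) :
    Productive s pc' ↔ Productive s pc := by
  have hskel : ∀ pc : PC 𝒪 n, Productive s (skeleton pc) ↔ Productive s pc := by
    intro pc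
    cases pc with
    | llAnnounce op q rsp j c right => cases right <;> exact Iff.rfl
    | _ => exact Iff.rfl
  rw [← hskel pc', h, hskel pc]

theorem exists_mustServe_productive (l : LocalState 𝒪 n) :
    (∀ s, Productive s l.pc) ∨ ∃ s, mustServe s l ∧ Productive s l.pc := by
  obtain ⟨k, pc⟩ := l
  cases pc with
  | llHead | llHeadEnd => exact .inr ⟨.left, trivial, rfl⟩
  | llAnnounce op q rsp j c right =>
    cases right with
    | none => exact .inr ⟨.left, trivial, rfl⟩
    | some d => exact .inr ⟨.right, rfl, rfl⟩
  | _ => exact .inl fun _ => trivial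

/-- All variables of `M` and `M'` have the same values, possibly with different contexts. -/
structure Shared.SameVals (M M' : Shared 𝒪 n) : Prop where
  head : M'.head.val = M.head.val
  ann : ∀ j, (M'.ann j).val = (M.ann j).val

variable {p : Fin n} {s : Side} {M M' : Shared 𝒪 n} {l l' : LocalState 𝒪 n}
  {r : Option 𝒪.Resp} {pend : Option 𝒪.Op} {pc : PC 𝒪 n}

theorem position_lt_afterHelp (op : 𝒪.Op) (j : Fin n) (a : AnnVal 𝒪) :
    6 < position (afterHelp op j a) := by
  cases a <;> simp [afterHelp, position]

theorem Transition.skeleton_or_position_lt (h : Transition p s M l M' l' none)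
    (hp : ProcInv M p pend l.pc) (hann : (M.ann p).val.IsRsp) :
    (skeleton l'.pc = skeleton l.pc ∧ M' = M) ∨ position l.pc < position l'.pc := by
  obtain ⟨r, hr⟩ := hann
  cases h with
  | announceOp => simp [ProcInv, hr] at hp
  | llAnnounce => rename_i d; right; cases d <;> simp [position]
  | vlHeadUnlinked => exact .inr (lt_trans (by simp [position]) (position_lt_afterHelp ..))
  | scHeadBotUnlinked | scHeadBot => exact .inr (position_lt_afterHelp ..)
  | loopTestEnter h => exact absurd ⟨r, hr⟩ h
  | _ => first | exact .inl ⟨rfl, rfl⟩ | exact .inr (by simp [position])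

theorem openPosition_lt_afterHelp (op : 𝒪.Op) (j : Fin n) (a : AnnVal 𝒪) :
    6 < openPosition false (afterHelp op j a) := by
  cases a <;> simp [afterHelp, openPosition]

theorem Transition.skeleton_or_openPosition_lt (h : Transition p s M l M' l' r)
    (hp : ProcInv M p pend l.pc) {o : 𝒪.Op} (hann : (M.ann p).val = .op o) (hv : M.SameVals M') :
    (skeleton l'.pc = skeleton l.pc ∧ M' = M) ∨
      openPosition (M.head.context p) l.pc < openPosition (M'.head.context p) l'.pc := by
  have hrsp : ¬ (M.ann p).val.IsRsp := by rintro ⟨r, hr⟩; rw [hann] at hr; cases hr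
  cases h with
  | vlHeadUnlinked h =>
    rw [h]; exact .inr (lt_trans (by simp [openPosition]) (openPosition_lt_afterHelp ..))
  | scHeadBotUnlinked h => rw [h]; exact .inr (openPosition_lt_afterHelp ..)
  | scApply =>
    obtain ⟨q, o, hhead, -⟩ := hp.2.2 (hp.2.1 _ rfl)
    have := hv.head
    rw [hhead] at this; cases this
  | scHeadBot =>
    obtain ⟨⟨r, hhead⟩, -⟩ := hp.2.2 (hp.2.1 _ rfl)
    have := hv.head
    rw [hhead] at this; cases this
  | scAnnounce =>
    rename_i j _
    obtain ⟨⟨o, hj⟩, -⟩ := hp.2.2.2.2 (hp.2.1 _ rfl)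
    have := hv.ann j
    rw [hj, Shared.ann_setAnn_self] at this; cases this
  | llHeadBot | llHeadHeld => right; simp [openPosition, Cell.context_setBit]
  | scApplyUnlinked h => right; simp [openPosition, h]
  | llAnnounceRlRetry | llAnnounceRl => exact absurd (hp.2.2 _ rfl).1 hrsp
  | llAnnounce =>
    right; rw [Shared.head_setAnn]; simp only [openPosition]; cases M.head.context p <;> simp
  | _ =>
    first
    | exact .inl ⟨rfl, rfl⟩
    | (exfalso; simp_all [ProcInv, Finishing]; done)
    | (right; simp only [openPosition]; cases M.head.context p <;> simp)

theorem Transition.rank_lt (h : Transition p s M l M' l' r) (hp : ProcInv M p pend l.pc)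
    (hv : M.SameVals M') :
    (M' = M ∧ ((M.ann p).val ≠ .bot → skeleton l'.pc = skeleton l.pc)) ∨
      rank (M.ann p).val (M.head.context p) l.pc <
        rank (M'.ann p).val (M'.head.context p) l'.pc := by
  have hvp := hv.ann p
  rw [hvp]
  rcases hval : (M.ann p).val with _ | o | r'
  · left
    cases h <;> simp_all [ProcInv, Looping, Finishing, AnnVal.IsRsp]
  · exact (h.skeleton_or_openPosition_lt hp hval hv).imp_left fun h => ⟨h.2, fun _ => h.1⟩
  · obtain rfl : r = none := by
      cases h <;> simp_all [ProcInv]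
    exact (h.skeleton_or_position_lt hp ⟨_, hval⟩).imp_left fun h => ⟨h.2, fun _ => h.1⟩

/-! ### Retry loops -/

/-- The contents of the base object `b`. -/
def Shared.cell (M : Shared 𝒪 n) : ∀ b : Var n, CellOf 𝒪 n b
  | .head => M.head
  | .announce j => M.ann j

/-- The retry loop that productive steps execute, with the variable that it accesses. -/
def activeLoop : PC 𝒪 n → Option (Σ b : Var n, Retry (Dom 𝒪 n b) n)
  | .llHead _ c => some ⟨.head, c⟩
  | .scApply _ _ _ _ c => some ⟨.head, c⟩
  | .llAnnounce _ _ _ j c none => some ⟨.announce j, c⟩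
  | .llAnnounce _ _ _ j _ (some d) => some ⟨.announce j, d⟩
  | .scAnnounce _ _ _ j _ c => some ⟨.announce j, c⟩
  | .scHeadBot _ _ _ _ c => some ⟨.head, c⟩
  | .rlAnnounce _ j c => some ⟨.announce j, c⟩
  | .llHeadEnd _ c => some ⟨.head, c⟩
  | .scHeadEnd _ _ c => some ⟨.head, c⟩
  | .rlHead _ c => some ⟨.head, c⟩
  | _ => none

/-- The variable accessed by the active retry loop. -/
def activeVar (pc : PC 𝒪 n) : Option (Var n) :=
  (activeLoop pc).map Sigma.fst

theorem activeVar_congr {pc pc' : PC 𝒪 n} (h : skeleton pc' = skeleton pc) :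
    activeVar pc' = activeVar pc := by
  have hskel : ∀ pc : PC 𝒪 n, activeVar (skeleton pc) = activeVar pc := by
    intro pc
    cases pc with
    | llAnnounce op q rsp j c right => cases right <;> rfl
    | _ => rfl
  rw [← hskel pc', h, hskel pc]

open Classical in
/-- The progress of a retry loop on an object with contents `X`; it falls when the contents change
after they have been read. -/
noncomputable def retryProgress {W : Type u} (X : Cell W n) : Retry W n → ℕ
  | .read => 1
  | .cas cur => if cur = X then 2 else 0

theorem retryProgress_le {W : Type u} (X : Cell W n) (c : Retry W n) : retryProgress X c ≤ 2 := by
  unfold retryProgress; split <;> first | omega | (split_ifs <;> omega)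

theorem retryProgress_lt {W : Type u} {X : Cell W n} {c c' : Retry W n}
    (h : Retry.Iterates X c c') : retryProgress X c < retryProgress X c' := by
  cases h with
  | read => simp [retryProgress]
  | fail h => simp [retryProgress, h.symm]

theorem retryProgress_unlinked {W : Type u} {c : Retry W n} (hc : c.Linked p) {X Y : Cell W n}
    (hX : X.context p = false) (hY : Y.context p = false) :
    retryProgress X c = retryProgress Y c := by
  cases c with
  | read => rfl
  | cas cur =>
    have hcur : cur.context p = true := hc cur rfl
    have hneX : cur ≠ X := by rintro rfl; simp [hcur] at hX
    have hneY : cur ≠ Y := by rintro rfl; simp [hcur] at hY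
    simp [retryProgress, hneX, hneY]

/-- The progress of the active retry loop. -/
noncomputable def loopProgress (M : Shared 𝒪 n) (pc : PC 𝒪 n) : ℕ :=
  (activeLoop pc).elim 0 fun ⟨b, c⟩ => retryProgress (M.cell b) c

theorem loopProgress_le (M : Shared 𝒪 n) (pc : PC 𝒪 n) : loopProgress M pc ≤ 2 := by
  unfold loopProgress
  cases activeLoop pc with
  | none => exact Nat.zero_le 2
  | some bc => exact retryProgress_le _ _

theorem loopProgress_congr (h : ∀ b ∈ activeVar pc, M'.cell b = M.cell b) :
    loopProgress M' pc = loopProgress M pc := by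
  unfold loopProgress
  rcases hloop : activeLoop pc with _ | ⟨b, c⟩
  · rfl
  · simp only [Option.elim, h b (by rw [activeVar, hloop]; rfl)]

theorem ProcInv.linked_of_activeLoop (hp : ProcInv M p pend l.pc) (hwait : ¬ mustServe .left l)
    {b : Var n} {c : Retry (Dom 𝒪 n b) n} (hc : activeLoop l.pc = some ⟨b, c⟩) : c.Linked p := by
  obtain ⟨k, pc⟩ := l
  cases pc with
  | llHead | llHeadEnd => exact absurd trivial hwait
  | llAnnounce op q rsp j c right =>
    cases right with
    | none => exact absurd trivial hwait
    | some d => cases hc; exact (hp.2.2 d rfl).2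
  | rlAnnounce => cases hc; exact hp.2
  | scApply | scAnnounce | scHeadBot | scHeadEnd | rlHead => cases hc; exact hp.2.1
  | _ => cases hc

theorem ProcInv.loopProgress_unlinked (hp : ProcInv M p pend l.pc) (hwait : ¬ mustServe .left l)
    {b : Var n} (hb : activeVar l.pc = some b) (hM : (M.cell b).context p = false)
    (hM' : (M'.cell b).context p = false) : loopProgress M' l.pc = loopProgress M l.pc := by
  obtain ⟨⟨b', c⟩, hc, rfl⟩ := Option.map_eq_some_iff.mp hb
  simp only [loopProgress, hc, Option.elim]
  exact retryProgress_unlinked (hp.linked_of_activeLoop hwait hc) hM' hM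

theorem skeleton_afterHelp_ne (op : 𝒪.Op) (j : Fin n) (a : AnnVal 𝒪) {pc : PC 𝒪 n}
    (hpc : position pc ≤ 6) : skeleton (afterHelp op j a) ≠ skeleton pc := by
  intro h
  refine (position_lt_afterHelp op j a).not_ge ?_
  rwa [← position_skeleton, h, position_skeleton]

theorem Transition.loopProgress_of_skeleton (h : Transition p s M l M' l' r)
    (hp : ProcInv M p pend l.pc) (hskel : skeleton l'.pc = skeleton l.pc) :
    loopProgress M l.pc ≤ loopProgress M l'.pc ∧
      (Productive s l.pc → loopProgress M l.pc < loopProgress M l'.pc) := by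
  cases h with
  | vlHeadUnlinked => exact absurd hskel (skeleton_afterHelp_ne _ _ _ (by simp [position]))
  | scHeadBotUnlinked | scHeadBot =>
    exact absurd hskel (skeleton_afterHelp_ne _ _ _ (by simp [position]))
  | loadResponseStuck h =>
    obtain ⟨r, hr⟩ := hp
    exact absurd ⟨r, hr.2⟩ h
  | llHeadRetry h | scApplyRetry h | llAnnounceRlRetry h | scAnnounceRetry h | scHeadBotRetry h
  | rlAnnounceRetry h | llHeadEndRetry h | scHeadEndRetry h | rlHeadRetry h =>
    exact ⟨(retryProgress_lt h).le, fun _ => retryProgress_lt h⟩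
  | llAnnounceRetry h =>
    rename_i d
    cases d with
    | none => exact ⟨(retryProgress_lt h).le, fun _ => retryProgress_lt h⟩
    | some d => exact ⟨le_rfl, fun hs => by cases hs⟩
  | llHeadWait | llAnnounceWait | llHeadEndWait => exact ⟨le_rfl, fun hs => by cases hs⟩
  | _ => simp [skeleton] at hskel

theorem Transition.not_mustServe_left (h : Transition p .right M l M' l' r)
    (hann : (M.ann p).val.IsRsp) (hhead : ¬ M.HeldFor p)
    (hskel : skeleton l'.pc = skeleton l.pc) : ¬ mustServe .left l := by
  cases h with
  | llHeadExit | llAnnounceExit | llHeadEndExit => simp [skeleton] at hskel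
  | llHeadWait h | llAnnounceWait h => exact absurd hann h
  | llHeadEndWait h => exact absurd h hhead
  | llAnnounceRlRetry | llAnnounceRl => exact fun h => by cases h
  | _ => exact id

end Universal

/-! ## Helping -/

namespace Universal

variable {𝒪 : AbstractObject.{u}} {n : ℕ} {p i j : Fin n} {s : Side} {M M' : Shared 𝒪 n}
  {l l' : LocalState 𝒪 n} {r : Option 𝒪.Resp} {pend : Option 𝒪.Op}

theorem MemStep.not_heldFor (h : MemStep p M M') (hj : ∀ o, (M.ann j).val ≠ .op o)
    (hM : ¬ M.HeldFor j) : ¬ M'.HeldFor j := by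
  cases h <;> grind [Shared.HeldFor, Shared.head_setHead, Shared.head_setAnn, Cell.val_fresh,
    Cell.val_setBit]

theorem MemStep.release (h : MemStep p M M') (hM : M.HeldFor j)
    (hv : M'.head.val ≠ M.head.val) : (M.ann j).val.IsRsp ∧ M'.head.val.2 = none := by
  cases h <;> grind [Shared.HeldFor, Shared.head_setHead, Shared.head_setAnn, Cell.val_fresh,
    Cell.val_setBit]

theorem MemStep.acquire (h : MemStep p M M') (hM : M.head.val.2 = none)
    (hv : M'.head.val ≠ M.head.val) : M'.head.val.2 ≠ none := by
  cases h <;> grind [Shared.head_setHead, Shared.head_setAnn, Cell.val_fresh, Cell.val_setBit]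

theorem MemStep.context_of_val_ne (h : MemStep p M M') {b : Var n}
    (hv : (M'.cell b).val ≠ (M.cell b).val) (i : Fin n) : (M'.cell b).context i = false := by
  cases b with
  | head =>
    change M'.head.val ≠ M.head.val at hv
    change M'.head.context i = false
    cases h <;> grind [Shared.head_setHead, Shared.head_setAnn, Cell.val_setBit,
      Cell.context_fresh]
  | announce j =>
    change (M'.ann j).val ≠ (M.ann j).val at hv
    change (M'.ann j).context i = false
    cases h <;> grind [Shared.ann_setHead, Shared.ann_setAnn, Cell.val_setBit,
      Cell.context_fresh]

theorem MemStep.context_of_ne (h : MemStep p M M') (hi : i ≠ p) (b : Var n) :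
    (M'.cell b).context i = (M.cell b).context i ∨ (M'.cell b).context i = false := by
  cases b with
  | head =>
    change M'.head.context i = M.head.context i ∨ M'.head.context i = false
    cases h <;> grind [Shared.head_setHead, Shared.head_setAnn, Cell.context_setBit,
      Cell.context_fresh]
  | announce j =>
    change (M'.ann j).context i = (M.ann j).context i ∨ (M'.ann j).context i = false
    cases h <;> grind [Shared.ann_setHead, Shared.ann_setAnn, Cell.context_setBit,
      Cell.context_fresh]

theorem MemStep.head_context_of_ne (h : MemStep p M M') (hi : i ≠ p)
    (hv : M'.head.val = M.head.val) : M'.head.context i = M.head.context i := by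
  cases h <;> grind [Shared.head_setHead, Shared.head_setAnn, Cell.val_fresh, Cell.context_setBit]

theorem MemStep.ann_val (h : MemStep p M M') (hv : (M'.ann j).val ≠ (M.ann j).val) :
    (∃ o, (M.ann j).val = .op o ∧ (M'.ann j).val.IsRsp ∧ M.HeldFor j) ∨
    ((M.ann j).val = .bot ∧ ∃ o, (M'.ann j).val = .op o) ∨
    ((M.ann j).val.IsRsp ∧ (M'.ann j).val = .bot ∧ ¬ M.HeldFor j) := by
  cases h <;> grind [Shared.ann_setHead, Shared.ann_setAnn, Cell.val_fresh, Cell.val_setBit,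
    AnnVal.IsRsp, Shared.HeldFor]

open Classical in
/-- A measure of how far the value announced by `j` can still change while the value of `head` is
constant: `⊥ → op` and `rsp → ⊥ → op` if `head` holds no response for `j`, and `op → rsp` if it
does. -/
noncomputable def annRank (M : Shared 𝒪 n) (j : Fin n) : ℕ :=
  match (M.ann j).val with
  | .bot => if M.HeldFor j then 0 else 1
  | .op _ => if M.HeldFor j then 0 else 2
  | .rsp _ => if M.HeldFor j then 1 else 0

theorem annRank_le (M : Shared 𝒪 n) (j : Fin n) : annRank M j ≤ 2 := by
  unfold annRank; split <;> split_ifs <;> omega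

theorem MemStep.annRank (h : MemStep p M M') (hM : HeadInv M) (hv : M'.head.val = M.head.val)
    (j : Fin n) : ((M'.ann j).val = (M.ann j).val ∧ annRank M' j = annRank M j) ∨
      annRank M j < annRank M' j := by
  have hheld : M'.HeldFor j ↔ M.HeldFor j := by simp only [Shared.HeldFor, hv]
  by_cases hne : (M'.ann j).val = (M.ann j).val
  · refine .inl ⟨hne, ?_⟩
    unfold Universal.annRank
    rw [hne, propext hheld]
  right
  rcases h.ann_val hne with ⟨o, hop, ⟨r, hrsp⟩, hj⟩ | ⟨hbot, o, hop⟩ | ⟨⟨r, hrsp⟩, hbot, hj⟩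
  · simp [Universal.annRank, hop, hrsp, hheld, hj]
  · have hj : ¬ M.HeldFor j := fun ⟨q, r, hj⟩ => (hM q r j hj).1 hbot
    simp [Universal.annRank, hop, hbot, hheld, hj]
  · simp [Universal.annRank, hrsp, hbot, hheld, hj]

/-- How far a process is from leaving the block in which it accesses `announce[j]`. -/
def visit (j : Fin n) : PC 𝒪 n → ℕ
  | .llAnnounce _ _ _ j' _ _ => if j' = j then 0 else 3
  | .vlHead _ _ _ j' _ => if j' = j then 1 else 3
  | .scAnnounce _ _ _ j' _ _ => if j' = j then 1 else 3
  | .scHeadBot _ _ j' _ _ => if j' = j then 1 else 3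
  | .rlAnnounce _ j' _ => if j' = j then 2 else 3
  | _ => 3

theorem visit_le (j : Fin n) (pc : PC 𝒪 n) : visit j pc ≤ 3 := by
  unfold visit; split <;> first | omega | (split_ifs <;> omega)

theorem visit_start (j : Fin n) (o : 𝒪.Op) (l : LocalState 𝒪 n) : visit j (start o l).pc = 3 := by
  by_cases ho : 𝒪.ReadOnly o <;> simp only [start, ho, if_true, if_false, visit]

theorem le_visit_afterHelp (op : 𝒪.Op) (j k : Fin n) (a : AnnVal 𝒪) :
    (if k = j then 1 else 3) ≤ visit j (afterHelp op k a) := by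
  cases a <;> simp only [afterHelp, visit] <;> split_ifs <;> omega

theorem Transition.visit (h : Transition p s M l M' l' r) (hp : ProcInv M p pend l.pc)
    (hj : ¬ M.HeldFor j) (hv : (M'.ann j).val = (M.ann j).val) :
    (M'.ann j = M.ann j ∧ visit j l.pc ≤ visit j l'.pc) ∨ visit j l.pc < visit j l'.pc := by
  cases h with
  | vlHeadUnlinked | scHeadBotUnlinked | scHeadBot => exact .inl ⟨rfl, le_visit_afterHelp ..⟩
  | announceOp =>
    have hbot := hp.2.2.1
    exact .inl ⟨by grind [Shared.ann_setAnn, Cell.val_fresh], le_rfl⟩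
  | clearAnnounce =>
    have hrsp := hp.1.2
    exact .inl ⟨by grind [Shared.ann_setAnn, Cell.val_fresh], le_rfl⟩
  | llHeadHeld h =>
    rename_i k
    have hne : k ≠ j := by rintro rfl; exact hj ⟨_, _, h⟩
    exact .inl ⟨rfl, by simp [Universal.visit, hne]⟩
  | scAnnounce =>
    obtain ⟨⟨o, hop⟩, -⟩ := hp.2.2.2.2 (hp.2.1 _ rfl)
    exact .inl ⟨by grind [Shared.ann_setAnn, Cell.val_fresh], by simp [Universal.visit]⟩
  | llAnnounce | llAnnounceRl | rlAnnounce =>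
    simp only [Universal.visit, Shared.ann_setAnn]
    grind
  | _ => exact .inl ⟨rfl, le_rfl⟩

theorem Transition.priority (h : Transition p s M l M' l' r) (hp : ProcInv M p pend l.pc) :
    (l'.priority = l.priority ∧ (M.head.val.2 = none → M'.head.val.2 = none)) ∨
    (l'.priority = succMod l.priority ∧ M.head.val.2 = none ∧ M'.head.val.2 ≠ none ∧
      (∃ op, l'.pc = .loopTest op) ∧
      ∃ op st rsp j c, l.pc = .scApply op st rsp j c ∧ M'.HeldFor j) := by
  cases h with
  | scApply =>
    obtain ⟨q, o, hhead, -⟩ := hp.2.2 (hp.2.1 _ rfl)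
    exact .inr ⟨rfl, by rw [hhead], by simp [Cell.fresh], ⟨_, rfl⟩, _, _, _, _, _, rfl, _, _, rfl⟩
  | scHeadBot | scHeadEnd => exact .inl ⟨rfl, fun _ => rfl⟩
  | _ => exact .inl ⟨rfl, id⟩

/-- If the process gives priority to `j`, then it is not about to help anybody else than `j`. -/
def HelpsPriority (j : Fin n) (l : LocalState 𝒪 n) : Prop :=
  l.priority = j →
    match l.pc with
    | .loadOwn _ _ => False
    | .scApply _ _ _ k _ => k = j
    | _ => True

theorem helpsPriority_start (j : Fin n) (o : 𝒪.Op) (l : LocalState 𝒪 n) :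
    HelpsPriority j (start o l) := by
  by_cases ho : 𝒪.ReadOnly o <;> simp [HelpsPriority, start, ho]

theorem Transition.helpsPriority (h : Transition p s M l M' l' r) {o : 𝒪.Op}
    (hj : (M.ann j).val = .op o) (hl : HelpsPriority j l) : HelpsPriority j l' := by
  cases h with
  | loadHelpOp => exact id
  | loadHelpNone h => rintro rfl; exact h _ hj
  | loadOwnOp => exact fun h => (hl h).elim
  | scApplyRetry => exact hl
  | vlHeadUnlinked => rename_i a _; cases a <;> exact fun _ => trivial
  | scHeadBotUnlinked => rename_i a _; cases a <;> exact fun _ => trivial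
  | scHeadBot => rename_i a; cases a <;> exact fun _ => trivial
  | _ => exact fun _ => trivial

end Universal

/-! ## Infinite executions -/

section Eventually

open Filter

variable {α : Type*} {P : ℕ → Prop}

theorem eventually_succ_eq_of_le {f : ℕ → ℕ} {B : ℕ} (hB : ∀ t, f t ≤ B)
    (h : ∀ᶠ t in atTop, f t ≤ f (t + 1)) : ∀ᶠ t in atTop, f (t + 1) = f t := by
  obtain ⟨T, hT⟩ := eventually_atTop.mp h
  have hmono : Monotone fun t => (⟨f (T + t), hB _⟩ : Set.Iic B) :=
    monotone_nat_of_le_succ fun t => hT (T + t) (Nat.le_add_right T t)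
  obtain ⟨k, hk⟩ := WellFoundedGT.monotone_chain_condition ⟨_, hmono⟩
  have hconst : ∀ t, T + k ≤ t → f t = f (T + k) := by
    intro t ht
    have := congrArg Subtype.val (hk (t - T) (by omega))
    simpa [show T + (t - T) = t by omega] using this.symm
  filter_upwards [eventually_ge_atTop (T + k)] with t ht
  rw [hconst t ht, hconst (t + 1) (by omega)]

theorem eventually_of_le_or_lt {f : ℕ → ℕ} {B : ℕ} (hB : ∀ t, f t ≤ B)
    (h : ∀ᶠ t in atTop, (P t ∧ f t ≤ f (t + 1)) ∨ f t < f (t + 1)) : ∀ᶠ t in atTop, P t := by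
  filter_upwards [h, eventually_succ_eq_of_le hB (h.mono fun t ht => ht.elim And.right le_of_lt)]
    with t ht heq
  exact (ht.resolve_right (by omega)).1

theorem eventually_of_frequently_of_succ (hP : ∃ᶠ t in atTop, P t)
    (h : ∀ᶠ t in atTop, P t → P (t + 1)) : ∀ᶠ t in atTop, P t := by
  obtain ⟨T, hT⟩ := eventually_atTop.mp h
  obtain ⟨t₀, ht₀, h₀⟩ := frequently_atTop.mp hP T
  exact eventually_atTop.mpr
    ⟨t₀, fun t ht => Nat.le_induction h₀ (fun m hm => hT m (ht₀.trans hm)) t ht⟩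

theorem exists_eventually_eq_of_succ {f : ℕ → α} (h : ∀ᶠ t in atTop, f (t + 1) = f t) :
    ∃ T, ∀ᶠ t in atTop, f t = f T := by
  obtain ⟨T, hT⟩ := eventually_atTop.mp h
  exact ⟨T, eventually_atTop.mpr
    ⟨T, fun t ht => Nat.le_induction rfl (fun m hm => (hT m hm).trans) t ht⟩⟩

theorem exists_next_of_frequently {f : ℕ → α} (hP : ∃ᶠ t in atTop, P t)
    (hf : ∀ t, ¬ P t → f (t + 1) = f t) (T : ℕ) : ∃ t, T ≤ t ∧ P t ∧ f t = f T := by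
  classical
  have hex := frequently_atTop.mp hP T
  obtain ⟨hle, hnext⟩ := Nat.find_spec hex
  have hconst : ∀ t, T ≤ t → t ≤ Nat.find hex → f t = f T := by
    intro t ht
    induction t, ht using Nat.le_induction with
    | base => exact fun _ => rfl
    | succ m hm ih =>
      intro hlt
      rw [hf m fun hPm => Nat.find_min hex hlt ⟨hm, hPm⟩, ih (by omega)]
  exact ⟨_, hle, hnext, hconst _ hle le_rfl⟩

end Eventually

namespace Implementation

variable {𝒪 : AbstractObject.{u}} {n : ℕ} {I : Implementation 𝒪 n} {ρ : I.InfExec} {p : Fin n}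
  {o : 𝒪.Op} {t t' : ℕ}

theorem InfExec.act_eq_invoke_of_history (h : ρ.history t = some (.inv p o)) :
    ρ.act t = .invoke p o := by
  unfold InfExec.history at h
  rcases ha : ρ.act t with ⟨p', o'⟩ | ⟨p', s, _ | r⟩ <;> rw [ha] at h <;> cases h
  rfl

theorem InfExec.pending_succ_of_history (h : ρ.history t = some (.inv p o)) :
    (ρ.cfg (t + 1)).pending p ≠ none := by
  have hstep := ρ.step t
  rw [InfExec.act_eq_invoke_of_history h] at hstep
  generalize ρ.cfg (t + 1) = C' at hstep
  cases hstep
  simp [afterInvoke]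

theorem Step.pending_of_forall_ne_res {C C' : I.Config} {a : ExecAction 𝒪 n} (h : I.Step C a C')
    (hpend : C.pending p ≠ none) (hres : ∀ r, a.event ≠ some (.res p r)) :
    C'.pending p ≠ none ∧ ∀ e, a.event = some e → e.proc ≠ p := by
  cases h with
  | invoke p' o h =>
    have hp : p ≠ p' := by rintro rfl; exact hpend h
    exact ⟨by simpa [afterInvoke, hp] using hpend, fun e he => by cases he; exact hp.symm⟩
  | step p' s h =>
    simp only [afterStep]
    generalize (I.outcome C p' s).2.2 = r at hres
    rcases r with _ | r
    · exact ⟨hpend, fun e he => by cases he⟩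
    · have hp : p ≠ p' := by rintro rfl; exact hres r rfl
      exact ⟨by simpa [hp] using hpend, fun e he => by cases he; exact hp.symm⟩

theorem InfExec.pending_of_not_returns (h : ρ.history t = some (.inv p o))
    (hno : ∀ t' r, ¬ Returns ρ.history t t' r) (ht : t + 1 ≤ t') :
    (ρ.cfg t').pending p ≠ none ∧
      ∀ x, t < x → x < t' → ∀ e, ρ.history x = some e → e.proc ≠ p := by
  induction t', ht using Nat.le_induction with
  | base => exact ⟨pending_succ_of_history h, fun x hx hx' => by omega⟩
  | succ m hm ih =>
    obtain ⟨hpend, hquiet⟩ := ih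
    obtain ⟨hpend', hevent⟩ := (ρ.step m).pending_of_forall_ne_res hpend
      fun r hr => hno m r ⟨p, o, h, hm, hr, hquiet⟩
    refine ⟨hpend', fun x hx hx' => ?_⟩
    rcases (Nat.lt_succ_iff.mp hx').eq_or_lt with rfl | hlt
    · exact hevent
    · exact hquiet x hx hlt

end Implementation

namespace Universal

open Filter

variable {𝒪 : AbstractObject.{u}} {n : ℕ} {ρ : (universalImplementation 𝒪 n).InfExec}
  {i j p : Fin n} {t : ℕ}

theorem inv_cfg (ρ : (universalImplementation 𝒪 n).InfExec) (t : ℕ) : Inv (ρ.cfg t) :=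
  inv_of_reachable ⟨_, ρ.reach t⟩

theorem configStep (ρ : (universalImplementation 𝒪 n).InfExec) (t : ℕ) :
    ConfigStep (ρ.cfg t) (ρ.cfg (t + 1)) (ρ.act t) :=
  (inv_cfg ρ t).configStep (ρ.step t)

/-- The steps from configuration `C` to `C'`, as seen by process `i`. -/
inductive StepFor (i : Fin n) (C C' : (universalImplementation 𝒪 n).Config)
    (a : ExecAction 𝒪 n) : Prop where
  | invoke (o : 𝒪.Op) (hpend : C.pending i = none) (hshared : shared C' = shared C)
      (hlocal : localState C' i = start o (localState C i)) (hact : ∀ s r, a ≠ .step i s r)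
  | step (s : Side) (r : Option 𝒪.Resp) (hact : a = .step i s r)
      (htrans : Transition i s (shared C) (localState C i) (shared C') (localState C' i) r)
  | other (p : Fin n) (hp : i ≠ p) (hmem : MemStep p (shared C) (shared C'))
      (hlocal : localState C' i = localState C i) (hact : ∀ s r, a ≠ .step i s r)

theorem stepFor (ρ : (universalImplementation 𝒪 n).InfExec) (i : Fin n) (t : ℕ) :
    StepFor i (ρ.cfg t) (ρ.cfg (t + 1)) (ρ.act t) := by
  have h := configStep ρ t
  generalize ρ.act t = a at h
  cases h with
  | invoke p o hpend hshared hlocal hother =>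
    rcases eq_or_ne i p with rfl | hi
    · exact .invoke o hpend hshared hlocal fun s r ha => by cases ha
    · exact .other p hi (hshared ▸ .silent) (hother i hi).1 fun s r ha => by cases ha
  | step p s r hpend htrans hother =>
    rcases eq_or_ne i p with rfl | hi
    · exact .step s r rfl htrans
    · exact .other p hi (htrans.memStep ((inv_cfg ρ t).proc p)) (hother i hi).1
        fun s r ha => by cases ha; exact hi rfl

theorem exists_step_or_shared_eq (ρ : (universalImplementation 𝒪 n).InfExec) (t : ℕ) :
    (∃ p s r, ρ.act t = .step p s r) ∨ shared (ρ.cfg (t + 1)) = shared (ρ.cfg t) := by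
  have h := configStep ρ t
  generalize ρ.act t = a at h
  cases h with
  | invoke p o hpend hshared => exact .inr hshared
  | step p s r => exact .inl ⟨p, s, r, rfl⟩

theorem exists_memStep (ρ : (universalImplementation 𝒪 n).InfExec) (t : ℕ) :
    ∃ p, MemStep p (shared (ρ.cfg t)) (shared (ρ.cfg (t + 1))) := by
  have h := configStep ρ t
  generalize ρ.act t = a at h
  cases h with
  | invoke p o hpend hshared => exact ⟨p, hshared ▸ .silent⟩
  | step p s r hpend htrans => exact ⟨p, htrans.memStep ((inv_cfg ρ t).proc p)⟩

/-- The value of `head` changes infinitely often. -/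
def HeadActive (ρ : (universalImplementation 𝒪 n).InfExec) : Prop :=
  ∃ᶠ t in atTop, (shared (ρ.cfg (t + 1))).head.val ≠ (shared (ρ.cfg t)).head.val

theorem HeadActive.exists_next (h : HeadActive ρ) (T : ℕ) :
    ∃ t, T ≤ t ∧ (shared (ρ.cfg (t + 1))).head.val ≠ (shared (ρ.cfg t)).head.val ∧
      (shared (ρ.cfg t)).head.val = (shared (ρ.cfg T)).head.val :=
  exists_next_of_frequently (f := fun t => (shared (ρ.cfg t)).head.val) h (fun _ => not_not.mp) T

theorem HeadActive.exists_release (h : HeadActive ρ) {T : ℕ}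
    (hT : (shared (ρ.cfg T)).HeldFor j) :
    ∃ t, T ≤ t ∧ ((shared (ρ.cfg t)).ann j).val.IsRsp ∧
      (shared (ρ.cfg (t + 1))).head.val.2 = none := by
  obtain ⟨t, ht, hne, heq⟩ := h.exists_next T
  obtain ⟨p, hmem⟩ := exists_memStep ρ t
  exact ⟨t, ht, hmem.release (by rwa [Shared.HeldFor, heq]) hne⟩

theorem HeadActive.frequently_head_eq_none (h : HeadActive ρ) :
    ∃ᶠ t in atTop, (shared (ρ.cfg t)).head.val.2 = none := by
  refine frequently_atTop.mpr fun T => ?_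
  rcases hv : (shared (ρ.cfg T)).head.val with ⟨q, _ | ⟨r, j⟩⟩
  · exact ⟨T, le_rfl, by rw [hv]⟩
  · obtain ⟨t, ht, -, hnone⟩ := h.exists_release ⟨q, r, hv⟩
    exact ⟨t + 1, by omega, hnone⟩

/-- At time `t`, process `p` applies an operation to the state stored in `head`. -/
def Applies (ρ : (universalImplementation 𝒪 n).InfExec) (p : Fin n) (t : ℕ) : Prop :=
  (∃ s r, ρ.act t = .step p s r) ∧ (shared (ρ.cfg t)).head.val.2 = none ∧
    (shared (ρ.cfg (t + 1))).head.val.2 ≠ none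

theorem HeadActive.exists_frequently_applies (h : HeadActive ρ) :
    ∃ p, ∃ᶠ t in atTop, Applies ρ p t := by
  suffices hfreq : ∃ᶠ t in atTop, ∃ p, Applies ρ p t by
    by_contra! hno
    exact hfreq ((eventually_all.mpr hno).mono fun t ht ⟨p, hp⟩ => ht p hp)
  refine frequently_atTop.mpr fun T => ?_
  obtain ⟨T', hT', hnone⟩ := frequently_atTop.mp h.frequently_head_eq_none T
  obtain ⟨t, ht, hne, heq⟩ := h.exists_next T'
  obtain ⟨p', hmem⟩ := exists_memStep ρ t
  obtain ⟨p, s, r, ha⟩ | heq' := exists_step_or_shared_eq ρ t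
  · have hnone' : (shared (ρ.cfg t)).head.val.2 = none := by rw [heq, hnone]
    exact ⟨t, hT'.trans ht, p, ⟨s, r, ha⟩, hnone', hmem.acquire hnone' hne⟩
  · exact absurd (by rw [heq']) hne

theorem priority_succ_of_not_applies (h : ¬ Applies ρ p t) :
    (localState (ρ.cfg (t + 1)) p).priority = (localState (ρ.cfg t) p).priority := by
  cases stepFor ρ p t with
  | invoke o hpend hshared hlocal => rw [hlocal]; rfl
  | step s r hact htrans =>
    obtain ⟨heq, -⟩ | ⟨-, hnone, hsome, -⟩ := htrans.priority ((inv_cfg ρ t).proc p)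
    · exact heq
    · exact absurd ⟨⟨s, r, hact⟩, hnone, hsome⟩ h
  | other p' hp hmem hlocal => rw [hlocal]

theorem Applies.effect (h : Applies ρ p t) :
    (localState (ρ.cfg (t + 1)) p).priority = succMod (localState (ρ.cfg t) p).priority ∧
    (∃ op, (localState (ρ.cfg (t + 1)) p).pc = .loopTest op) ∧
    ∃ op st rsp j c, (localState (ρ.cfg t) p).pc = .scApply op st rsp j c ∧
      (shared (ρ.cfg (t + 1))).HeldFor j := by
  obtain ⟨⟨s, r, ha⟩, hnone, hsome⟩ := h
  cases stepFor ρ p t with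
  | step s r hact htrans =>
    obtain ⟨-, hkeep⟩ | ⟨hprio, -, -, heffect⟩ := htrans.priority ((inv_cfg ρ t).proc p)
    · exact absurd (hkeep hnone) hsome
    · exact ⟨hprio, heffect⟩
  | invoke _ _ _ _ hact | other _ _ _ _ hact => exact absurd ha (hact s r)

theorem exists_applies_of_priority_add {k T : ℕ} (h : ∃ᶠ t in atTop, Applies ρ p t)
    (hk : ((localState (ρ.cfg T) p).priority.1 + k) % n = j) :
    ∃ t, T ≤ t ∧ Applies ρ p t ∧ (localState (ρ.cfg t) p).priority = j := by
  induction k generalizing T with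
  | zero =>
    obtain ⟨t, ht, happ, hprio⟩ :=
      exists_next_of_frequently (f := fun t => (localState (ρ.cfg t) p).priority) h
        (fun t => priority_succ_of_not_applies) T
    refine ⟨t, ht, happ, Fin.ext ?_⟩
    rw [hprio, ← hk, Nat.add_zero, Nat.mod_eq_of_lt (Fin.is_lt _)]
  | succ k ih =>
    obtain ⟨t, ht, happ, hprio⟩ :=
      exists_next_of_frequently (f := fun t => (localState (ρ.cfg t) p).priority) h
        (fun t => priority_succ_of_not_applies) T
    have hk' : ((localState (ρ.cfg (t + 1)) p).priority.1 + k) % n = j := by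
      rw [happ.effect.1, hprio, ← hk]
      simp only [succMod]
      rw [Nat.mod_add_mod, Nat.add_assoc, Nat.add_comm 1 k]
    obtain ⟨t', ht', happ'⟩ := ih hk'
    exact ⟨t', by omega, happ'⟩

theorem frequently_applies_with_priority (h : ∃ᶠ t in atTop, Applies ρ p t) (j : Fin n) :
    ∃ᶠ t in atTop, Applies ρ p t ∧ (localState (ρ.cfg t) p).priority = j := by
  refine frequently_atTop.mpr fun T => ?_
  have hlt := (localState (ρ.cfg T) p).priority.2
  refine exists_applies_of_priority_add (k := j + n - (localState (ρ.cfg T) p).priority) h ?_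
  rw [Nat.add_sub_cancel' (by omega), Nat.add_mod_right, Nat.mod_eq_of_lt j.2]

theorem helpsPriority_succ {o : 𝒪.Op} (hj : ((shared (ρ.cfg t)).ann j).val = .op o)
    (h : HelpsPriority j (localState (ρ.cfg t) p)) :
    HelpsPriority j (localState (ρ.cfg (t + 1)) p) := by
  cases stepFor ρ p t with
  | invoke o hpend hshared hlocal => rw [hlocal]; exact helpsPriority_start j _ _
  | step s r hact htrans => exact htrans.helpsPriority hj h
  | other p' hp hmem hlocal => rwa [hlocal]

theorem eventually_helpsPriority (h : ∃ᶠ t in atTop, Applies ρ p t)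
    (hj : ∀ᶠ t in atTop, ∃ o, ((shared (ρ.cfg t)).ann j).val = .op o) :
    ∀ᶠ t in atTop, HelpsPriority j (localState (ρ.cfg t) p) := by
  refine eventually_of_frequently_of_succ (frequently_atTop.mpr fun T => ?_)
    (hj.mono fun t ⟨o, ho⟩ => helpsPriority_succ ho)
  obtain ⟨t, ht, happ⟩ := frequently_atTop.mp h T
  obtain ⟨op, hop⟩ := happ.effect.2.1
  exact ⟨t + 1, by omega, fun _ => by rw [hop]; trivial⟩

theorem HeadActive.frequently_ne_op (h : HeadActive ρ) (j : Fin n) :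
    ∃ᶠ t in atTop, ∀ o, ((shared (ρ.cfg t)).ann j).val ≠ .op o := by
  by_contra hforever
  have hop : ∀ᶠ t in atTop, ∃ o, ((shared (ρ.cfg t)).ann j).val = .op o := by
    simpa using hforever
  obtain ⟨p, hp⟩ := h.exists_frequently_applies
  obtain ⟨T, hT⟩ := eventually_atTop.mp (hop.and (eventually_helpsPriority hp hop))
  obtain ⟨t, ht, happ, hprio⟩ := frequently_atTop.mp (frequently_applies_with_priority hp j) T
  obtain ⟨-, -, op, st, rsp, j', c, hpc, hheld⟩ := happ.effect
  obtain rfl : j' = j := by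
    have hhelp := (hT t ht).2 hprio
    rwa [hpc] at hhelp
  obtain ⟨t', ht', ⟨r, hr⟩, -⟩ := h.exists_release hheld
  obtain ⟨o, ho⟩ := (hT t' (by omega)).1
  cases ho.symm.trans hr

theorem HeadActive.eventually_not_heldFor (h : HeadActive ρ)
    (hj : ∀ᶠ t in atTop, ∀ o, ((shared (ρ.cfg t)).ann j).val ≠ .op o) :
    ∀ᶠ t in atTop, ¬ (shared (ρ.cfg t)).HeldFor j := by
  refine eventually_of_frequently_of_succ (h.frequently_head_eq_none.mono ?_) ?_
  · rintro t hnone ⟨q, r, hheld⟩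
    simp [hheld] at hnone
  · filter_upwards [hj] with t ht
    obtain ⟨p, hmem⟩ := exists_memStep ρ t
    exact hmem.not_heldFor ht

theorem HeadActive.eventually_ann_const (h : HeadActive ρ)
    (hval : ∀ᶠ t in atTop, ((shared (ρ.cfg (t + 1))).ann j).val = ((shared (ρ.cfg t)).ann j).val) :
    ∀ᶠ t in atTop, (shared (ρ.cfg (t + 1))).ann j = (shared (ρ.cfg t)).ann j := by
  have hop : ∀ᶠ t in atTop, ∀ o, ((shared (ρ.cfg t)).ann j).val ≠ .op o :=
    eventually_of_frequently_of_succ (h.frequently_ne_op j)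
      (hval.mono fun t ht => by rw [ht]; exact id)
  have hown : ∀ᶠ t in atTop, ∀ p, (∃ s r, ρ.act t = .step p s r) →
      (shared (ρ.cfg (t + 1))).ann j = (shared (ρ.cfg t)).ann j := by
    refine eventually_all.mpr fun p => eventually_of_le_or_lt
      (f := fun t => visit j (localState (ρ.cfg t) p).pc) (fun t => visit_le _ _) ?_
    filter_upwards [hval, h.eventually_not_heldFor hop] with t ht hheld
    cases stepFor ρ p t with
    | invoke o hpend hshared hlocal =>
      rw [hshared, hlocal, visit_start]
      exact .inl ⟨fun _ => rfl, visit_le _ _⟩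
    | step s r hact htrans =>
      exact (htrans.visit ((inv_cfg ρ t).proc p) hheld ht).imp_left fun h => ⟨fun _ => h.1, h.2⟩
    | other p' hp hmem hlocal hact =>
      exact .inl ⟨fun ⟨s, r, ha⟩ => absurd ha (hact s r), by rw [hlocal]⟩
  filter_upwards [hown] with t ht
  obtain ⟨p, hp⟩ | heq := exists_step_or_shared_eq ρ t
  · exact ht p hp
  · rw [heq]

theorem HeadActive.eventually_cell_const (h : HeadActive ρ) {b : Var n}
    (hb : ∀ᶠ t in atTop, ((shared (ρ.cfg t)).cell b).context i = true) :
    ∀ᶠ t in atTop, (shared (ρ.cfg (t + 1))).cell b = (shared (ρ.cfg t)).cell b := by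
  have hval : ∀ᶠ t in atTop,
      ((shared (ρ.cfg (t + 1))).cell b).val = ((shared (ρ.cfg t)).cell b).val := by
    filter_upwards [(tendsto_add_atTop_nat 1).eventually hb] with t ht
    by_contra hne
    obtain ⟨p, hmem⟩ := exists_memStep ρ t
    exact Bool.false_ne_true ((hmem.context_of_val_ne hne i).symm.trans ht)
  cases b with
  | head => exact (h (hval.mono fun t heq hne => hne heq)).elim
  | announce j => exact h.eventually_ann_const hval

end Universal

/-! ## Wait-freedom -/

namespace Universal

open Filter

variable {𝒪 : AbstractObject.{u}} {n : ℕ}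

theorem Transition.ann_ne_bot {p : Fin n} {s : Side} {M M' : Shared 𝒪 n} {l l' : LocalState 𝒪 n}
    {pend : Option 𝒪.Op} (h : Transition p s M l M' l' none) (hp : ProcInv M p pend l.pc) :
    (M'.ann p).val ≠ .bot := by
  cases h <;> grind [ProcInv, Looping, Finishing, AnnVal.IsRsp, Shared.ann_setAnn,
    Shared.ann_setHead, Cell.val_fresh, Cell.val_setBit]

variable {ρ : (universalImplementation 𝒪 n).InfExec} {i : Fin n}

/-- In the fair execution `ρ`, process `i` eventually has a pending operation that never returns,
although `i` takes infinitely many steps. -/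
structure Stuck (ρ : (universalImplementation 𝒪 n).InfExec) (i : Fin n) : Prop where
  fair : ρ.FairInterleaving
  steps : ρ.StepsInfinitely i
  pending : ∀ᶠ t in atTop, (ρ.cfg t).pending i ≠ none
  no_return : ∀ᶠ t in atTop, ∀ s r, ρ.act t = .step i s r → r = none

theorem Stuck.frequently_step (h : Stuck ρ i) : ∃ᶠ t in atTop, ∃ s r, ρ.act t = .step i s r :=
  Nat.frequently_atTop_iff_infinite.mpr h.steps

theorem Stuck.frequently_step_of_mustServe (h : Stuck ρ i) {s : Side}
    (hs : ∀ᶠ t in atTop, mustServe s (localState (ρ.cfg t) i)) :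
    ∃ᶠ t in atTop, ∃ r, ρ.act t = .step i s r := by
  obtain ⟨T₀, hT₀⟩ := eventually_atTop.mp hs
  refine frequently_atTop.mpr fun T => ?_
  obtain ⟨t, r, ht, ha⟩ := h.fair i s (max T₀ T) h.steps fun t ht => hT₀ t (le_of_max_le_left ht)
  exact ⟨t, le_of_max_le_right ht, r, ha⟩

theorem Stuck.step_cases (h : Stuck ρ i) : ∀ᶠ t in atTop,
    (∃ s, ρ.act t = .step i s none ∧ Transition i s (shared (ρ.cfg t)) (localState (ρ.cfg t) i)
      (shared (ρ.cfg (t + 1))) (localState (ρ.cfg (t + 1)) i) none) ∨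
    ((∀ s r, ρ.act t ≠ .step i s r) ∧ localState (ρ.cfg (t + 1)) i = localState (ρ.cfg t) i ∧
      ∃ p, i ≠ p ∧ MemStep p (shared (ρ.cfg t)) (shared (ρ.cfg (t + 1)))) := by
  filter_upwards [h.pending, h.no_return] with t hpend hret
  cases stepFor ρ i t with
  | invoke o hidle => exact absurd hidle hpend
  | step s r hact htrans => obtain rfl := hret s r hact; exact .inl ⟨s, hact, htrans⟩
  | other p hp hmem hlocal hact => exact .inr ⟨hact, hlocal, p, hp, hmem⟩

theorem Stuck.eventually_ne_bot (h : Stuck ρ i) :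
    ∀ᶠ t in atTop, ((shared (ρ.cfg t)).ann i).val ≠ .bot := by
  refine eventually_of_frequently_of_succ (frequently_atTop.mpr fun T => ?_) ?_
  · obtain ⟨t, ht, ⟨s, r, ha⟩, ⟨s', -, htrans⟩ | ⟨hno, -⟩⟩ :=
      frequently_atTop.mp (h.frequently_step.and_eventually h.step_cases) T
    · exact ⟨t + 1, by omega, htrans.ann_ne_bot ((inv_cfg ρ t).proc i)⟩
    · exact absurd ha (hno s r)
  · filter_upwards [h.step_cases] with t ht hbot
    obtain ⟨s, -, htrans⟩ | ⟨-, -, p, hp, hmem⟩ := ht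
    · exact htrans.ann_ne_bot ((inv_cfg ρ t).proc i)
    · obtain heq | ⟨-, r, hr⟩ := (hmem.rely (inv_cfg ρ t).head hp).ann_self
      · rwa [heq]
      · rw [hr]; exact nofun

theorem Stuck.false_of_loopProgress (h : Stuck ρ i) {l : LocalState 𝒪 n}
    (hskel : ∀ᶠ t in atTop, skeleton (localState (ρ.cfg t) i).pc = skeleton l.pc)
    (hown : ∀ᶠ t in atTop, (∃ s r, ρ.act t = .step i s r) →
      shared (ρ.cfg (t + 1)) = shared (ρ.cfg t))
    (hother : ∀ᶠ t in atTop, (∀ s r, ρ.act t ≠ .step i s r) →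
      loopProgress (shared (ρ.cfg t)) (localState (ρ.cfg t) i).pc ≤
        loopProgress (shared (ρ.cfg (t + 1))) (localState (ρ.cfg t) i).pc) : False := by
  have hproductive : ∃ᶠ t in atTop, ∃ s r, ρ.act t = .step i s r ∧ Productive s l.pc := by
    obtain hall | ⟨s, hserve, hs⟩ := exists_mustServe_productive l
    · exact h.frequently_step.mono fun t ⟨s, r, ha⟩ => ⟨s, r, ha, hall s⟩
    · exact (h.frequently_step_of_mustServe (hskel.mono fun t ht =>
        (mustServe_congr ht s).mpr hserve)).mono fun t ⟨r, ha⟩ => ⟨s, r, ha, hs⟩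
  refine hproductive (eventually_of_le_or_lt
    (f := fun t => loopProgress (shared (ρ.cfg t)) (localState (ρ.cfg t) i).pc)
    (fun t => loopProgress_le _ _) ?_)
  filter_upwards [h.step_cases, hskel, (tendsto_add_atTop_nat 1).eventually hskel, hown, hother]
    with t hcases hskel hskel' hown hother
  obtain ⟨s, hact, htrans⟩ | ⟨hno, hlocal, -⟩ := hcases
  · obtain ⟨hle, hlt⟩ := htrans.loopProgress_of_skeleton ((inv_cfg ρ t).proc i)
      (hskel'.trans hskel.symm)
    rw [hown ⟨s, none, hact⟩]
    by_cases hs : Productive s l.pc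
    · exact .inr (hlt ((productive_congr hskel s).mpr hs))
    · refine .inl ⟨?_, hle⟩
      rintro ⟨s', r, hact', hs'⟩
      cases hact.symm.trans hact'
      exact hs hs'
  · rw [hlocal]
    exact .inl ⟨fun ⟨s, r, hact, _⟩ => hno s r hact, hother hno⟩

theorem eventually_sameVals_of_not_headActive (h : ¬ HeadActive ρ) :
    ∀ᶠ t in atTop, (shared (ρ.cfg t)).SameVals (shared (ρ.cfg (t + 1))) := by
  have hhead : ∀ᶠ t in atTop, (shared (ρ.cfg (t + 1))).head.val = (shared (ρ.cfg t)).head.val :=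
    (not_frequently.mp h).mono fun t => not_not.mp
  have hann : ∀ᶠ t in atTop, ∀ j,
      ((shared (ρ.cfg (t + 1))).ann j).val = ((shared (ρ.cfg t)).ann j).val := by
    refine eventually_all.mpr fun j => eventually_of_le_or_lt
      (f := fun t => annRank (shared (ρ.cfg t)) j) (fun t => annRank_le _ _) ?_
    filter_upwards [hhead] with t ht
    obtain ⟨p, hmem⟩ := exists_memStep ρ t
    exact (hmem.annRank (inv_cfg ρ t).head ht j).imp_left fun h => ⟨h.1, h.2.ge⟩
  filter_upwards [hhead, hann] with t h₁ h₂ using ⟨h₁, h₂⟩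

theorem Inv.ann_eq_bot {C : (universalImplementation 𝒪 n).Config} (hC : Inv C)
    (hi : C.pending i = none) : ((shared C).ann i).val = .bot := by
  have hproc := hC.proc i
  rw [(hC.idle_iff i).mpr hi] at hproc
  exact hproc.2.1

theorem eventually_step_silent (h : ∀ᶠ t in atTop,
      (shared (ρ.cfg t)).SameVals (shared (ρ.cfg (t + 1)))) (p : Fin n) :
    ∀ᶠ t in atTop, (∃ s r, ρ.act t = .step p s r) →
      shared (ρ.cfg (t + 1)) = shared (ρ.cfg t) ∧ (((shared (ρ.cfg t)).ann p).val ≠ .bot →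
        skeleton (localState (ρ.cfg (t + 1)) p).pc = skeleton (localState (ρ.cfg t) p).pc) := by
  refine eventually_of_le_or_lt (f := fun t => rank ((shared (ρ.cfg t)).ann p).val
    ((shared (ρ.cfg t)).head.context p) (localState (ρ.cfg t) p).pc) (fun t => rank_le _ _ _) ?_
  filter_upwards [h] with t hv
  cases stepFor ρ p t with
  | invoke o hpend hshared hlocal hact =>
    rw [hshared, (inv_cfg ρ t).ann_eq_bot hpend]
    exact .inl ⟨fun ⟨s, r, ha⟩ => absurd ha (hact s r), le_rfl⟩
  | step s r hact htrans =>
    refine (htrans.rank_lt ((inv_cfg ρ t).proc p) hv).imp_left fun ⟨heq, hskel⟩ =>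
      ⟨fun _ => ⟨heq, hskel⟩, ?_⟩
    rw [heq]
    by_cases hbot : ((shared (ρ.cfg t)).ann p).val = .bot
    · rw [hbot]; exact le_rfl
    · exact (rank_congr _ _ (hskel hbot)).ge
  | other p' hp hmem hlocal hact =>
    rw [hlocal, hv.ann p, hmem.head_context_of_ne hp hv.head]
    exact .inl ⟨fun ⟨s, r, ha⟩ => absurd ha (hact s r), le_rfl⟩

theorem Stuck.headActive (h : Stuck ρ i) : HeadActive ρ := by
  by_contra hquiet
  have hvals := eventually_sameVals_of_not_headActive hquiet
  have hsilent := eventually_step_silent hvals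
  have hmem : ∀ᶠ t in atTop, shared (ρ.cfg (t + 1)) = shared (ρ.cfg t) := by
    filter_upwards [eventually_all.mpr hsilent] with t ht
    obtain ⟨p, hp⟩ | heq := exists_step_or_shared_eq ρ t
    · exact (ht p hp).1
    · exact heq
  have hskel : ∀ᶠ t in atTop,
      skeleton (localState (ρ.cfg (t + 1)) i).pc = skeleton (localState (ρ.cfg t) i).pc := by
    filter_upwards [h.step_cases, hsilent i, h.eventually_ne_bot] with t hcases hstep hbot
    obtain ⟨s, hact, -⟩ | ⟨-, hlocal, -⟩ := hcases
    · exact (hstep ⟨s, none, hact⟩).2 hbot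
    · rw [hlocal]
  obtain ⟨T, hT⟩ := exists_eventually_eq_of_succ
    (f := fun t => skeleton (localState (ρ.cfg t) i).pc) hskel
  exact h.false_of_loopProgress hT (hmem.mono fun t ht _ => ht)
    (hmem.mono fun t ht _ => by rw [ht])

theorem Stuck.eventually_isRsp (h : Stuck ρ i) :
    ∀ᶠ t in atTop, ((shared (ρ.cfg t)).ann i).val.IsRsp := by
  refine eventually_of_frequently_of_succ
    (((h.headActive.frequently_ne_op i).and_eventually h.eventually_ne_bot).mono ?_) ?_
  · rintro t ⟨hop, hbot⟩
    cases hv : ((shared (ρ.cfg t)).ann i).val with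
    | bot => exact absurd hv hbot
    | op o => exact absurd hv (hop o)
    | rsp r => exact ⟨r, rfl⟩
  · filter_upwards [(tendsto_add_atTop_nat 1).eventually h.eventually_ne_bot] with t hbot hrsp
    obtain ⟨p, hmem⟩ := exists_memStep ρ t
    by_contra hne
    have hval := hmem.ann_val (j := i) fun heq => hne (heq ▸ hrsp)
    obtain ⟨r, hr⟩ := hrsp
    grind [AnnVal.IsRsp]

theorem Stuck.eventually_skeleton (h : Stuck ρ i) : ∀ᶠ t in atTop,
    skeleton (localState (ρ.cfg (t + 1)) i).pc = skeleton (localState (ρ.cfg t) i).pc ∧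
      ((∃ s r, ρ.act t = .step i s r) → shared (ρ.cfg (t + 1)) = shared (ρ.cfg t)) := by
  refine eventually_of_le_or_lt (f := fun t => position (localState (ρ.cfg t) i).pc)
    (fun t => position_le _) ?_
  filter_upwards [h.step_cases, h.eventually_isRsp] with t hcases hrsp
  obtain ⟨s, -, htrans⟩ | ⟨hno, hlocal, -⟩ := hcases
  · refine (htrans.skeleton_or_position_lt ((inv_cfg ρ t).proc i) hrsp).imp_left fun h =>
      ⟨⟨h.1, fun _ => h.2⟩, ?_⟩
    rw [← position_skeleton, ← h.1, position_skeleton]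
  · rw [hlocal]
    exact .inl ⟨⟨rfl, fun ⟨s, r, ha⟩ => absurd ha (hno s r)⟩, le_rfl⟩

theorem Stuck.frequently_not_mustServe_left (h : Stuck ρ i) :
    ∃ᶠ t in atTop, ¬ mustServe .left (localState (ρ.cfg t) i) := by
  intro hwait
  have hright : ∀ᶠ t in atTop, mustServe .right (localState (ρ.cfg t) i) :=
    hwait.mono fun t ht => mustServe_right_of_left (not_not.mp ht)
  have hrsp := h.eventually_isRsp
  have hheld := h.headActive.eventually_not_heldFor (hrsp.mono fun t ⟨r, hr⟩ o ho => by
    cases hr.symm.trans ho)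
  obtain ⟨t, ⟨r, ha⟩, hcases, hserve, ⟨hskel, -⟩, hrsp, hheld⟩ :=
    ((h.frequently_step_of_mustServe hright).and_eventually (h.step_cases.and (hwait.and
      (h.eventually_skeleton.and (hrsp.and hheld))))).exists
  obtain ⟨s, hact, htrans⟩ | ⟨hno, -⟩ := hcases
  · cases ha.symm.trans hact
    exact hserve (htrans.not_mustServe_left hrsp hheld hskel)
  · exact hno _ _ ha

theorem Stuck.eventually_loopProgress (h : Stuck ρ i) {l : LocalState 𝒪 n}
    (hskel : ∀ᶠ t in atTop, skeleton (localState (ρ.cfg t) i).pc = skeleton l.pc)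
    (hown : ∀ᶠ t in atTop, (∃ s r, ρ.act t = .step i s r) →
      shared (ρ.cfg (t + 1)) = shared (ρ.cfg t))
    (hwait : ¬ mustServe .left l) :
    ∀ᶠ t in atTop, loopProgress (shared (ρ.cfg (t + 1))) (localState (ρ.cfg t) i).pc =
      loopProgress (shared (ρ.cfg t)) (localState (ρ.cfg t) i).pc := by
  have hvar : ∀ᶠ t in atTop, activeVar (localState (ρ.cfg t) i).pc = activeVar l.pc :=
    hskel.mono fun t => activeVar_congr
  rcases hl : activeVar l.pc with _ | b
  · filter_upwards [hvar] with t ht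
    exact loopProgress_congr fun b hb => by rw [ht, hl] at hb; cases hb
  by_cases hlink : ∀ᶠ t in atTop, ((shared (ρ.cfg t)).cell b).context i = true
  · filter_upwards [hvar, h.headActive.eventually_cell_const hlink] with t ht hcell
    exact loopProgress_congr fun b' hb => by rw [ht, hl] at hb; cases hb; exact hcell
  have hunlink : ∀ᶠ t in atTop, ((shared (ρ.cfg t)).cell b).context i = false := by
    refine eventually_of_frequently_of_succ
      ((not_eventually.mp hlink).mono fun t => Bool.eq_false_of_not_eq_true) ?_
    filter_upwards [h.step_cases, hown] with t hcases hown hfalse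
    obtain ⟨s, hact, -⟩ | ⟨-, -, p, hp, hmem⟩ := hcases
    · rwa [hown ⟨s, none, hact⟩]
    · exact (hmem.context_of_ne hp b).elim (fun heq => heq.trans hfalse) id
  filter_upwards [hskel, hvar, hunlink, (tendsto_add_atTop_nat 1).eventually hunlink]
    with t hskel ht hfalse hfalse'
  exact ((inv_cfg ρ t).proc i).loopProgress_unlinked
    (fun hserve => hwait ((mustServe_congr hskel .left).mp hserve)) (ht.trans hl) hfalse hfalse'

theorem not_stuck (ρ : (universalImplementation 𝒪 n).InfExec) (i : Fin n) : ¬ Stuck ρ i := by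
  intro h
  obtain ⟨hskel, hown⟩ := eventually_and.mp h.eventually_skeleton
  obtain ⟨T, hT⟩ := exists_eventually_eq_of_succ
    (f := fun t => skeleton (localState (ρ.cfg t) i).pc) hskel
  have hwait : ¬ mustServe .left (localState (ρ.cfg T) i) := by
    obtain ⟨t, hnot, ht⟩ := (h.frequently_not_mustServe_left.and_eventually hT).exists
    exact fun hserve => hnot ((mustServe_congr ht .left).mpr hserve)
  exact h.false_of_loopProgress hT hown
    ((h.eventually_loopProgress hT hown hwait).mono fun t ht _ => ht.ge)

theorem waitFree (𝒪 : AbstractObject.{u}) (n : ℕ) : (universalImplementation 𝒪 n).WaitFree := by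
  intro ρ hfair t i o hinv hsteps
  by_contra! hno
  have hopen := fun t' => ρ.pending_of_not_returns (t' := t') hinv hno
  refine not_stuck ρ i ⟨hfair, hsteps, ?_, ?_⟩
  · filter_upwards [eventually_ge_atTop (t + 1)] with t' ht' using (hopen t' ht').1
  · filter_upwards [eventually_gt_atTop t] with t' ht' s r hact
    by_contra hr
    obtain ⟨r, rfl⟩ := Option.ne_none_iff_exists'.mp hr
    refine (hopen (t' + 1) (by omega)).2 t' ht' (by omega) (.res i r) ?_ rfl
    rw [Implementation.InfExec.history, hact]
    rfl

end Universal

/-! ## Cardinalities -/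

namespace Universal

/-- The state of an R-LLSC object as a pair of its value and its context. -/
def cellEquiv (W : Type u) (n : ℕ) : Cell W n ≃ W × (Fin n → Bool) where
  toFun c := (c.val, c.context)
  invFun x := ⟨x.1, x.2⟩
  left_inv _ := rfl
  right_inv _ := rfl

theorem card_cell (W : Type u) (n : ℕ) : Nat.card (Cell W n) = Nat.card W * 2 ^ n := by
  simp [Nat.card_congr (cellEquiv W n), Nat.card_prod]

/-- The disjoint union `{⊥} ⊔ O ⊔ R` of announced values as an iterated sum of types. -/
def annValEquiv (𝒪 : AbstractObject.{u}) : AnnVal 𝒪 ≃ Option (𝒪.Op ⊕ 𝒪.Resp) where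
  toFun
    | .bot => none
    | .op o => some (.inl o)
    | .rsp r => some (.inr r)
  invFun
    | none => .bot
    | some (.inl o) => .op o
    | some (.inr r) => .rsp r
  left_inv a := by cases a <;> rfl
  right_inv a := by rcases a with _ | _ | _ <;> rfl

theorem card_headVal (𝒪 : AbstractObject.{u}) (n : ℕ) [Finite 𝒪.Resp] :
    Nat.card (HeadVal 𝒪 n) = Nat.card 𝒪.State * (n * Nat.card 𝒪.Resp + 1) := by
  rw [Nat.card_prod, Finite.card_option, Nat.card_prod, Nat.card_fin, mul_comm n]

theorem card_annVal (𝒪 : AbstractObject.{u}) [Finite 𝒪.Op] [Finite 𝒪.Resp] :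
    Nat.card (AnnVal 𝒪) = Nat.card 𝒪.Op + Nat.card 𝒪.Resp + 1 := by
  rw [Nat.card_congr (annValEquiv 𝒪), Finite.card_option, Nat.card_sum]

end Universal

theorem mainTheorem4 (𝒪 : AbstractObject.{u}) (n : ℕ) :
    (universalImplementation 𝒪 n).Linearizable ∧
    (universalImplementation 𝒪 n).WaitFree ∧
    (universalImplementation 𝒪 n).StateQuiescentHI ∧
    (Finite 𝒪.State → Finite 𝒪.Op → Finite 𝒪.Resp →
      Nat.card ((universalImplementation 𝒪 n).Val Universal.Var.head) =
        Nat.card 𝒪.State * (n * Nat.card 𝒪.Resp + 1) * 2 ^ n ∧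
      ∀ j : Fin n, Nat.card ((universalImplementation 𝒪 n).Val (Universal.Var.announce j)) =
        (Nat.card 𝒪.Op + Nat.card 𝒪.Resp + 1) * 2 ^ n) := by
  refine ⟨Universal.linearizable 𝒪 n, Universal.waitFree 𝒪 n, Universal.stateQuiescentHI 𝒪 n, ?_⟩
  intro _ _ _
  exact ⟨(Universal.card_cell (Universal.HeadVal 𝒪 n) n).trans
      (congrArg (· * 2 ^ n) (Universal.card_headVal 𝒪 n)),
    fun _ => (Universal.card_cell (Universal.AnnVal 𝒪) n).trans
      (congrArg (· * 2 ^ n) (Universal.card_annVal 𝒪))⟩
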